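/- Let $\mathbf R^4_1=\mathbf R^3\times\mathbf R$ with $\langle (v,v_4),(w,w_4)\rangle=v\cdot w-v_4w_4$, and let $d\omega$ be the area measure of the unit sphere $S^2\subset\mathbf R^3$. Let $\Omega\subset S^2$ be a nonempty open set. A spherical graph over $\Omega$ is a map $Y:\overline\Omega\to\mathbf R^4_1$, smooth up to the boundary, which is a space-like immersion on $\Omega$ such that at every $\nu\in\Omega$ the null vector $(\nu,1)$ is orthogonal to the image of $dY_\nu$. Let $\vec H_Y$ be its mean curvature vector, $\mathrm{Area}[Y]$ the area of $Y$ over $\Omega$ in the induced metric, and $\underline Y(\nu)$ the component tangent to $S^2$ at $\nu$ (that is, orthogonal to $\nu$) of the projection of $Y(\nu)$ to $\mathbf R^3$. The spherical graph is called marginally trapped if $\langle\vec H_Y,(\nu,1)\rangle=0$ for all $\nu\in\Omega$. Let $$\beta_1(\Omega)=\inf\Big\{\frac{\int_\Omega(\hat\Delta u)^2\,d\omega}{\int_\Omega|Du|^2\,d\omega}\;:\;u\in W^{2,2}_0(\Omega)\text{ nonconstant}\Big\}$$ be the first buckling eigenvalue of $\Omega$, where $D$ and $\hat\Delta$ are the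 gradient and the Laplacian of $S^2$ and $W^{2,2}_0(\Omega)$ is the completion of $C^\infty_c(\Omega)$ in the $W^{2,2}$ norm; nonconstant means that $Du$ is not almost everywhere zero. Then $\beta_1(\Omega)\ge 2$. Moreover, let $X$ be a spherical graph over $\Omega$ with $\vec H_X\equiv 0$, and let $Y$ be any marginally trapped spherical graph over $\Omega$ with $Y=X$ on $\partial\Omega$. Then $$\mathrm{Area}[X]\le\mathrm{Area}[Y],$$ and, more precisely, $$\tfrac14\,(\beta_1(\Omega)-2)\int_\Omega|\underline X-\underline Y|^2\,d\omega+\mathrm{Area}[X]\le\mathrm{Area}[Y].$$ -/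

import Mathlib

open MeasureTheory Filter Topology Set Module
open scoped Manifold ContDiff ENNReal RealInnerProductSpace

noncomputable section

namespace SphericalGraph

/-- Euclidean three-space. -/
abbrev E3 : Type := EuclideanSpace ℝ (Fin 3)

instance factFinrankE3 : Fact (finrank ℝ E3 = 2 + 1) := ⟨by simp⟩

/-- The unit sphere in Euclidean three-space. -/
abbrev S2 : Type := Metric.sphere (0 : E3) 1

/-- The area measure of the unit sphere. -/
def sphereArea : Measure S2 := (volume : Measure E3).toSphere

/-- The vector space underlying Lorentz-Minkowski space, vectors being written `(v, v₄)`. -/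
abbrev R41 : Type := E3 × ℝ

/-- The Lorentz inner product, of signature `(+, +, +, -)`. -/
def lor (a b : R41) : ℝ := ⟪a.1, b.1⟫ - a.2 * b.2

/-- The null vector `(ν, 1)` at the point `ν` of the sphere. -/
def nullDir (p : S2) : R41 := ((p : E3), 1)

/-- The radially constant extension `x ↦ F (x / |x|)` of a map on the sphere (`0` at the origin).
At points of the sphere its first derivative along tangent vectors is the derivative of `F`, its
radial derivative vanishes, and its second derivative on pairs of tangent vectors is therefore the
covariant Hessian of `F`. -/
def radialExt {V : Type*} [Zero V] (F : S2 → V) (x : E3) : V :=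
  open Classical in
  if h : x = 0 then 0
  else F ⟨‖x‖⁻¹ • x, by
    rw [mem_sphere_zero_iff_norm, norm_smul, norm_inv, norm_norm,
      inv_mul_cancel₀ (norm_ne_zero_iff.mpr h)]⟩

/-- The orthogonal projection of a vector to the tangent plane of the sphere at `p`. -/
def tang (p : S2) (v : E3) : E3 := v - ⟪(p : E3), v⟫ • (p : E3)

/-- An orthonormal basis of the tangent plane of the sphere at `p`. The quantities below that are
computed with it do not depend on its choice. -/
def frame (p : S2) (i : Fin 2) : E3 :=
  (OrthonormalBasis.fromOrthogonalSpanSingleton (𝕜 := ℝ) 2 (v := (p : E3))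
    (ne_zero_of_mem_unit_sphere p) i : E3)

/-! ### Surfaces parameterized over the sphere -/

/-- The differential of `Y` at `p`, to be applied to tangent vectors. -/
def dY (Y : S2 → R41) (p : S2) (v : E3) : R41 := fderiv ℝ (radialExt Y) (p : E3) v

/-- The covariant Hessian of `Y` at `p`, to be applied to tangent vectors. -/
def hessY (Y : S2 → R41) (p : S2) (v w : E3) : R41 :=
  fderiv ℝ (fderiv ℝ (radialExt Y)) (p : E3) v w

/-- The matrix of the induced metric `dY · dY` in an orthonormal basis of the tangent plane of
the sphere. -/
def inducedMetric (Y : S2 → R41) (p : S2) : Matrix (Fin 2) (Fin 2) ℝ :=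
  Matrix.of fun i j => lor (dY Y p (frame p i)) (dY Y p (frame p j))

/-- The component of `w` normal to the surface `Y` at `p`. -/
def normalPart (Y : S2 → R41) (p : S2) (w : R41) : R41 :=
  w - ∑ i, ∑ j, ((inducedMetric Y p)⁻¹ i j * lor w (dY Y p (frame p j))) • dY Y p (frame p i)

/-- The second fundamental form of `Y` at `p`: the normal part of the second derivative. -/
def secondFundamentalForm (Y : S2 → R41) (p : S2) (v w : E3) : R41 :=
  normalPart Y p (hessY Y p v w)

/-- The mean curvature vector: half the trace of the second fundamental form with respect to the
induced metric. -/
def meanCurvature (Y : S2 → R41) (p : S2) : R41 :=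
  (1 / 2 : ℝ) • ∑ i, ∑ j,
    (inducedMetric Y p)⁻¹ i j • secondFundamentalForm Y p (frame p i) (frame p j)

/-- The area of `Y` over `Ω`, as an element of `[0, ∞]`. -/
def area (Y : S2 → R41) (Ω : Set S2) : ℝ≥0∞ :=
  ∫⁻ p in Ω, ENNReal.ofReal (Real.sqrt (inducedMetric Y p).det) ∂sphereArea

/-- `Y` is a spherical graph over `Ω`, parameterized by the inverse of `ν` and smooth up to the
boundary: a space-like immersion of `Ω` for which `(ν, 1)` is normal at the point with
parameter `ν`. -/
structure IsSphericalGraph (Y : S2 → R41) (Ω : Set S2) : Prop where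
  smooth : ContMDiffOn (𝓡 2) 𝓘(ℝ, R41) ∞ Y (closure Ω)
  spacelike : ∀ p ∈ Ω, ∀ v : E3, ⟪(p : E3), v⟫ = 0 → v ≠ 0 → 0 < lor (dY Y p v) (dY Y p v)
  normal : ∀ p ∈ Ω, ∀ v : E3, ⟪(p : E3), v⟫ = 0 → lor (dY Y p v) (nullDir p) = 0

/-- A spherical graph over `Ω` with vanishing mean curvature vector. -/
structure IsZeroMeanCurvatureGraph (X : S2 → R41) (Ω : Set S2) : Prop
    extends IsSphericalGraph X Ω where
  meanCurvature_eq_zero : ∀ p ∈ Ω, meanCurvature X p = 0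

/-- A marginally trapped spherical graph over `Ω`: its mean curvature vector is orthogonal to
the prescribed null normal `(ν, 1)`. -/
structure IsMarginallyTrappedGraph (Y : S2 → R41) (Ω : Set S2) : Prop
    extends IsSphericalGraph Y Ω where
  meanCurvature_orthogonal : ∀ p ∈ Ω, lor (meanCurvature Y p) (nullDir p) = 0

/-! ### The first buckling eigenvalue -/

/-- Smooth functions on the sphere with compact support in `Ω`. -/
def IsTestFunction (Ω : Set S2) (φ : S2 → ℝ) : Prop :=
  ContMDiff (𝓡 2) 𝓘(ℝ, ℝ) ∞ φ ∧ tsupport φ ⊆ Ω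

/-- The gradient on the sphere, as a tangent vector in three-space. -/
def grad (φ : S2 → ℝ) (p : S2) : E3 := gradient (radialExt φ) (p : E3)

/-- Matrices of size three with the Frobenius (Hilbert-Schmidt) norm. -/
abbrev Mat3 : Type := EuclideanSpace ℝ (Fin 3 × Fin 3)

/-- The covariant Hessian on the sphere, as a bilinear form on three-space that vanishes on the
normal direction. -/
def hess (φ : S2 → ℝ) (p : S2) : Mat3 :=
  WithLp.toLp 2 fun ij : Fin 3 × Fin 3 =>
    fderiv ℝ (fderiv ℝ (radialExt φ)) (p : E3)
      (tang p (EuclideanSpace.single ij.1 1)) (tang p (EuclideanSpace.single ij.2 1))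

/-- The trace; the trace of the Hessian is the Laplacian. -/
def tr (A : Mat3) : ℝ := ∑ i : Fin 3, A (i, i)

/-- `u` belongs to `W₀^{2,2}(Ω)`, the completion of the test functions in the `W^{2,2}` norm, and
`G` and `H` are its gradient and its Hessian: test functions converge to `u` in `L²(Ω)` while
their gradients and Hessians converge in `L²(Ω)` to `G` and `H`. -/
def IsW22Zero (Ω : Set S2) (u : S2 → ℝ) (G : S2 → E3) (H : S2 → Mat3) : Prop :=
  MemLp u 2 (sphereArea.restrict Ω) ∧ MemLp G 2 (sphereArea.restrict Ω) ∧ MemLp H 2 (sphereArea.restrict Ω) ∧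
  ∃ φ : ℕ → S2 → ℝ, (∀ n, IsTestFunction Ω (φ n)) ∧
    Tendsto (fun n => eLpNorm (fun p => φ n p - u p) 2 (sphereArea.restrict Ω)) atTop (𝓝 0) ∧
    Tendsto (fun n => eLpNorm (fun p => grad (φ n) p - G p) 2 (sphereArea.restrict Ω)) atTop (𝓝 0) ∧
    Tendsto (fun n => eLpNorm (fun p => hess (φ n) p - H p) 2 (sphereArea.restrict Ω)) atTop (𝓝 0)

/-- The first buckling eigenvalue: the infimum of `∫ (Δu)² / ∫ |Du|²` over the nonconstant `u` in
`W₀^{2,2}(Ω)`, that is, those whose gradient `G` is not almost everywhere zero. -/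
def buckling (Ω : Set S2) : ℝ :=
  sInf {r : ℝ | ∃ (u : S2 → ℝ) (G : S2 → E3) (H : S2 → Mat3), IsW22Zero Ω u G H ∧
    ¬ (G =ᵐ[sphereArea.restrict Ω] 0) ∧
    r = (∫ p in Ω, (tr (H p)) ^ 2 ∂sphereArea) / (∫ p in Ω, ‖G p‖ ^ 2 ∂sphereArea)}

end SphericalGraph

end

/-!
The support function `u(ν) = ⟨W(ν), (ν, 1)⟩` of a map `W` with `⟨dW, (ν, 1)⟩ = 0` has gradient the
tangential part of `W`, and its covariant Hessian differs from the shape form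
`A(v, w) = ⟨dW(v), w⟩` by a multiple of the round metric. The induced metric is `A²`, and the
marginally trapped condition says that `A` is trace-free (`shapeTrace_eq_zero`). Hence a marginally
trapped graph is conformal to the round sphere and its area is its Dirichlet integral
(`area_eq_energy`); if moreover `H = 0`, the graph is a harmonic map (`laplacian_eq_zero`).

Let `W = Y - X`. Being orthogonal to the null direction with trace-free shape form is a linear
condition, so `W` satisfies it too. The Dirichlet integral of `Y` is that of `X`, plus a cross term,
plus that of `W`. The cross term vanishes because `X` is harmonic and `W` is zero on the boundary
(`setIntegral_energy_eq_zero`). The Dirichlet integrand of `W` is half the squared norm of the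
trace-free Hessian of its support function `u` (`energy_eq_hess`), and Bochner's formula `∫ |D²u|² =
∫ (Δu)² - ∫ |Du|²` (`integral_norm_hess_sq`) turns its integral into `1/4 ∫ (Δu)² - 1/2 ∫ |Du|²`,
which is at least `1/4 (β₁ - 2) ∫ |Du|²`, where `Du` is the tangential part of `W`. The bound `β₁ ≥
2` is the same formula together with `(Δu)² ≤ 2 |D²u|²`.

The open set is arbitrary, so there is no divergence theorem on it and `u` has to be approximated by
test functions. Since `W` vanishes on the boundary and has bounded derivative, `W` is `O(d)` for the
distance `d` to the complement of `Ω`. Moreover `u = O(d²)`, because the gradient of `u` is the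
tangential part of `W`. Multiplication by a cutoff function at scale `ε` therefore keeps the first
derivative of `W` and the first two derivatives of `u` bounded (`exists_approximation`), and
dominated convergence passes to the limit.

Calculus on the sphere is done with radially constant extensions. Integration by parts comes from
`integral_fderiv_of_homogeneous`, the divergence theorem for homogeneous functions on space.
-/

noncomputable section

namespace SphericalGraph

/-! ### Radially constant extensions -/

/-- The radial projection `x ↦ x / |x|` onto the sphere; its value at the origin is a junk point of
the sphere. -/
def proj (x : E3) : S2 :=
  open Classical in
  if h : x = 0 then ⟨EuclideanSpace.single 0 1, by simp⟩
  else ⟨‖x‖⁻¹ • x, by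
    rw [mem_sphere_zero_iff_norm, norm_smul, norm_inv, norm_norm,
      inv_mul_cancel₀ (norm_ne_zero_iff.mpr h)]⟩

/-- The open cone over a subset of the sphere, without its vertex. -/
def cone (S : Set S2) : Set E3 := {x | x ≠ 0 ∧ proj x ∈ S}

theorem coe_proj {x : E3} (hx : x ≠ 0) : (proj x : E3) = ‖x‖⁻¹ • x := by
  simp [proj, hx]

theorem norm_coe_S2 (p : S2) : ‖(p : E3)‖ = 1 := by simp

theorem inner_self_S2 (p : S2) : ⟪(p : E3), (p : E3)⟫ = 1 := by
  rw [real_inner_self_eq_norm_sq, norm_coe_S2]; norm_num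

theorem coe_S2_ne_zero (p : S2) : (p : E3) ≠ 0 := ne_zero_of_mem_unit_sphere p

@[simp] theorem proj_coe (p : S2) : proj (p : E3) = p := by
  ext1; rw [coe_proj (coe_S2_ne_zero p), norm_coe_S2]; simp

theorem proj_smul {r : ℝ} (hr : 0 < r) (x : E3) : proj (r • x) = proj x := by
  by_cases hx : x = 0
  · simp [hx]
  · ext1
    rw [coe_proj hx, coe_proj (smul_ne_zero hr.ne' hx), norm_smul, Real.norm_of_nonneg hr.le,
      smul_smul, mul_inv]
    congr 1
    field_simp

section RadialExt

theorem radialExt_of_ne {V : Type*} [Zero V] {x : E3} (hx : x ≠ 0) (F : S2 → V) :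
    radialExt F x = F (proj x) := by
  simp [radialExt, proj, hx]

@[simp] theorem radialExt_coe {V : Type*} [Zero V] (F : S2 → V) (p : S2) :
    radialExt F (p : E3) = F p := by
  rw [radialExt_of_ne (coe_S2_ne_zero p), proj_coe]

theorem radialExt_smul {V : Type*} [Zero V] {r : ℝ} (hr : 0 < r) (F : S2 → V) (x : E3) :
    radialExt F (r • x) = radialExt F x := by
  by_cases hx : x = 0
  · simp [hx]
  · rw [radialExt_of_ne hx, radialExt_of_ne (smul_ne_zero hr.ne' hx), proj_smul hr]

variable {V : Type*} [NormedAddCommGroup V] [NormedSpace ℝ V]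

theorem contMDiffAt_proj {n : WithTop ℕ∞} {x : E3} (hx : x ≠ 0) :
    ContMDiffAt 𝓘(ℝ, E3) (𝓡 2) n proj x := by
  let U : TopologicalSpace.Opens E3 := ⟨{0}ᶜ, isOpen_compl_singleton⟩
  have hU : ∀ y : U, (y : E3) ≠ 0 := fun y => y.2
  have h1 : ContMDiff 𝓘(ℝ, E3) 𝓘(ℝ, E3) n (fun y : U => ‖(y : E3)‖⁻¹ • (y : E3)) := by
    intro y
    have : ContDiffAt ℝ n (fun z : E3 => ‖z‖⁻¹ • z) (y : E3) :=
      ((contDiffAt_norm ℝ (hU y)).inv (norm_ne_zero_iff.mpr (hU y))).smul contDiffAt_id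
    exact this.contMDiffAt.comp y contMDiff_subtype_val.contMDiffAt
  have h2 := ContMDiff.codRestrict_sphere (n := 2) h1 (fun y => by
    rw [mem_sphere_zero_iff_norm, norm_smul, norm_inv, norm_norm,
      inv_mul_cancel₀ (norm_ne_zero_iff.mpr (hU y))])
  have h3 : (fun y : U => proj (y : E3)) = Set.codRestrict (fun y : U => ‖(y : E3)‖⁻¹ • (y : E3))
      (Metric.sphere (0 : E3) 1) (fun y => by
    rw [mem_sphere_zero_iff_norm, norm_smul, norm_inv, norm_norm,
      inv_mul_cancel₀ (norm_ne_zero_iff.mpr (hU y))]) := by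
    ext1 y
    ext1
    rw [coe_proj (hU y)]
    rfl
  have h4 : ContMDiffAt 𝓘(ℝ, E3) (𝓡 2) n (fun y : U => proj (y : E3)) ⟨x, hx⟩ := by
    rw [h3]
    exact h2 _
  exact contMDiffAt_subtype_iff.mp h4

theorem continuousAt_proj {x : E3} (hx : x ≠ 0) : ContinuousAt proj x :=
  (contMDiffAt_proj (n := 0) hx).continuousAt

theorem isOpen_cone {S : Set S2} (hS : IsOpen S) : IsOpen (cone S) := by
  have : ContinuousOn proj ({0}ᶜ : Set E3) := fun x hx =>
    (continuousAt_proj hx).continuousWithinAt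
  exact this.isOpen_inter_preimage isOpen_compl_singleton hS

theorem coe_mem_cone {S : Set S2} {p : S2} : (p : E3) ∈ cone S ↔ p ∈ S := by
  simp [cone, coe_S2_ne_zero p]

theorem contDiffOn_radialExt {n : WithTop ℕ∞} {F : S2 → V} {S : Set S2}
    (hF : ContMDiffOn (𝓡 2) 𝓘(ℝ, V) n F S) : ContDiffOn ℝ n (radialExt F) (cone S) := by
  have h1 : ContMDiffOn 𝓘(ℝ, E3) (𝓡 2) n proj (cone S) := fun x hx =>
    (contMDiffAt_proj hx.1).contMDiffWithinAt
  have h2 : ContMDiffOn 𝓘(ℝ, E3) 𝓘(ℝ, V) n (F ∘ proj) (cone S) := hF.comp h1 (fun x hx => hx.2)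
  exact h2.contDiffOn.congr fun x hx => radialExt_of_ne hx.1 F

theorem contDiffAt_radialExt {n : WithTop ℕ∞} {F : S2 → V} {S : Set S2} (hS : IsOpen S)
    (hF : ContMDiffOn (𝓡 2) 𝓘(ℝ, V) n F S) {x : E3} (hx : x ∈ cone S) :
    ContDiffAt ℝ n (radialExt F) x :=
  (contDiffOn_radialExt hF).contDiffAt ((isOpen_cone hS).mem_nhds hx)

omit [NormedSpace ℝ V] in
theorem radialExt_eventuallyEq {F G : S2 → V} {x : E3} (hx : x ≠ 0) (h : F =ᶠ[𝓝 (proj x)] G) :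
    radialExt F =ᶠ[𝓝 x] radialExt G := by
  filter_upwards [(continuousAt_proj hx).eventually h, isOpen_ne.mem_nhds hx] with y hy hy0
  rw [radialExt_of_ne hy0, radialExt_of_ne hy0, hy]

/-- A map on the sphere is smooth where it is the restriction of a smooth map of space. -/
theorem contMDiffAt_of_eventuallyEq {n : WithTop ℕ∞} {F : S2 → V} {g : E3 → V} {p : S2}
    (hg : ContDiffAt ℝ n g (p : E3)) (h : ∀ᶠ q : S2 in 𝓝 p, F q = g (q : E3)) :
    ContMDiffAt (𝓡 2) 𝓘(ℝ, V) n F p :=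
  (hg.contMDiffAt.comp p (contMDiff_coe_sphere p)).congr_of_eventuallyEq h

/-- Differentiation lowers the degree of homogeneity by one. -/
theorem fderiv_homogeneous {f : E3 → V} {r a : ℝ} (hr : 0 < r)
    (h : ∀ x, f (r • x) = a • f x) (x : E3) :
    fderiv ℝ f (r • x) = (r⁻¹ * a) • fderiv ℝ f x := by
  have h1 : fderiv ℝ (fun y => f (r • y)) x = r • fderiv ℝ f (r • x) := fderiv_comp_smul r
  have h2 : (fun y => f (r • y)) = fun y => a • f y := funext h
  have h3 : fderiv ℝ (fun y => a • f y) x = a • fderiv ℝ f x := by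
    rcases eq_or_ne a 0 with rfl | ha
    · simp
    · let _ := invertibleOfNonzero ha
      exact fderiv_const_smul_of_invertible a
  rw [h2, h3] at h1
  rw [mul_smul, h1, smul_smul, inv_mul_cancel₀ hr.ne', one_smul]

theorem fderiv_radialExt_smul {r : ℝ} (hr : 0 < r) (F : S2 → V) (x : E3) :
    fderiv ℝ (radialExt F) (r • x) = r⁻¹ • fderiv ℝ (radialExt F) x := by
  have := fderiv_homogeneous (a := 1) hr
    (fun x => by rw [one_smul]; exact radialExt_smul hr F x) x
  rwa [mul_one] at this

/-- Radially constant maps have vanishing radial derivative. -/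
theorem fderiv_radialExt_self (F : S2 → V) (x : E3) : fderiv ℝ (radialExt F) x x = 0 := by
  by_cases hd : DifferentiableAt ℝ (radialExt F) x
  · have h1 : HasDerivAt (fun t : ℝ => t • x) x 1 := by
      simpa using (hasDerivAt_id (1 : ℝ)).smul_const x
    have h2 : HasFDerivAt (radialExt F) (fderiv ℝ (radialExt F) x) ((1 : ℝ) • x) := by
      rw [one_smul]; exact hd.hasFDerivAt
    have h3 := h2.comp_hasDerivAt (1 : ℝ) h1
    have h4 : HasDerivAt (radialExt F ∘ fun t : ℝ => t • x) 0 1 := by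
      refine (hasDerivAt_const (1 : ℝ) (radialExt F x)).congr_of_eventuallyEq ?_
      filter_upwards [lt_mem_nhds (zero_lt_one (α := ℝ))] with t ht
      exact radialExt_smul ht F x
    exact h3.unique h4
  · rw [fderiv_zero_of_not_differentiableAt hd]; rfl

/-- Euler's relation for the first derivative of a radially constant map, which is homogeneous of
degree `-1`. -/
theorem fderiv_fderiv_radialExt_self {F : S2 → V} {x : E3}
    (hF : ContDiffAt ℝ 2 (radialExt F) x) (v : E3) :
    fderiv ℝ (fderiv ℝ (radialExt F)) x v x = - fderiv ℝ (radialExt F) x v := by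
  have hd : DifferentiableAt ℝ (fderiv ℝ (radialExt F)) x :=
    (hF.fderiv_right (m := 1) (by norm_num)).differentiableAt (by norm_num)
  have h1 := hd.hasFDerivAt.clm_apply (hasFDerivAt_id x)
  have h2 : (fun y => fderiv ℝ (radialExt F) y (id y)) = fun _ => 0 :=
    funext fun y => fderiv_radialExt_self F y
  rw [h2] at h1
  have h3 := congrArg (fun L => L v) (h1.unique (hasFDerivAt_const 0 x))
  simp at h3
  rw [add_comm] at h3
  exact eq_neg_of_add_eq_zero_left h3

theorem fderiv_fderiv_radialExt_symm {F : S2 → V} {x : E3}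
    (hF : ContDiffAt ℝ 2 (radialExt F) x) (v w : E3) :
    fderiv ℝ (fderiv ℝ (radialExt F)) x v w = fderiv ℝ (fderiv ℝ (radialExt F)) x w v :=
  (hF.isSymmSndFDerivAt (by simp)).eq v w

end RadialExt

/-! ### Integration by parts on the sphere -/

instance : IsFiniteMeasure sphereArea := by unfold sphereArea; infer_instance

instance : sphereArea.IsOpenPosMeasure := by unfold sphereArea; infer_instance

theorem hasFDerivAt_norm_E3 {x : E3} (hx : x ≠ 0) :
    HasFDerivAt (fun y : E3 => ‖y‖) (‖x‖⁻¹ • innerSL ℝ x) x := by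
  have h := (hasStrictFDerivAt_norm_sq x).hasFDerivAt.sqrt (by simpa using hx)
  have h2 : (fun y : E3 => √(‖y‖ ^ 2)) = fun y => ‖y‖ := by
    ext y; exact Real.sqrt_sq (norm_nonneg y)
  rw [h2, Real.sqrt_sq (norm_nonneg x)] at h
  refine h.congr_fderiv ?_
  ext v
  simp
  field_simp

/-- Polar coordinates, for the product of a radial function with a homogeneous one. -/
theorem integral_radial_mul_homogeneous (ψ : ℝ → ℝ) {h : E3 → ℝ} {m : ℕ}
    (hom : ∀ r : ℝ, 0 < r → ∀ x, h (r • x) = (r ^ m)⁻¹ * h x) :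
    ∫ x, ψ ‖x‖ * h x = (∫ p : S2, h p ∂sphereArea) *
      ∫ r in Ioi (0 : ℝ), r ^ 2 * (ψ r * (r ^ m)⁻¹) := by
  have hdim : finrank ℝ E3 - 1 = 2 := by simp
  calc ∫ x, ψ ‖x‖ * h x
      = ∫ x : ({0}ᶜ : Set E3), ψ ‖(x : E3)‖ * h x ∂((volume : Measure E3).comap (↑)) := by
        rw [integral_subtype_comap (measurableSet_singleton _).compl fun x : E3 => ψ ‖x‖ * h x,
          restrict_compl_singleton]
    _ = ∫ z : S2 × Ioi (0 : ℝ), h z.1 * (ψ z.2 * ((z.2 : ℝ) ^ m)⁻¹)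
          ∂((volume : Measure E3).toSphere.prod (.volumeIoiPow (finrank ℝ E3 - 1))) := by
        rw [← (volume : Measure E3).measurePreserving_homeomorphUnitSphereProd.integral_comp
          (Homeomorph.measurableEmbedding _)]
        refine integral_congr_ae (Eventually.of_forall fun x => ?_)
        have hx : 0 < ‖(x : E3)‖ := norm_pos_iff.mpr x.2
        have h1 : (((homeomorphUnitSphereProd E3) x).1 : E3) = ‖(x : E3)‖⁻¹ • (x : E3) := by
          simp
        have h2 := hom _ (inv_pos.mpr hx) (x : E3)
        simp only [homeomorphUnitSphereProd_apply_snd_coe]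
        rw [h1, h2, inv_pow, inv_inv]
        field_simp
    _ = _ := by
        rw [integral_prod_mul (fun p : S2 => h p)
          (fun r : Ioi (0 : ℝ) => ψ r * ((r : ℝ) ^ m)⁻¹)]
        congr 1
        rw [hdim]
        simp only [Measure.volumeIoiPow, ENNReal.ofReal]
        rw [integral_withDensity_eq_integral_smul,
          integral_subtype_comap measurableSet_Ioi
            fun a : ℝ => Real.toNNReal (a ^ 2) • (ψ a * (a ^ m)⁻¹)]
        · refine setIntegral_congr_fun measurableSet_Ioi fun x hx => ?_
          simp only [NNReal.smul_def, Real.coe_toNNReal _ (pow_nonneg (le_of_lt hx) 2), smul_eq_mul]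
        · exact (measurable_subtype_coe.pow_const _).real_toNNReal

/-- The surface integral of a derivative of a function of degree `-2` vanishes: this is the
divergence theorem on spherical shells, where the contributions of the two boundary components
cancel by homogeneity. -/
theorem integral_fderiv_eq_zero_of_degree_two {g : E3 → ℝ}
    (hg : ∀ x, x ≠ 0 → ContDiffAt ℝ 1 g x)
    (hom : ∀ r : ℝ, 0 < r → ∀ x, g (r • x) = (r ^ 2)⁻¹ * g x) (e : E3) :
    ∫ p : S2, fderiv ℝ g p e ∂sphereArea = 0 := by
  let χ : ContDiffBump (2 : ℝ) := ⟨1 / 2, 1, by norm_num, by norm_num⟩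
  have hχ0 : ∀ r : ℝ, r ≤ 1 → χ r = 0 := fun r hr => by
    apply χ.zero_of_le_dist
    change 1 ≤ dist r 2
    rw [Real.dist_eq]
    exact le_trans (by linarith) (neg_le_abs _)
  have hχ3 : ∀ r : ℝ, 3 ≤ r → χ r = 0 := fun r hr => by
    apply χ.zero_of_le_dist
    change 1 ≤ dist r 2
    rw [Real.dist_eq]
    exact le_trans (by linarith) (le_abs_self _)
  have hχc : ContDiff ℝ ∞ (χ : ℝ → ℝ) := χ.contDiff
  have hχd : Differentiable ℝ (χ : ℝ → ℝ) := hχc.differentiable (by simp)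
  have hχ'c : Continuous (deriv (χ : ℝ → ℝ)) := hχc.continuous_deriv (by simp)
  have hdχ0 : ∀ r : ℝ, r < 1 → deriv χ r = 0 := fun r hr => by
    have : (χ : ℝ → ℝ) =ᶠ[𝓝 r] fun _ => 0 := by
      filter_upwards [gt_mem_nhds hr] with s hs using hχ0 s hs.le
    rw [this.deriv_eq]; simp
  have hdχ3 : ∀ r : ℝ, 3 < r → deriv χ r = 0 := fun r hr => by
    have : (χ : ℝ → ℝ) =ᶠ[𝓝 r] fun _ => 0 := by
      filter_upwards [lt_mem_nhds hr] with s hs using hχ3 s hs.le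
    rw [this.deriv_eq]; simp
  -- products with radial cutoffs are integrable
  have key : ∀ (ψ : ℝ → ℝ) (h : E3 → ℝ), Continuous ψ → (∀ r, r < 1 → ψ r = 0) →
      (∀ r, 3 < r → ψ r = 0) → (∀ x, x ≠ 0 → ContinuousAt h x) →
      Integrable (fun x : E3 => ψ ‖x‖ * h x) := by
    intro ψ h hψ h0 h3 hh
    have hc : Continuous (fun x : E3 => ψ ‖x‖ * h x) := by
      rw [continuous_iff_continuousAt]
      intro x
      by_cases hx : x = 0
      · have : (fun x : E3 => ψ ‖x‖ * h x) =ᶠ[𝓝 x] fun _ => 0 := by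
          have : ∀ᶠ y : E3 in 𝓝 x, ‖y‖ < 1 :=
            continuous_norm.continuousAt.eventually (gt_mem_nhds (by simp [hx]))
          filter_upwards [this] with y hy
          rw [h0 _ hy, zero_mul]
        exact continuousAt_const.congr this.symm
      · exact (hψ.comp continuous_norm).continuousAt.mul (hh x hx)
    refine hc.integrable_of_hasCompactSupport ?_
    refine HasCompactSupport.intro (isCompact_closedBall (0 : E3) 3) fun x hx => ?_
    rw [h3 _ (by simpa using hx), zero_mul]
  have hn : ∀ x : E3, x ≠ 0 →
      HasFDerivAt (fun y : E3 => χ ‖y‖) (deriv χ ‖x‖ • (‖x‖⁻¹ • innerSL ℝ x)) x := fun x hx =>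
    (hχd ‖x‖).hasDerivAt.comp_hasFDerivAt x (hasFDerivAt_norm_E3 hx)
  have hn0 : HasFDerivAt (fun y : E3 => χ ‖y‖) (0 : E3 →L[ℝ] ℝ) 0 := by
    refine (hasFDerivAt_const (0 : ℝ) (0 : E3)).congr_of_eventuallyEq ?_
    have : ∀ᶠ y : E3 in 𝓝 0, ‖y‖ < 1 :=
      continuous_norm.continuousAt.eventually (gt_mem_nhds (by simp))
    filter_upwards [this] with y hy using hχ0 _ hy.le
  have hfd : ∀ x : E3, fderiv ℝ (fun y : E3 => χ ‖y‖) x e = deriv χ ‖x‖ * ⟪‖x‖⁻¹ • x, e⟫ := by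
    intro x
    by_cases hx : x = 0
    · subst hx; rw [hn0.fderiv]; simp
    · rw [(hn x hx).fderiv, inner_smul_left]; simp
  have hdg : ∀ x, x ≠ 0 → ContinuousAt (fun y => fderiv ℝ g y e) x := fun x hx =>
    ((hg x hx).fderiv_right (m := 0) (by norm_num)).continuousAt.clm_apply continuousAt_const
  have h0t : ∀ x ∈ tsupport (fun y : E3 => χ ‖y‖), x ≠ 0 := by
    intro x hx h
    have : x ∉ tsupport (fun y : E3 => χ ‖y‖) := by
      rw [notMem_tsupport_iff_eventuallyEq, h]
      have : ∀ᶠ y : E3 in 𝓝 0, ‖y‖ < 1 :=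
        continuous_norm.continuousAt.eventually (gt_mem_nhds (by simp))
      filter_upwards [this] with y hy using hχ0 _ hy.le
    exact this hx
  have ibp := integral_mul_fderiv_eq_neg_fderiv_mul_of_integrable (μ := (volume : Measure E3))
    (f := fun y : E3 => χ ‖y‖) (g := g) (v := e)
    (by
      simp only [hfd, mul_assoc]
      refine key _ _ hχ'c hdχ0 hdχ3 fun x hx => ?_
      have : ContinuousAt (fun y : E3 => ‖y‖⁻¹ • y) x :=
        (continuous_norm.continuousAt.inv₀ (by simpa using hx)).smul continuousAt_id
      exact (this.inner continuousAt_const).mul (hg x hx).continuousAt)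
    (key _ _ hχc.continuous (fun r hr => hχ0 r hr.le) (fun r hr => hχ3 r hr.le) hdg)
    (key _ _ hχc.continuous (fun r hr => hχ0 r hr.le) (fun r hr => hχ3 r hr.le)
      fun x hx => (hg x hx).continuousAt)
    (fun x _ => by
      by_cases hx : x = 0
      · subst hx; exact hn0.differentiableAt
      · exact (hn x hx).differentiableAt)
    (fun x hx => (hg x (h0t x hx)).differentiableAt (by simp))
  simp only [hfd, mul_assoc] at ibp
  rw [integral_radial_mul_homogeneous χ (m := 3),
    integral_radial_mul_homogeneous (deriv χ) (m := 2)]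
    at ibp
  · have e1 : ∫ r in Ioi (0 : ℝ), r ^ 2 * (deriv χ r * (r ^ 2)⁻¹) = 0 := by
      have : ∫ r in Ioi (0 : ℝ), r ^ 2 * (deriv χ r * (r ^ 2)⁻¹) = ∫ r, deriv χ r := by
        rw [← setIntegral_eq_integral_of_forall_compl_eq_zero (s := Ioi (0 : ℝ))
          (f := deriv χ) (fun r hr => hdχ0 r (lt_of_le_of_lt (not_lt.mp hr) zero_lt_one))]
        refine setIntegral_congr_fun measurableSet_Ioi fun r hr => ?_
        have : r ≠ 0 := ne_of_gt hr
        field_simp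
      rw [this]
      exact integral_eq_zero_of_hasDerivAt_of_integrable (fun r => (hχd r).hasDerivAt)
        (hχ'c.integrable_of_hasCompactSupport χ.hasCompactSupport.deriv)
        (hχc.continuous.integrable_of_hasCompactSupport χ.hasCompactSupport)
    have e2 : 0 < ∫ r in Ioi (0 : ℝ), r ^ 2 * (χ r * (r ^ 3)⁻¹) := by
      have : ∫ r in Ioi (0 : ℝ), r ^ 2 * (χ r * (r ^ 3)⁻¹) = ∫ r, χ r * (max r 1)⁻¹ := by
        rw [← setIntegral_eq_integral_of_forall_compl_eq_zero (s := Ioi (0 : ℝ))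
          (f := fun r => χ r * (max r 1)⁻¹)
          (fun r hr => by rw [hχ0 r ((not_lt.mp hr).trans zero_le_one), zero_mul])]
        refine setIntegral_congr_fun measurableSet_Ioi fun r hr => ?_
        have h0 : r ≠ 0 := ne_of_gt hr
        rcases le_total r 1 with h1 | h1
        · simp [hχ0 r h1]
        · simp only [max_eq_left h1]
          field_simp
      rw [this]
      have hc : Continuous fun r : ℝ => χ r * (max r 1)⁻¹ :=
        hχc.continuous.mul ((continuous_id.max continuous_const).inv₀
          fun r => (lt_of_lt_of_le zero_lt_one (le_max_right r 1)).ne')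
      refine hc.integral_pos_of_hasCompactSupport_nonneg_nonzero (x := 2)
        χ.hasCompactSupport.mul_right (fun r => mul_nonneg χ.nonneg (by positivity)) ?_
      have : χ 2 = 1 := χ.one_of_mem_closedBall (by simp [χ.rIn_pos.le])
      simp [this]
    rw [e1, mul_zero, neg_zero] at ibp
    exact (mul_eq_zero.mp ibp).resolve_right e2.ne'
  · intro r hr x
    rw [hom r hr x, inner_smul_left, inner_smul_left, inner_smul_left, norm_smul,
      Real.norm_of_nonneg hr.le]
    simp only [conj_trivial]
    field_simp
  · intro r hr x
    rw [fderiv_homogeneous (a := (r ^ 2)⁻¹) hr (fun y => by rw [smul_eq_mul]; exact hom r hr y)]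
    simp only [smul_apply, smul_eq_mul]
    field_simp

/-- The surface integral of a derivative of a homogeneous function of degree `-k`. -/
theorem integral_fderiv_of_homogeneous {g : E3 → ℝ} {k : ℕ}
    (hg : ∀ x, x ≠ 0 → ContDiffAt ℝ 1 g x)
    (hom : ∀ r : ℝ, 0 < r → ∀ x, g (r • x) = (r ^ k)⁻¹ * g x) (e : E3) :
    ∫ p : S2, fderiv ℝ g p e ∂sphereArea
      = (2 - k) * ∫ p : S2, ⟪(p : E3), e⟫ * g p ∂sphereArea := by
  have hρ : ∀ x : E3, x ≠ 0 → ContDiffAt ℝ 1 (fun y : E3 => ‖y‖ ^ k * (‖y‖ ^ 2)⁻¹) x :=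
    fun x hx => ((contDiffAt_norm ℝ hx).pow k).mul
      (((contDiffAt_norm ℝ hx).pow 2).inv (pow_ne_zero 2 (norm_ne_zero_iff.mpr hx)))
  have hzero := integral_fderiv_eq_zero_of_degree_two
    (g := fun x => ‖x‖ ^ k * (‖x‖ ^ 2)⁻¹ * g x) (fun x hx => (hρ x hx).mul (hg x hx))
    (fun r hr x => by
      rw [hom r hr x, norm_smul, Real.norm_of_nonneg hr.le, mul_pow]
      field_simp) e
  have hd : ∀ p : S2, fderiv ℝ (fun x => ‖x‖ ^ k * (‖x‖ ^ 2)⁻¹ * g x) p e =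
      fderiv ℝ g p e - (2 - k) * (⟪(p : E3), e⟫ * g p) := by
    intro p
    have hp := coe_S2_ne_zero p
    have h1 := hasFDerivAt_norm_E3 hp
    have hs := h1.pow k
    have h2 := (hasDerivAt_inv (x := ‖(p : E3)‖ ^ 2) (by simp)).comp_hasFDerivAt (p : E3) (h1.pow 2)
    have h3 := (hs.mul h2).mul ((hg p hp).differentiableAt (by simp)).hasFDerivAt
    have h4 : fderiv ℝ (fun x => ‖x‖ ^ k * (‖x‖ ^ 2)⁻¹ * g x) p = _ := h3.fderiv
    rw [h4]
    simp
    ring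
  simp only [hd] at hzero
  have i1 : Integrable (fun p : S2 => fderiv ℝ g p e) sphereArea := by
    have : Continuous fun p : S2 => fderiv ℝ g p e := by
      rw [continuous_iff_continuousAt]
      intro p
      have h := ((hg p (coe_S2_ne_zero p)).fderiv_right (m := 0) (by norm_num)).continuousAt
      exact (ContinuousAt.comp (f := fun p : S2 => (p : E3)) h
        continuous_subtype_val.continuousAt).clm_apply continuousAt_const
    exact this.integrable_of_hasCompactSupport (HasCompactSupport.of_compactSpace _)
  have i2 : Integrable (fun p : S2 => ⟪(p : E3), e⟫ * g p) sphereArea := by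
    have : Continuous fun p : S2 => ⟪(p : E3), e⟫ * g p := by
      refine (continuous_subtype_val.inner continuous_const).mul ?_
      rw [continuous_iff_continuousAt]
      intro p
      exact ContinuousAt.comp (f := fun p : S2 => (p : E3)) (hg p (coe_S2_ne_zero p)).continuousAt
        continuous_subtype_val.continuousAt
    exact this.integrable_of_hasCompactSupport (HasCompactSupport.of_compactSpace _)
  rw [integral_sub i1 (i2.const_mul _), integral_const_mul] at hzero
  linarith

/-! ### Tangent frames and traces -/

theorem inner_frame_frame (p : S2) (i j : Fin 2) :
    ⟪frame p i, frame p j⟫ = if i = j then (1 : ℝ) else 0 := by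
  have h := (OrthonormalBasis.fromOrthogonalSpanSingleton (𝕜 := ℝ) 2 (v := (p : E3))
    (ne_zero_of_mem_unit_sphere p)).orthonormal
  exact (orthonormal_iff_ite.mp h) i j

theorem inner_frame (p : S2) (i : Fin 2) : ⟪(p : E3), frame p i⟫ = 0 := by
  have h := (OrthonormalBasis.fromOrthogonalSpanSingleton (𝕜 := ℝ) 2 (v := (p : E3))
    (ne_zero_of_mem_unit_sphere p) i).2
  exact Submodule.mem_orthogonal_singleton_iff_inner_right.mp h

theorem inner_tang (p : S2) (v : E3) : ⟪(p : E3), tang p v⟫ = 0 := by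
  rw [tang, inner_sub_right, inner_smul_right, inner_self_S2]; ring

theorem tang_eq_self {p : S2} {v : E3} (h : ⟪(p : E3), v⟫ = 0) : tang p v = v := by
  simp [tang, h]

theorem tang_eq_sum_frame (p : S2) (v : E3) : tang p v = ∑ k, ⟪frame p k, v⟫ • frame p k := by
  let b := OrthonormalBasis.fromOrthogonalSpanSingleton (𝕜 := ℝ) 2 (v := (p : E3))
    (ne_zero_of_mem_unit_sphere p)
  have hmem : tang p v ∈ (ℝ ∙ (p : E3))ᗮ :=
    Submodule.mem_orthogonal_singleton_iff_inner_right.mpr (inner_tang p v)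
  have h := congrArg (Submodule.subtype _) (b.sum_repr' ⟨tang p v, hmem⟩)
  rw [map_sum] at h
  have h2 : ∀ k, ⟪frame p k, tang p v⟫ = ⟪frame p k, v⟫ := fun k => by
    rw [tang, inner_sub_right, inner_smul_right, real_inner_comm (p : E3) (frame p k),
      inner_frame]
    simp
  rw [← show (Submodule.subtype _) (⟨tang p v, hmem⟩ : (ℝ ∙ (p : E3))ᗮ) = tang p v from rfl, ← h]
  refine Finset.sum_congr rfl fun k _ => ?_
  rw [map_smul, ← h2]
  rfl

/-- The coordinate vectors of three-space. -/
def stdVec (i : Fin 3) : E3 := EuclideanSpace.single i 1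

theorem inner_stdVec (v : E3) (i : Fin 3) : ⟪v, stdVec i⟫ = v i := by
  simp [stdVec, EuclideanSpace.inner_single_right]

theorem sum_coord_mul (v w : E3) : ∑ i, v i * w i = ⟪v, w⟫ := by
  simp [PiLp.inner_apply, mul_comm]

theorem sum_coord_smul_stdVec (v : E3) : ∑ i, v i • stdVec i = v := by
  ext j
  simp [stdVec, Fin.sum_univ_three]
  fin_cases j <;> simp

theorem sum_frame_coord (p : S2) (k l : Fin 2) :
    ∑ i, frame p k i * frame p l i = if k = l then (1 : ℝ) else 0 := by
  rw [sum_coord_mul, inner_frame_frame]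

theorem tang_stdVec (p : S2) (i : Fin 3) : tang p (stdVec i) = ∑ k, frame p k i • frame p k := by
  simp [tang_eq_sum_frame, inner_stdVec]

/-- The trace over the tangent plane, computed in the coordinate directions and in a frame. -/
theorem sum_tang_stdVec (B : E3 →L[ℝ] E3 →L[ℝ] ℝ) (p : S2) :
    ∑ i, B (tang p (stdVec i)) (tang p (stdVec i)) = ∑ k, B (frame p k) (frame p k) := by
  have h00 := sum_frame_coord p 0 0
  have h01 := sum_frame_coord p 0 1
  have h11 := sum_frame_coord p 1 1
  simp only [Fin.sum_univ_three, if_true, Fin.reduceEq, if_false] at h00 h01 h11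
  simp only [tang_stdVec, Fin.sum_univ_three, Fin.sum_univ_two, map_add, map_smul,
    add_apply, smul_apply, smul_eq_mul]
  linear_combination B (frame p 0) (frame p 0) * h00 + B (frame p 1) (frame p 1) * h11 +
    (B (frame p 0) (frame p 1) + B (frame p 1) (frame p 0)) * h01

/-- The squared norm over the tangent plane, computed in the coordinate directions and in a
frame. -/
theorem sum_tang_stdVec_sq (B : E3 →L[ℝ] E3 →L[ℝ] ℝ) (p : S2) :
    ∑ i, ∑ j, B (tang p (stdVec i)) (tang p (stdVec j)) ^ 2 =
      ∑ k, ∑ l, B (frame p k) (frame p l) ^ 2 := by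
  have h00 := sum_frame_coord p 0 0
  have h01 := sum_frame_coord p 0 1
  have h11 := sum_frame_coord p 1 1
  have key : ∀ x y : ℝ, ∑ i, (frame p 0 i * x + frame p 1 i * y) ^ 2 = x ^ 2 + y ^ 2 := by
    intro x y
    simp only [Fin.sum_univ_three, if_true, Fin.reduceEq, if_false] at h00 h01 h11 ⊢
    linear_combination x ^ 2 * h00 + y ^ 2 * h11 + 2 * x * y * h01
  have h1 : ∀ i j, B (tang p (stdVec i)) (tang p (stdVec j)) =
      frame p 0 j * (B (tang p (stdVec i)) (frame p 0)) +
        frame p 1 j * (B (tang p (stdVec i)) (frame p 1)) := fun i j => by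
    rw [tang_stdVec p j]
    simp [Fin.sum_univ_two]
  have h2 : ∀ i k, B (tang p (stdVec i)) (frame p k) =
      frame p 0 i * B (frame p 0) (frame p k) + frame p 1 i * B (frame p 1) (frame p k) :=
    fun i k => by
      rw [tang_stdVec p i]
      simp [Fin.sum_univ_two]
  simp only [h1, key]
  rw [Finset.sum_add_distrib]
  simp only [h2, key, Fin.sum_univ_two]
  ring

/-! ### The Hessian of a function on the sphere -/

theorem inner_gradient_radialExt (φ : S2 → ℝ) (p : S2) (v : E3) :
    ⟪grad φ p, v⟫ = fderiv ℝ (radialExt φ) p v := by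
  simp [grad, gradient]

theorem norm_grad_sq (φ : S2 → ℝ) (p : S2) :
    ‖grad φ p‖ ^ 2 = ∑ i, fderiv ℝ (radialExt φ) p (stdVec i) ^ 2 := by
  simp only [← inner_gradient_radialExt, inner_stdVec]
  rw [← real_inner_self_eq_norm_sq, ← sum_coord_mul]
  simp only [sq]

theorem norm_hess_sq (φ : S2 → ℝ) (p : S2) :
    ‖hess φ p‖ ^ 2 = ∑ i, ∑ j,
      fderiv ℝ (fderiv ℝ (radialExt φ)) p (frame p i) (frame p j) ^ 2 := by
  rw [← sum_tang_stdVec_sq, EuclideanSpace.norm_sq_eq, Fintype.sum_prod_type]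
  simp [hess, stdVec]

theorem tr_hess (φ : S2 → ℝ) (p : S2) :
    tr (hess φ p) = ∑ i, fderiv ℝ (fderiv ℝ (radialExt φ)) p (frame p i) (frame p i) := by
  rw [← sum_tang_stdVec]
  simp [hess, stdVec, tr]

/-- The Laplacian is bounded by the Hessian: the sphere has dimension two. -/
theorem tr_hess_sq_le (φ : S2 → ℝ) (p : S2) : tr (hess φ p) ^ 2 ≤ 2 * ‖hess φ p‖ ^ 2 := by
  rw [norm_hess_sq, tr_hess]
  simp only [Fin.sum_univ_two]
  nlinarith [sq_nonneg (fderiv ℝ (fderiv ℝ (radialExt φ)) p (frame p 0) (frame p 0) -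
    fderiv ℝ (fderiv ℝ (radialExt φ)) p (frame p 1) (frame p 1)),
    sq_nonneg (fderiv ℝ (fderiv ℝ (radialExt φ)) p (frame p 0) (frame p 1)),
    sq_nonneg (fderiv ℝ (fderiv ℝ (radialExt φ)) p (frame p 1) (frame p 0))]

section Smooth

variable {φ : S2 → ℝ} (hφ : ContMDiff (𝓡 2) 𝓘(ℝ, ℝ) ∞ φ)
include hφ

theorem contDiffAt_radialExt_of_contMDiff (n : ℕ) {x : E3} (hx : x ≠ 0) :
    ContDiffAt ℝ n (radialExt φ) x :=
  (contDiffAt_radialExt isOpen_univ hφ.contMDiffOn ⟨hx, mem_univ _⟩).of_le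
    (by exact_mod_cast le_top)

theorem contDiffAt_fderiv_radialExt (n : ℕ) {x : E3} (hx : x ≠ 0) :
    ContDiffAt ℝ n (fderiv ℝ (radialExt φ)) x :=
  (contDiffAt_radialExt_of_contMDiff hφ (n + 1) hx).fderiv_right (by simp)

theorem contDiffAt_fderiv_fderiv_radialExt (n : ℕ) {x : E3} (hx : x ≠ 0) :
    ContDiffAt ℝ n (fderiv ℝ (fderiv ℝ (radialExt φ))) x :=
  (contDiffAt_fderiv_radialExt hφ (n + 1) hx).fderiv_right (by simp)

theorem continuous_fderiv_radialExt : Continuous fun p : S2 => fderiv ℝ (radialExt φ) p :=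
  continuous_iff_continuousAt.mpr fun p =>
    ContinuousAt.comp (f := fun p : S2 => (p : E3))
      (contDiffAt_fderiv_radialExt hφ 0 (coe_S2_ne_zero p)).continuousAt
      continuous_subtype_val.continuousAt

theorem continuous_fderiv_fderiv_radialExt :
    Continuous fun p : S2 => fderiv ℝ (fderiv ℝ (radialExt φ)) p :=
  continuous_iff_continuousAt.mpr fun p =>
    ContinuousAt.comp (f := fun p : S2 => (p : E3))
      (contDiffAt_fderiv_fderiv_radialExt hφ 0 (coe_S2_ne_zero p)).continuousAt
      continuous_subtype_val.continuousAt

theorem continuous_grad : Continuous (grad φ) :=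
  (InnerProductSpace.toDual ℝ E3).symm.continuous.comp (continuous_fderiv_radialExt hφ)

theorem continuous_hess : Continuous (hess φ) := by
  have h := continuous_fderiv_fderiv_radialExt hφ
  have ht : ∀ v, Continuous fun p : S2 => tang p v := fun v => by
    unfold tang
    fun_prop
  refine (PiLp.continuous_toLp 2 _).comp (continuous_pi fun ij => ?_)
  exact (h.clm_apply (ht _)).clm_apply (ht _)

/-- Integration by parts, twice, for one minor of the Hessian matrix of the radially constant
extension. The third derivatives cancel because they are symmetric. -/
theorem integral_hessian_minor (a b : E3) :
    ∫ p : S2, (fderiv ℝ (fderiv ℝ (radialExt φ)) p b a ^ 2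
        - fderiv ℝ (fderiv ℝ (radialExt φ)) p a a * fderiv ℝ (fderiv ℝ (radialExt φ)) p b b)
        ∂sphereArea =
      ∫ p : S2, (⟪(p : E3), a⟫ * (fderiv ℝ (radialExt φ) p a *
          fderiv ℝ (fderiv ℝ (radialExt φ)) p b b)
        - ⟪(p : E3), b⟫ * (fderiv ℝ (radialExt φ) p a *
          fderiv ℝ (fderiv ℝ (radialExt φ)) p b a)) ∂sphereArea := by
  set f := radialExt φ with hf
  have c1 : ∀ n : ℕ, ∀ x : E3, x ≠ 0 → ContDiffAt ℝ n (fderiv ℝ f) x := fun n x hx =>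
    contDiffAt_fderiv_radialExt hφ n hx
  have c2 : ∀ n : ℕ, ∀ x : E3, x ≠ 0 → ContDiffAt ℝ n (fderiv ℝ (fderiv ℝ f)) x := fun n x hx =>
    contDiffAt_fderiv_fderiv_radialExt hφ n hx
  have c1a : ∀ v : E3, ∀ x : E3, x ≠ 0 → ContDiffAt ℝ 1 (fun y => fderiv ℝ f y v) x :=
    fun v x hx => (c1 1 x hx).clm_apply contDiffAt_const
  have c2a : ∀ v w : E3, ∀ x : E3, x ≠ 0 →
      ContDiffAt ℝ 1 (fun y => fderiv ℝ (fderiv ℝ f) y v w) x :=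
    fun v w x hx => ((c2 1 x hx).clm_apply contDiffAt_const).clm_apply contDiffAt_const
  have h1 : ∀ r : ℝ, 0 < r → ∀ x, fderiv ℝ f (r • x) = r⁻¹ • fderiv ℝ f x :=
    fun r hr x => fderiv_radialExt_smul hr φ x
  have h2 : ∀ r : ℝ, 0 < r → ∀ x,
      fderiv ℝ (fderiv ℝ f) (r • x) = (r⁻¹ * r⁻¹) • fderiv ℝ (fderiv ℝ f) x :=
    fun r hr x => fderiv_homogeneous hr (h1 r hr) x
  have hom : ∀ v w z : E3, ∀ r : ℝ, 0 < r → ∀ x,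
      fderiv ℝ f (r • x) v * fderiv ℝ (fderiv ℝ f) (r • x) w z =
        (r ^ 3)⁻¹ * (fderiv ℝ f x v * fderiv ℝ (fderiv ℝ f) x w z) := by
    intro v w z r hr x
    rw [h1 r hr, h2 r hr]
    simp only [smul_apply, smul_eq_mul]
    field_simp
  have I1 := integral_fderiv_of_homogeneous
    (g := fun y => fderiv ℝ f y a * fderiv ℝ (fderiv ℝ f) y b a) (k := 3)
    (fun x hx => (c1a a x hx).mul (c2a b a x hx)) (hom a b a) b
  have I2 := integral_fderiv_of_homogeneous
    (g := fun y => fderiv ℝ f y a * fderiv ℝ (fderiv ℝ f) y b b) (k := 3)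
    (fun x hx => (c1a a x hx).mul (c2a b b x hx)) (hom a b b) a
  have d1 : ∀ (p : S2) (v w : E3), fderiv ℝ (fun y => fderiv ℝ f y v) p w =
      fderiv ℝ (fderiv ℝ f) p w v := fun p v w => by
    have := ((c1 1 p (coe_S2_ne_zero p)).differentiableAt (by simp)).hasFDerivAt.clm_apply
      (hasFDerivAt_const v (p : E3))
    rw [this.fderiv]; simp
  have dprod : ∀ (p : S2) (v w z : E3),
      fderiv ℝ (fun y => fderiv ℝ f y a * fderiv ℝ (fderiv ℝ f) y v w) p z =
        fderiv ℝ f p a * fderiv ℝ (fun y => fderiv ℝ (fderiv ℝ f) y v w) p z +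
          fderiv ℝ (fderiv ℝ f) p v w * fderiv ℝ (fderiv ℝ f) p z a := fun p v w z => by
    rw [fderiv_fun_mul ((c1a a p (coe_S2_ne_zero p)).differentiableAt (by simp))
      ((c2a v w p (coe_S2_ne_zero p)).differentiableAt (by simp))]
    simp only [add_apply, smul_apply, smul_eq_mul, d1]
  -- both third derivatives are second derivatives of the first derivative in direction `b`
  have third : ∀ p : S2, fderiv ℝ (fun y => fderiv ℝ (fderiv ℝ f) y b a) p b =
      fderiv ℝ (fun y => fderiv ℝ (fderiv ℝ f) y b b) p a := by
    intro p
    have hp := coe_S2_ne_zero p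
    have hne : ∀ᶠ y : E3 in 𝓝 (p : E3), y ≠ 0 := isOpen_ne.mem_nhds hp
    have e1 : (fun y => fderiv ℝ (fderiv ℝ f) y b a) =ᶠ[𝓝 (p : E3)]
        fun y => fderiv ℝ (fun z => fderiv ℝ f z b) y a := by
      filter_upwards [hne] with y hy
      have := ((c1 1 y hy).differentiableAt (by simp)).hasFDerivAt.clm_apply
        (hasFDerivAt_const b y)
      rw [this.fderiv]
      simp only [ContinuousLinearMap.flip_apply, add_apply, ContinuousLinearMap.comp_apply,
        zero_apply, map_zero, zero_add]
      exact fderiv_fderiv_radialExt_symm (contDiffAt_radialExt_of_contMDiff hφ 2 hy) b a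
    have e2 : (fun y => fderiv ℝ (fderiv ℝ f) y b b) =ᶠ[𝓝 (p : E3)]
        fun y => fderiv ℝ (fun z => fderiv ℝ f z b) y b := by
      filter_upwards [hne] with y hy
      have := ((c1 1 y hy).differentiableAt (by simp)).hasFDerivAt.clm_apply
        (hasFDerivAt_const b y)
      rw [this.fderiv]
      simp
    rw [e1.fderiv_eq, e2.fderiv_eq]
    have hc : ContDiffAt ℝ 2 (fun z => fderiv ℝ f z b) (p : E3) :=
      (c1 2 p hp).clm_apply contDiffAt_const
    have hd : DifferentiableAt ℝ (fderiv ℝ (fun z => fderiv ℝ f z b)) (p : E3) :=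
      (hc.fderiv_right (m := 1) (by norm_num)).differentiableAt (by simp)
    have k1 := (hd.hasFDerivAt.clm_apply (hasFDerivAt_const a (p : E3))).fderiv
    have k2 := (hd.hasFDerivAt.clm_apply (hasFDerivAt_const b (p : E3))).fderiv
    rw [k1, k2]
    simpa using (hc.isSymmSndFDerivAt (by simp)).eq b a
  have hint : ∀ F : S2 → ℝ, Continuous F → Integrable F sphereArea := fun F hF =>
    hF.integrable_of_hasCompactSupport (HasCompactSupport.of_compactSpace _)
  have k1 : ∀ v, Continuous fun p : S2 => fderiv ℝ f p v := fun v =>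
    (continuous_fderiv_radialExt hφ).clm_apply continuous_const
  have k2 : ∀ v w, Continuous fun p : S2 => fderiv ℝ (fderiv ℝ f) p v w := fun v w =>
    ((continuous_fderiv_fderiv_radialExt hφ).clm_apply continuous_const).clm_apply
      continuous_const
  have k3 : ∀ v w z, Continuous fun p : S2 =>
      fderiv ℝ (fun y => fderiv ℝ (fderiv ℝ f) y v w) p z := fun v w z =>
    continuous_iff_continuousAt.mpr fun p =>
      (ContinuousAt.comp (f := fun p : S2 => (p : E3))
        ((c2a v w p (coe_S2_ne_zero p)).fderiv_right (m := 0) (by norm_num)).continuousAt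
        continuous_subtype_val.continuousAt).clm_apply continuousAt_const
  have k0 : ∀ v : E3, Continuous fun p : S2 => ⟪(p : E3), v⟫ := fun v =>
    continuous_subtype_val.inner continuous_const
  simp only [dprod] at I1 I2
  have J : ∫ p : S2, ((fderiv ℝ f p a * fderiv ℝ (fun y => fderiv ℝ (fderiv ℝ f) y b a) p b +
          fderiv ℝ (fderiv ℝ f) p b a * fderiv ℝ (fderiv ℝ f) p b a) -
        (fderiv ℝ f p a * fderiv ℝ (fun y => fderiv ℝ (fderiv ℝ f) y b b) p a +
          fderiv ℝ (fderiv ℝ f) p b b * fderiv ℝ (fderiv ℝ f) p a a)) ∂sphereArea =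
      ∫ p : S2, (⟪(p : E3), a⟫ * (fderiv ℝ f p a * fderiv ℝ (fderiv ℝ f) p b b)
        - ⟪(p : E3), b⟫ * (fderiv ℝ f p a * fderiv ℝ (fderiv ℝ f) p b a)) ∂sphereArea := by
    rw [integral_sub, integral_sub, I1, I2]
    · push_cast; ring
    · exact hint _ ((k0 a).mul ((k1 a).mul (k2 b b)))
    · exact hint _ ((k0 b).mul ((k1 a).mul (k2 b a)))
    · exact hint _ (((k1 a).mul (k3 b a b)).add ((k2 b a).mul (k2 b a)))
    · exact hint _ (((k1 a).mul (k3 b b a)).add ((k2 b b).mul (k2 a a)))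
  rw [← J]
  refine integral_congr_ae (Eventually.of_forall fun p => ?_)
  simp only [third]
  ring

/-- Bochner's formula on the sphere, whose Ricci curvature is one. -/
theorem integral_norm_hess_sq :
    ∫ p, ‖hess φ p‖ ^ 2 ∂sphereArea =
      ∫ p, (tr (hess φ p) ^ 2 - ‖grad φ p‖ ^ 2) ∂sphereArea := by
  have hm := fun i j : Fin 3 => integral_hessian_minor hφ (stdVec i) (stdVec j)
  set f := radialExt φ with hf
  have hint : ∀ F : S2 → ℝ, Continuous F → Integrable F sphereArea := fun F hF =>
    hF.integrable_of_hasCompactSupport (HasCompactSupport.of_compactSpace _)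
  have k1 : ∀ v, Continuous fun p : S2 => fderiv ℝ f p v := fun v =>
    (continuous_fderiv_radialExt hφ).clm_apply continuous_const
  have k2 : ∀ v w, Continuous fun p : S2 => fderiv ℝ (fderiv ℝ f) p v w := fun v w =>
    ((continuous_fderiv_fderiv_radialExt hφ).clm_apply continuous_const).clm_apply
      continuous_const
  have k0 : ∀ v : E3, Continuous fun p : S2 => ⟪(p : E3), v⟫ := fun v =>
    continuous_subtype_val.inner continuous_const
  have hsum := Finset.sum_congr rfl fun i (_ : i ∈ Finset.univ) =>
    Finset.sum_congr rfl fun j (_ : j ∈ Finset.univ) => hm i j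
  simp only [inner_stdVec] at hsum
  have k0' : ∀ i : Fin 3, Continuous fun p : S2 => (p : E3) i := fun i => by
    simpa only [inner_stdVec] using k0 (stdVec i)
  have hintL : ∀ i j : Fin 3, Integrable (fun p : S2 =>
      fderiv ℝ (fderiv ℝ f) p (stdVec j) (stdVec i) ^ 2
        - fderiv ℝ (fderiv ℝ f) p (stdVec i) (stdVec i) *
          fderiv ℝ (fderiv ℝ f) p (stdVec j) (stdVec j)) sphereArea := fun i j =>
    hint _ (((k2 _ _).pow 2).sub ((k2 _ _).mul (k2 _ _)))
  have hintR : ∀ i j : Fin 3, Integrable (fun p : S2 =>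
      (p : E3) i * (fderiv ℝ f p (stdVec i) * fderiv ℝ (fderiv ℝ f) p (stdVec j) (stdVec j))
        - (p : E3) j * (fderiv ℝ f p (stdVec i) *
          fderiv ℝ (fderiv ℝ f) p (stdVec j) (stdVec i))) sphereArea := fun i j =>
    hint _ (((k0' _).mul ((k1 _).mul (k2 _ _))).sub ((k0' _).mul ((k1 _).mul (k2 _ _))))
  simp only [← integral_finsetSum _ fun j _ => hintL _ j,
    ← integral_finsetSum _ fun j _ => hintR _ j] at hsum
  rw [← integral_finsetSum _ fun i _ => integrable_finsetSum _ fun j _ => hintL i j,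
    ← integral_finsetSum _ fun i _ => integrable_finsetSum _ fun j _ => hintR i j] at hsum
  have hcL : Continuous fun p : S2 => ‖hess φ p‖ ^ 2 := (continuous_hess hφ).norm.pow 2
  have hcT : Continuous fun p : S2 => tr (hess φ p) ^ 2 - ‖grad φ p‖ ^ 2 := by
    have : Continuous fun p : S2 => tr (hess φ p) := by
      unfold tr
      exact continuous_finsetSum _ fun i _ =>
        (continuous_apply (i, i)).comp ((PiLp.continuous_ofLp 2 _).comp (continuous_hess hφ))
    exact (this.pow 2).sub ((continuous_grad hφ).norm.pow 2)
  rw [← sub_eq_zero, ← integral_sub (hint _ hcL) (hint _ hcT)]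
  rw [← sub_eq_zero, ← integral_sub
    (integrable_finsetSum _ fun i _ => integrable_finsetSum _ fun j _ => hintL i j)
    (integrable_finsetSum _ fun i _ => integrable_finsetSum _ fun j _ => hintR i j)] at hsum
  rw [← hsum]
  refine integral_congr_ae (Eventually.of_forall fun p => ?_)
  have hp := coe_S2_ne_zero p
  have hC := contDiffAt_radialExt_of_contMDiff hφ 2 hp
  have hnorm : ‖hess φ p‖ ^ 2 = ∑ i, ∑ j, fderiv ℝ (fderiv ℝ f) p (tang p (stdVec i))
      (tang p (stdVec j)) ^ 2 := by
    rw [norm_hess_sq, ← sum_tang_stdVec_sq]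
  have htr : tr (hess φ p) = ∑ i, fderiv ℝ (fderiv ℝ f) p (tang p (stdVec i))
      (tang p (stdVec i)) := by
    rw [tr_hess, ← sum_tang_stdVec]
  have hpp : ∑ i, (p : E3) i * (p : E3) i = 1 := by rw [sum_coord_mul, inner_self_S2]
  have hDp : ∑ i, (p : E3) i * fderiv ℝ f p (stdVec i) = 0 := by
    have := fderiv_radialExt_self φ (p : E3)
    conv at this => lhs; arg 2; rw [← sum_coord_smul_stdVec (p : E3)]
    simpa only [map_sum, map_smul, smul_eq_mul] using this
  have hHr : ∀ v, fderiv ℝ (fderiv ℝ f) p v p = - fderiv ℝ f p v :=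
    fun v => fderiv_fderiv_radialExt_self hC v
  have hHl : ∀ v, fderiv ℝ (fderiv ℝ f) p p v = - fderiv ℝ f p v := fun v => by
    rw [← hHr v]; exact fderiv_fderiv_radialExt_symm hC _ _
  have hHp : ∀ i, ∑ j, (p : E3) j * fderiv ℝ (fderiv ℝ f) p (stdVec j) (stdVec i) =
      - fderiv ℝ f p (stdVec i) := by
    intro i
    rw [← hHl (stdVec i)]
    conv_rhs => arg 1; arg 2; rw [← sum_coord_smul_stdVec (p : E3)]
    simp only [map_sum, map_smul, smul_eq_mul, FunLike.coe_sum, Finset.sum_apply, smul_apply]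
  have hsymm : ∀ i j, fderiv ℝ (fderiv ℝ f) p (stdVec i) (stdVec j) =
      fderiv ℝ (fderiv ℝ f) p (stdVec j) (stdVec i) := fun i j =>
    fderiv_fderiv_radialExt_symm hC _ _
  have hself : fderiv ℝ f p p = 0 := fderiv_radialExt_self φ (p : E3)
  have hB : ∀ i j, fderiv ℝ (fderiv ℝ f) p (tang p (stdVec i)) (tang p (stdVec j)) =
      fderiv ℝ (fderiv ℝ f) p (stdVec i) (stdVec j) + (p : E3) i * fderiv ℝ f p (stdVec j) +
        (p : E3) j * fderiv ℝ f p (stdVec i) := by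
    intro i j
    simp only [tang, inner_stdVec, map_sub, map_smul, sub_apply, smul_apply, smul_eq_mul, hHr, hHl,
      hself]
    ring
  beta_reduce
  rw [hnorm, htr, norm_grad_sq]
  simp only [hB]
  have s01 := hsymm 0 1
  have s02 := hsymm 0 2
  have s12 := hsymm 1 2
  have q0 := hHp 0
  have q1 := hHp 1
  have q2 := hHp 2
  simp only [Fin.sum_univ_three] at hpp hDp q0 q1 q2 ⊢
  simp only [s01, s02, s12] at q0 q1 q2 ⊢
  set f0 := fderiv ℝ f p (stdVec 0)
  set f1 := fderiv ℝ f p (stdVec 1)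
  set f2 := fderiv ℝ f p (stdVec 2)
  set F00 := fderiv ℝ (fderiv ℝ f) p (stdVec 0) (stdVec 0)
  set F11 := fderiv ℝ (fderiv ℝ f) p (stdVec 1) (stdVec 1)
  set F22 := fderiv ℝ (fderiv ℝ f) p (stdVec 2) (stdVec 2)
  linear_combination 3 * (f0 * q0 + f1 * q1 + f2 * q2) + 2 * (f0 ^ 2 + f1 ^ 2 + f2 ^ 2) * hpp -
    (2 * ((p : E3) 0 * f0 + (p : E3) 1 * f1 + (p : E3) 2 * f2) + 3 * (F00 + F11 + F22)) * hDp

end Smooth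

/-! ### The first buckling eigenvalue is at least two -/

theorem integrable_of_continuous {F : S2 → ℝ} (hF : Continuous F) : Integrable F sphereArea :=
  hF.integrable_of_hasCompactSupport (HasCompactSupport.of_compactSpace _)

theorem memLp_of_continuous {V : Type*} [NormedAddCommGroup V] [SecondCountableTopologyEither S2 V]
    {F : S2 → V} (hF : Continuous F) (Ω : Set S2) : MemLp F 2 (sphereArea.restrict Ω) :=
  (hF.memLp_of_hasCompactSupport (HasCompactSupport.of_compactSpace _)).restrict Ω

/-- The trace as a continuous linear functional. -/
def trCLM : Mat3 →L[ℝ] ℝ := ∑ i : Fin 3, EuclideanSpace.proj (i, i)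

theorem trCLM_apply (A : Mat3) : trCLM A = tr A := by
  simp [trCLM, tr]

theorem integral_norm_sq_eq {α V : Type*} [MeasurableSpace α] {μ : Measure α}
    [NormedAddCommGroup V] {f : α → V} (hf : MemLp f 2 μ) :
    ∫ x, ‖f x‖ ^ 2 ∂μ = ‖hf.toLp f‖ ^ 2 := by
  rw [Lp.norm_toLp, hf.eLpNorm_eq_integral_rpow_norm (by norm_num) (by norm_num),
    ENNReal.toReal_ofReal (by positivity), ← Real.rpow_natCast, ← Real.rpow_mul (by positivity)]
  norm_num

theorem tendsto_integral_norm_sq {α V : Type*} [MeasurableSpace α] {μ : Measure α}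
    [NormedAddCommGroup V] {F : ℕ → α → V} {f : α → V} (hF : ∀ n, MemLp (F n) 2 μ)
    (hf : MemLp f 2 μ) (h : Tendsto (fun n => eLpNorm (fun x => F n x - f x) 2 μ) atTop (𝓝 0)) :
    Tendsto (fun n => ∫ x, ‖F n x‖ ^ 2 ∂μ) atTop (𝓝 (∫ x, ‖f x‖ ^ 2 ∂μ)) := by
  simp only [integral_norm_sq_eq hf, fun n => integral_norm_sq_eq (hF n)]
  refine Tendsto.pow ?_ 2
  exact ((Lp.tendsto_Lp_iff_tendsto_eLpNorm'' F hF f hf).mpr h).norm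

section TestFunction

variable {Ω : Set S2} {φ : S2 → ℝ}

theorem radialExt_eventually_zero (h : ∀ p ∉ Ω, p ∉ tsupport φ) {p : S2} (hp : p ∉ Ω) :
    radialExt φ =ᶠ[𝓝 (p : E3)] fun _ => 0 := by
  have h1 : φ =ᶠ[𝓝 p] (fun _ => 0) := notMem_tsupport_iff_eventuallyEq.mp (h p hp)
  have h2 : radialExt φ =ᶠ[𝓝 (p : E3)] radialExt (fun _ : S2 => (0 : ℝ)) :=
    radialExt_eventuallyEq (coe_S2_ne_zero p) (by rwa [proj_coe])
  refine h2.trans ?_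
  filter_upwards [isOpen_ne.mem_nhds (coe_S2_ne_zero p)] with x hx
  exact radialExt_of_ne hx (fun _ : S2 => (0 : ℝ))

theorem grad_eq_zero (h : IsTestFunction Ω φ) {p : S2} (hp : p ∉ Ω) : grad φ p = 0 := by
  have := (radialExt_eventually_zero (fun q hq hq' => hq (h.2 hq')) hp).fderiv_eq (𝕜 := ℝ)
  rw [grad, gradient, this]
  simp

theorem hess_eq_zero (h : IsTestFunction Ω φ) {p : S2} (hp : p ∉ Ω) : hess φ p = 0 := by
  have h1 := ((radialExt_eventually_zero (fun q hq hq' => hq (h.2 hq')) hp).fderiv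
    (𝕜 := ℝ)).fderiv_eq (𝕜 := ℝ)
  ext ij
  rw [hess, h1]
  simp

theorem isW22Zero_of_isTestFunction (h : IsTestFunction Ω φ) :
    IsW22Zero Ω φ (grad φ) (hess φ) :=
  ⟨memLp_of_continuous h.1.continuous Ω, memLp_of_continuous (continuous_grad h.1) Ω,
    memLp_of_continuous (continuous_hess h.1) Ω, fun _ => φ, fun _ => h, by simp, by simp, by simp⟩

theorem continuous_tr_hess (h : IsTestFunction Ω φ) : Continuous fun p => tr (hess φ p) := by
  simp only [← trCLM_apply]
  exact trCLM.continuous.comp (continuous_hess h.1)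

/-- Bochner's formula, for a test function. -/
theorem setIntegral_norm_hess_sq (h : IsTestFunction Ω φ) :
    ∫ p in Ω, ‖hess φ p‖ ^ 2 ∂sphereArea =
      ∫ p in Ω, tr (hess φ p) ^ 2 ∂sphereArea - ∫ p in Ω, ‖grad φ p‖ ^ 2 ∂sphereArea := by
  have hT := continuous_tr_hess h
  have hb := integral_norm_hess_sq h.1
  have i1 : Integrable (fun p => tr (hess φ p) ^ 2) sphereArea :=
    integrable_of_continuous (hT.pow 2)
  have i2 : Integrable (fun p => ‖grad φ p‖ ^ 2) sphereArea :=
    integrable_of_continuous ((continuous_grad h.1).norm.pow 2)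
  rw [integral_sub i1 i2] at hb
  rw [setIntegral_eq_integral_of_forall_compl_eq_zero fun p hp => by simp [hess_eq_zero h hp],
    setIntegral_eq_integral_of_forall_compl_eq_zero fun p hp => by
      simp [hess_eq_zero h hp, ← trCLM_apply],
    setIntegral_eq_integral_of_forall_compl_eq_zero fun p hp => by simp [grad_eq_zero h hp], hb]

theorem two_mul_setIntegral_grad_le (h : IsTestFunction Ω φ) :
    2 * ∫ p in Ω, ‖grad φ p‖ ^ 2 ∂sphereArea ≤ ∫ p in Ω, tr (hess φ p) ^ 2 ∂sphereArea := by
  have hb := setIntegral_norm_hess_sq h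
  have hle : ∫ p in Ω, tr (hess φ p) ^ 2 ∂sphereArea ≤
      ∫ p in Ω, 2 * ‖hess φ p‖ ^ 2 ∂sphereArea :=
    integral_mono (integrable_of_continuous ((continuous_tr_hess h).pow 2)).restrict
      (integrable_of_continuous (((continuous_hess h.1).norm.pow 2).const_mul 2)).restrict
      fun p => tr_hess_sq_le φ p
  rw [integral_const_mul] at hle
  linarith

/-- The gradient of a bump function in a small cap is not almost everywhere zero: its integral in
the direction of the center of the cap is twice the integral of a nonnegative function. -/
theorem exists_isTestFunction_grad_ne (hΩ : IsOpen Ω) (hne : Ω.Nonempty) :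
    ∃ φ, IsTestFunction Ω φ ∧ ¬ (grad φ =ᵐ[sphereArea.restrict Ω] 0) := by
  obtain ⟨p₀, hp₀⟩ := hne
  have hcap : IsOpen {q : S2 | 0 < ⟪(q : E3), (p₀ : E3)⟫} :=
    isOpen_lt continuous_const (continuous_subtype_val.inner continuous_const)
  have hU : Ω ∩ {q : S2 | 0 < ⟪(q : E3), (p₀ : E3)⟫} ∈ 𝓝 p₀ :=
    (hΩ.inter hcap).mem_nhds ⟨hp₀, by simp⟩
  obtain ⟨t, ht, htc, htU⟩ := exists_mem_nhds_isClosed_subset hU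
  obtain ⟨φ, hφ1, hφ0, hφI⟩ := exists_contMDiffMap_one_nhds_of_subset_interior (n := ⊤) (𝓡 2)
    (isClosed_singleton (x := p₀)) (singleton_subset_iff.mpr (mem_interior_iff_mem_nhds.mpr ht))
  have hsupp : tsupport φ ⊆ t := closure_minimal
    (fun q hq => by by_contra h; exact hq (hφ0 q h)) htc
  have htest : IsTestFunction Ω φ := ⟨φ.contMDiff, hsupp.trans (htU.trans inter_subset_left)⟩
  refine ⟨φ, htest, fun hzero => ?_⟩
  have hI := integral_fderiv_of_homogeneous (g := radialExt φ) (k := 0)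
    (fun x hx => contDiffAt_radialExt_of_contMDiff htest.1 1 hx)
    (fun r hr x => by rw [radialExt_smul hr]; simp) (p₀ : E3)
  have hL : ∫ p : S2, fderiv ℝ (radialExt φ) p (p₀ : E3) ∂sphereArea = 0 := by
    have h1 : ∀ p : S2, p ∉ Ω → fderiv ℝ (radialExt φ) p (p₀ : E3) = 0 := fun p hp => by
      rw [← inner_gradient_radialExt, grad_eq_zero htest hp, inner_zero_left]
    rw [← setIntegral_eq_integral_of_forall_compl_eq_zero (s := Ω) h1]
    refine integral_eq_zero_of_ae ?_
    filter_upwards [hzero] with p hp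
    rw [← inner_gradient_radialExt, hp]
    simp
  rw [hL] at hI
  have hpos : 0 < ∫ p : S2, ⟪(p : E3), (p₀ : E3)⟫ * radialExt φ p ∂sphereArea := by
    simp only [radialExt_coe]
    refine Continuous.integral_pos_of_hasCompactSupport_nonneg_nonzero (x := p₀)
      ((continuous_subtype_val.inner continuous_const).mul φ.contMDiff.continuous)
      (HasCompactSupport.of_compactSpace _) (fun q => ?_) ?_
    · by_cases hq : q ∈ t
      · exact mul_nonneg (le_of_lt (htU hq).2) (hφI q).1
      · change 0 ≤ _ * φ q
        rw [hφ0 q hq, mul_zero]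
    · have : φ p₀ = 1 := (hφ1.self_of_nhdsSet p₀ rfl)
      rw [this, inner_self_S2]
      norm_num
  norm_num at hI
  simp only [radialExt_coe] at hpos
  linarith

/-- The lower bound for the Rayleigh quotient passes from test functions to their completion. -/
theorem two_le_buckling (hΩ : IsOpen Ω) (hne : Ω.Nonempty) : 2 ≤ buckling Ω := by
  obtain ⟨φ, hφ, hφ0⟩ := exists_isTestFunction_grad_ne hΩ hne
  refine le_csInf ⟨_, φ, grad φ, hess φ, isW22Zero_of_isTestFunction hφ, hφ0, rfl⟩ ?_
  rintro r ⟨u, G, H, ⟨-, hG, hH, ψ, hψ, -, hlimG, hlimH⟩, hG0, rfl⟩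
  have hpos : 0 < ∫ p in Ω, ‖G p‖ ^ 2 ∂sphereArea := by
    refine lt_of_le_of_ne (integral_nonneg fun p => by positivity) fun h => hG0 ?_
    have := (integral_eq_zero_iff_of_nonneg (fun p => by positivity)
      (hG.integrable_norm_pow (p := 2) (by norm_num))).mp h.symm
    filter_upwards [this] with p hp
    simpa using hp
  rw [le_div_iff₀ hpos]
  have hT : MemLp (fun p => tr (H p)) 2 (sphereArea.restrict Ω) := by
    simp only [← trCLM_apply]
    exact trCLM.comp_memLp' hH
  have hlimT : Tendsto (fun n => eLpNorm (fun p => tr (hess (ψ n) p) - tr (H p)) 2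
      (sphereArea.restrict Ω)) atTop (𝓝 0) := by
    have hle : ∀ n, eLpNorm (fun p => tr (hess (ψ n) p) - tr (H p)) 2 (sphereArea.restrict Ω) ≤
        ENNReal.ofReal ‖trCLM‖ *
          eLpNorm (fun p => hess (ψ n) p - H p) 2 (sphereArea.restrict Ω) := fun n => by
      refine eLpNorm_le_mul_eLpNorm_of_ae_le_mul (Eventually.of_forall fun p => ?_) 2
      rw [← trCLM_apply, ← trCLM_apply, ← map_sub]
      exact trCLM.le_opNorm _
    have h0 := ENNReal.Tendsto.const_mul (a := ENNReal.ofReal ‖trCLM‖) hlimH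
      (Or.inr ENNReal.ofReal_ne_top)
    rw [mul_zero] at h0
    exact tendsto_of_tendsto_of_tendsto_of_le_of_le tendsto_const_nhds h0 (fun _ => zero_le) hle
  have l1 := tendsto_integral_norm_sq
    (fun n => memLp_of_continuous (continuous_grad (hψ n).1) Ω) hG hlimG
  have l2 := tendsto_integral_norm_sq
    (fun n => memLp_of_continuous (continuous_tr_hess (hψ n)) Ω) hT hlimT
  simp only [Real.norm_eq_abs, sq_abs] at l2
  exact le_of_tendsto_of_tendsto' (l1.const_mul 2) l2 fun n => two_mul_setIntegral_grad_le (hψ n)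

theorem buckling_mul_le (h : IsTestFunction Ω φ) :
    buckling Ω * ∫ p in Ω, ‖grad φ p‖ ^ 2 ∂sphereArea ≤
      ∫ p in Ω, tr (hess φ p) ^ 2 ∂sphereArea := by
  have hnn : 0 ≤ ∫ p in Ω, ‖grad φ p‖ ^ 2 ∂sphereArea := integral_nonneg fun p => by positivity
  by_cases h0 : grad φ =ᵐ[sphereArea.restrict Ω] 0
  · have : ∫ p in Ω, ‖grad φ p‖ ^ 2 ∂sphereArea = 0 := by
      refine integral_eq_zero_of_ae ?_
      filter_upwards [h0] with p hp
      simp [hp]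
    rw [this, mul_zero]
    exact integral_nonneg fun p => by positivity
  · have hle : buckling Ω ≤ (∫ p in Ω, tr (hess φ p) ^ 2 ∂sphereArea) /
        ∫ p in Ω, ‖grad φ p‖ ^ 2 ∂sphereArea := by
      refine csInf_le ⟨0, ?_⟩ ⟨φ, grad φ, hess φ, isW22Zero_of_isTestFunction h, h0, rfl⟩
      rintro r ⟨u, G, H, -, -, rfl⟩
      exact div_nonneg (integral_nonneg fun p => by positivity)
        (integral_nonneg fun p => by positivity)
    rcases hnn.eq_or_lt with h1 | h1
    · rw [← h1, mul_zero]
      exact integral_nonneg fun p => by positivity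
    · exact (le_div_iff₀ h1).mp hle

end TestFunction

/-! ### The Lorentz product -/

/-- The Lorentz inner product as a continuous bilinear map. -/
def lorCLM : R41 →L[ℝ] R41 →L[ℝ] ℝ :=
  (isBoundedBilinearMap_inner (𝕜 := ℝ) (E := E3)).toContinuousLinearMap.bilinearComp
    (ContinuousLinearMap.fst ℝ E3 ℝ) (ContinuousLinearMap.fst ℝ E3 ℝ) -
    (ContinuousLinearMap.mul ℝ ℝ).bilinearComp (ContinuousLinearMap.snd ℝ E3 ℝ)
      (ContinuousLinearMap.snd ℝ E3 ℝ)

theorem lorCLM_apply (a b : R41) : lorCLM a b = lor a b := by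
  simp [lorCLM, lor]

theorem lor_comm (a b : R41) : lor a b = lor b a := by
  rw [lor, lor, real_inner_comm, mul_comm]

theorem lor_sub_left (a b c : R41) : lor (a - b) c = lor a c - lor b c := by
  simp [← lorCLM_apply]

theorem lor_add_left (a b c : R41) : lor (a + b) c = lor a c + lor b c := by
  simp [← lorCLM_apply]

theorem lor_smul_left (r : ℝ) (a c : R41) : lor (r • a) c = r * lor a c := by
  simp [← lorCLM_apply]

theorem lor_smul_right (r : ℝ) (a c : R41) : lor a (r • c) = r * lor a c := by
  simp [← lorCLM_apply]

theorem lor_zero_left (c : R41) : lor 0 c = 0 := by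
  simp [← lorCLM_apply]

theorem lor_sum_left {ι : Type*} (s : Finset ι) (a : ι → R41) (c : R41) :
    lor (∑ i ∈ s, a i) c = ∑ i ∈ s, lor (a i) c := by
  simp only [← lorCLM_apply, map_sum, FunLike.coe_sum, Finset.sum_apply]

theorem hasFDerivAt_lor {a b : E3 → R41} {a' b' : E3 →L[ℝ] R41} {x : E3}
    (ha : HasFDerivAt a a' x) (hb : HasFDerivAt b b' x) :
    HasFDerivAt (fun y => lor (a y) (b y))
      (lorCLM.precompR E3 (a x) b' + lorCLM.precompL E3 a' (b x)) x := by
  simp only [← lorCLM_apply]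
  exact lorCLM.hasFDerivAt_of_bilinear ha hb

/-! ### Maps orthogonal to the null direction -/

theorem inner_eq_sum_frame (p : S2) (a b : E3) :
    ⟪a, b⟫ = ∑ k, ⟪a, frame p k⟫ * ⟪b, frame p k⟫ + ⟪a, (p : E3)⟫ * ⟪b, (p : E3)⟫ := by
  have h : b = tang p b + ⟪(p : E3), b⟫ • (p : E3) := by simp [tang]
  conv_lhs => rw [h]
  rw [inner_add_right, tang_eq_sum_frame, inner_sum, inner_smul_right]
  simp only [inner_smul_right, real_inner_comm b]
  congr 1
  · exact Finset.sum_congr rfl fun k _ => mul_comm _ _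
  · ring

/-- The full trace in the coordinate directions is the trace over the tangent plane plus the normal
term. -/
theorem sum_stdVec (B : E3 →L[ℝ] E3 →L[ℝ] ℝ) (p : S2) :
    ∑ i, B (stdVec i) (stdVec i) = ∑ k, B (frame p k) (frame p k) + B p p := by
  have hs : ∀ i, stdVec i = frame p 0 i • frame p 0 + frame p 1 i • frame p 1 +
      (p : E3) i • (p : E3) := fun i => by
    have h := tang_stdVec p i
    rw [tang, inner_stdVec, sub_eq_iff_eq_add, Fin.sum_univ_two] at h
    exact h
  have h00 := sum_frame_coord p 0 0
  have h01 := sum_frame_coord p 0 1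
  have h11 := sum_frame_coord p 1 1
  have hp0 := (sum_coord_mul (p : E3) (frame p 0)).trans (inner_frame p 0)
  have hp1 := (sum_coord_mul (p : E3) (frame p 1)).trans (inner_frame p 1)
  have hpp := (sum_coord_mul (p : E3) (p : E3)).trans (inner_self_S2 p)
  simp only [Fin.sum_univ_three, if_true, Fin.reduceEq, if_false] at h00 h01 h11 hp0 hp1 hpp
  rw [Fin.sum_univ_three, hs 0, hs 1, hs 2]
  simp only [Fin.sum_univ_two, map_add, map_smul, add_apply, smul_apply, smul_eq_mul]
  linear_combination B (frame p 0) (frame p 0) * h00 + B (frame p 1) (frame p 1) * h11 +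
    (B (frame p 0) (frame p 1) + B (frame p 1) (frame p 0)) * h01 +
    (B (frame p 0) p + B p (frame p 0)) * hp0 + (B (frame p 1) p + B p (frame p 1)) * hp1 +
    B p p * hpp

/-- A map `W` smooth over `Ω` whose differential is orthogonal to the null direction. These maps
form a linear space, unlike the spherical graphs, which are the immersions among them. -/
structure IsNullOrthogonal (W : S2 → R41) (Ω : Set S2) : Prop where
  smooth : ContMDiffOn (𝓡 2) 𝓘(ℝ, R41) ∞ W Ω
  normal : ∀ p ∈ Ω, ∀ v : E3, ⟪(p : E3), v⟫ = 0 → lor (dY W p v) (nullDir p) = 0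

theorem IsSphericalGraph.isNullOrthogonal {Y : S2 → R41} {Ω : Set S2}
    (h : IsSphericalGraph Y Ω) : IsNullOrthogonal Y Ω :=
  ⟨h.smooth.mono subset_closure, h.normal⟩

/-- The support function `ν ↦ ⟨W(ν), (ν, 1)⟩`. -/
def support (W : S2 → R41) (p : S2) : ℝ := lor (W p) (nullDir p)

theorem hasFDerivAt_normalize (p : S2) :
    HasFDerivAt (fun x : E3 => ‖x‖⁻¹ • x)
      (ContinuousLinearMap.id ℝ E3 - (innerSL ℝ (p : E3)).smulRight (p : E3)) p := by
  have h1 := hasFDerivAt_norm_E3 (coe_S2_ne_zero p)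
  have h2 := (hasDerivAt_inv (x := ‖(p : E3)‖) (by simp)).comp_hasFDerivAt (p : E3) h1
  refine (h2.smul (hasFDerivAt_id (p : E3))).congr_fderiv ?_
  ext1 v
  simp
  abel

theorem tang_add_smul (p : S2) (v : E3) : tang p v + ⟪(p : E3), v⟫ • (p : E3) = v := by
  simp [tang]

theorem norm_smul_proj {x : E3} (hx : x ≠ 0) : ‖x‖ • (proj x : E3) = x := by
  rw [coe_proj hx, smul_smul, mul_inv_cancel₀ (norm_ne_zero_iff.mpr hx), one_smul]

theorem fderiv_radialExt_eq {V : Type*} [NormedAddCommGroup V] [NormedSpace ℝ V] (F : S2 → V)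
    {x : E3} (hx : x ≠ 0) :
    fderiv ℝ (radialExt F) x = ‖x‖⁻¹ • fderiv ℝ (radialExt F) (proj x) := by
  conv_lhs => rw [← norm_smul_proj hx]
  exact fderiv_radialExt_smul (norm_pos_iff.mpr hx) F _

theorem fderiv_radialExt_tang {V : Type*} [NormedAddCommGroup V] [NormedSpace ℝ V] (F : S2 → V)
    (p : S2) (v : E3) :
    fderiv ℝ (radialExt F) p (tang p v) = fderiv ℝ (radialExt F) p v := by
  conv_rhs => rw [← tang_add_smul p v]
  rw [map_add, map_smul, fderiv_radialExt_self, smul_zero, add_zero]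

section NullOrthogonal

variable {W : S2 → R41} {Ω : Set S2} (hΩ : IsOpen Ω) (hW : IsNullOrthogonal W Ω)
include hΩ hW

theorem IsNullOrthogonal.contDiffAt (n : ℕ) {x : E3} (hx : x ∈ cone Ω) :
    ContDiffAt ℝ n (radialExt W) x :=
  (contDiffAt_radialExt hΩ hW.smooth hx).of_le (by exact_mod_cast le_top)

theorem IsNullOrthogonal.hasFDerivAt {x : E3} (hx : x ∈ cone Ω) :
    HasFDerivAt (radialExt W) (fderiv ℝ (radialExt W) x) x :=
  ((hW.contDiffAt hΩ 1 hx).differentiableAt (by simp)).hasFDerivAt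

theorem IsNullOrthogonal.hasFDerivAt_fderiv {x : E3} (hx : x ∈ cone Ω) :
    HasFDerivAt (fderiv ℝ (radialExt W)) (fderiv ℝ (fderiv ℝ (radialExt W)) x) x :=
  (((hW.contDiffAt hΩ 2 hx).fderiv_right (m := 1) (by norm_num)).differentiableAt
    (by simp)).hasFDerivAt

omit hΩ in
theorem IsNullOrthogonal.normal_cone {x : E3} (hx : x ∈ cone Ω) (v : E3) :
    lor (fderiv ℝ (radialExt W) x v) (nullDir (proj x)) = 0 := by
  rw [fderiv_radialExt_eq W hx.1, smul_apply, lor_smul_left, ← fderiv_radialExt_tang]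
  exact mul_eq_zero_of_right _ (hW.normal _ hx.2 _ (inner_tang _ _))

omit hW hΩ in
theorem radialExt_support {x : E3} (hx : x ≠ 0) :
    radialExt (support W) x = lor (radialExt W x) (‖x‖⁻¹ • x, 1) := by
  rw [radialExt_of_ne hx, radialExt_of_ne hx, support, nullDir, coe_proj hx]

theorem IsNullOrthogonal.contDiffAt_support (n : ℕ) {x : E3} (hx : x ∈ cone Ω) :
    ContDiffAt ℝ n (radialExt (support W)) x := by
  have h1 : ContDiffAt ℝ n (fun y : E3 => ((‖y‖⁻¹ • y, 1) : R41)) x :=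
    ((((contDiffAt_norm ℝ hx.1).inv (norm_ne_zero_iff.mpr hx.1))).smul contDiffAt_id).prodMk
      contDiffAt_const
  have h2 : ContDiffAt ℝ n (fun y => lorCLM (radialExt W y) (‖y‖⁻¹ • y, 1)) x :=
    (contDiffAt_const.clm_apply (hW.contDiffAt hΩ n hx)).clm_apply h1
  refine h2.congr_of_eventuallyEq ?_
  filter_upwards [isOpen_ne.mem_nhds hx.1] with y hy
  rw [radialExt_support hy, lorCLM_apply]

theorem IsNullOrthogonal.fderiv_support {p : S2} (hp : p ∈ Ω) (v : E3) :
    fderiv ℝ (radialExt (support W)) p v = ⟪(W p).1, tang p v⟫ := by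
  have hx : (p : E3) ∈ cone Ω := coe_mem_cone.mpr hp
  have h := hasFDerivAt_lor (hW.hasFDerivAt hΩ hx)
    ((hasFDerivAt_normalize p).prodMk (hasFDerivAt_const (1 : ℝ) (p : E3)))
  have h2 : radialExt (support W) =ᶠ[𝓝 (p : E3)]
      fun x => lor (radialExt W x) (‖x‖⁻¹ • x, 1) := by
    filter_upwards [isOpen_ne.mem_nhds hx.1] with y hy using radialExt_support hy
  rw [h2.fderiv_eq, h.fderiv]
  have h3 := hW.normal_cone hx v
  rw [proj_coe, nullDir] at h3
  simp only [ContinuousLinearMap.precompR_apply, ContinuousLinearMap.precompL_apply, add_apply,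
    lorCLM_apply, radialExt_coe, norm_coe_S2, inv_one, one_smul, h3]
  simp [lor, lorCLM_apply, tang]

theorem IsNullOrthogonal.grad_support {p : S2} (hp : p ∈ Ω) :
    grad (support W) p = tang p (W p).1 := by
  refine ext_inner_right ℝ fun v => ?_
  rw [inner_gradient_radialExt, hW.fderiv_support hΩ hp]
  simp only [tang, inner_sub_left, inner_sub_right, inner_smul_left, inner_smul_right,
    conj_trivial]
  rw [real_inner_comm (p : E3) (W p).1]
  ring

/-- The second derivative of the radially constant extension of the support function. -/
theorem IsNullOrthogonal.fderiv_fderiv_support {p : S2} (hp : p ∈ Ω) (v w : E3) :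
    fderiv ℝ (fderiv ℝ (radialExt (support W))) p w v =
      ⟪(dY W p w).1, tang p v⟫ - ⟪(W p).1, tang p w⟫ * ⟪(p : E3), v⟫
        - ⟪(W p).1, (p : E3)⟫ * ⟪tang p w, v⟫ - ⟪(p : E3), w⟫ * ⟪(W p).1, tang p v⟫ := by
  have hx : (p : E3) ∈ cone Ω := coe_mem_cone.mpr hp
  have h1 : (fun x => fderiv ℝ (radialExt (support W)) x v) =ᶠ[𝓝 (p : E3)]
      fun x => ‖x‖⁻¹ * (⟪(radialExt W x).1, v⟫ -
        ⟪(radialExt W x).1, ‖x‖⁻¹ • x⟫ * ⟪‖x‖⁻¹ • x, v⟫) := by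
    filter_upwards [(isOpen_cone hΩ).mem_nhds hx] with x hx
    rw [fderiv_radialExt_eq _ hx.1, smul_apply, hW.fderiv_support hΩ hx.2, smul_eq_mul,
      radialExt_of_ne hx.1, ← coe_proj hx.1, tang, inner_sub_right, inner_smul_right]
    ring
  have hd : HasFDerivAt (fderiv ℝ (radialExt (support W)))
      (fderiv ℝ (fderiv ℝ (radialExt (support W))) p) p :=
    (((hW.contDiffAt_support hΩ 2 hx).fderiv_right (m := 1) (by norm_num)).differentiableAt
      (by simp)).hasFDerivAt
  have e1 : fderiv ℝ (fun x => fderiv ℝ (radialExt (support W)) x v) p w =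
      fderiv ℝ (fderiv ℝ (radialExt (support W))) p w v := by
    rw [(hd.clm_apply (hasFDerivAt_const v (p : E3))).fderiv]; simp
  have hn := hasFDerivAt_normalize p
  have hy := (hW.hasFDerivAt hΩ hx).fst
  have hi := (hasDerivAt_inv (x := ‖(p : E3)‖) (by simp)).comp_hasFDerivAt (p : E3)
    (hasFDerivAt_norm_E3 (coe_S2_ne_zero p))
  have h2 := hi.mul ((hy.inner ℝ (hasFDerivAt_const v (p : E3))).sub
    ((hy.inner ℝ hn).mul (hn.inner ℝ (hasFDerivAt_const v (p : E3)))))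
  have h3 := congrArg (fun L => L w) (h2.congr_of_eventuallyEq h1).fderiv
  rw [← e1]
  refine h3.trans ?_
  simp [dY, tang, inner_sub_left, inner_sub_right, inner_smul_left, inner_smul_right,
    real_inner_comm (p : E3)]
  ring

/-- On tangent vectors, the Hessian of the support function is the shape form
`(v, w) ↦ ⟨dW(v), w⟩` up to a multiple of the round metric. -/
theorem IsNullOrthogonal.fderiv_fderiv_support_tangent {p : S2} (hp : p ∈ Ω) {v w : E3}
    (hv : ⟪(p : E3), v⟫ = 0) (hw : ⟪(p : E3), w⟫ = 0) :
    fderiv ℝ (fderiv ℝ (radialExt (support W))) p w v =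
      ⟪(dY W p w).1, v⟫ - ⟪(W p).1, (p : E3)⟫ * ⟪w, v⟫ := by
  rw [hW.fderiv_fderiv_support hΩ hp, tang_eq_self hv, tang_eq_self hw, hv, hw]
  ring

theorem IsNullOrthogonal.shape_symm {p : S2} (hp : p ∈ Ω) {v w : E3}
    (hv : ⟪(p : E3), v⟫ = 0) (hw : ⟪(p : E3), w⟫ = 0) :
    ⟪(dY W p w).1, v⟫ = ⟪(dY W p v).1, w⟫ := by
  have h := fderiv_fderiv_radialExt_symm
    (hW.contDiffAt_support hΩ 2 (coe_mem_cone.mpr hp)) w v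
  rw [hW.fderiv_fderiv_support_tangent hΩ hp hv hw,
    hW.fderiv_fderiv_support_tangent hΩ hp hw hv, real_inner_comm w v] at h
  linarith

omit hΩ in
theorem IsNullOrthogonal.dY_snd {p : S2} (hp : p ∈ Ω) (v : E3) :
    (dY W p v).2 = ⟪(dY W p v).1, (p : E3)⟫ := by
  have h := hW.normal_cone (coe_mem_cone.mpr hp) v
  rw [proj_coe, lor, nullDir] at h
  simp only [mul_one] at h
  exact (sub_eq_zero.mp h).symm

omit hΩ in
/-- The Lorentz product on the image of the differential only sees the tangential part, because
`(ν, 1)` is null. -/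
theorem lor_dY_dY {X : S2 → R41} (hX : IsNullOrthogonal X Ω) {p : S2} (hp : p ∈ Ω) (v w : E3) :
    lor (dY W p v) (dY X p w) =
      ∑ k, ⟪(dY W p v).1, frame p k⟫ * ⟪(dY X p w).1, frame p k⟫ := by
  rw [lor, hW.dY_snd hp, hX.dY_snd hp, inner_eq_sum_frame p]
  ring

/-- Differentiating `⟨dW, (ν, 1)⟩ = 0`. -/
theorem IsNullOrthogonal.lor_hessY {p : S2} (hp : p ∈ Ω) {v : E3} (hv : ⟪(p : E3), v⟫ = 0)
    (w : E3) : lor (hessY W p v w) (nullDir p) = - ⟪(dY W p w).1, v⟫ := by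
  have hx : (p : E3) ∈ cone Ω := coe_mem_cone.mpr hp
  have h1 := (hW.hasFDerivAt_fderiv hΩ hx).clm_apply (hasFDerivAt_const w (p : E3))
  have h := hasFDerivAt_lor h1
    ((hasFDerivAt_normalize p).prodMk (hasFDerivAt_const (1 : ℝ) (p : E3)))
  have h2 : (fun x => lor (fderiv ℝ (radialExt W) x w) (‖x‖⁻¹ • x, 1)) =ᶠ[𝓝 (p : E3)]
      fun _ => 0 := by
    filter_upwards [(isOpen_cone hΩ).mem_nhds hx] with x hx
    rw [← hW.normal_cone hx w, nullDir, coe_proj hx.1]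
  have h3 := congrArg (fun L => L v) (h.unique
    ((hasFDerivAt_const (0 : ℝ) (p : E3)).congr_of_eventuallyEq h2))
  simp only [ContinuousLinearMap.precompR_apply, ContinuousLinearMap.precompL_apply, add_apply,
    lorCLM_apply, norm_coe_S2, inv_one, one_smul] at h3
  simp [hv, lor, lorCLM_apply] at h3
  simp [lor, nullDir, hessY, dY]
  linarith


theorem IsNullOrthogonal.dY_sub {X : S2 → R41} (hX : IsNullOrthogonal X Ω) {p : S2} (hp : p ∈ Ω)
    (v : E3) : dY (W - X) p v = dY W p v - dY X p v := by
  have hx : (p : E3) ∈ cone Ω := coe_mem_cone.mpr hp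
  have h := (hW.hasFDerivAt hΩ hx).sub (hX.hasFDerivAt hΩ hx)
  have h2 : radialExt (W - X) =ᶠ[𝓝 (p : E3)] radialExt W - radialExt X := by
    filter_upwards [isOpen_ne.mem_nhds hx.1] with x hx
    simp [radialExt_of_ne hx]
  rw [dY, h2.fderiv_eq, h.fderiv]
  rfl

theorem IsNullOrthogonal.sub {X : S2 → R41} (hX : IsNullOrthogonal X Ω) :
    IsNullOrthogonal (W - X) Ω where
  smooth := hW.smooth.sub hX.smooth
  normal p hp v hv := by
    rw [hW.dY_sub hΩ hX hp, lor_sub_left, hW.normal p hp v hv, hX.normal p hp v hv, sub_zero]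

end NullOrthogonal

/-! ### Marginally trapped graphs and graphs of vanishing mean curvature -/

/-- The pointwise Lorentz product of two differentials; `energy W W / 2` is the Dirichlet
integrand of `W`. -/
def energy (W X : S2 → R41) (p : S2) : ℝ := ∑ i, lor (dY W p (frame p i)) (dY X p (frame p i))

/-- The trace of the shape form `(v, w) ↦ ⟨dW(v), w⟩` over the tangent plane. -/
def shapeTrace (W : S2 → R41) (p : S2) : ℝ := ∑ i, ⟪(dY W p (frame p i)).1, frame p i⟫

theorem dY_add_smul (W : S2 → R41) (p : S2) (r s : ℝ) (v w : E3) :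
    dY W p (r • v + s • w) = r • dY W p v + s • dY W p w := by
  simp [dY]

section Pointwise

variable {W X Y : S2 → R41} {Ω : Set S2} {p : S2}

theorem lor_normalPart (hW : IsNullOrthogonal W Ω) (hp : p ∈ Ω) (w : R41) :
    lor (normalPart W p w) (nullDir p) = lor w (nullDir p) := by
  rw [normalPart, lor_sub_left, lor_sum_left, Finset.sum_eq_zero, sub_zero]
  intro i _
  rw [lor_sum_left]
  refine Finset.sum_eq_zero fun j _ => ?_
  rw [lor_smul_left, hW.normal p hp _ (inner_frame p i), mul_zero]

/-- The induced metric is the square of the shape form. -/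
theorem inducedMetric_apply (hW : IsNullOrthogonal W Ω) (hp : p ∈ Ω) (i j : Fin 2) :
    inducedMetric W p i j =
      ∑ k, ⟪(dY W p (frame p i)).1, frame p k⟫ * ⟪(dY W p (frame p j)).1, frame p k⟫ := by
  rw [inducedMetric, Matrix.of_apply, lor_dY_dY hW hW hp]

/-- A space-like map has a nondegenerate shape form: a null vector of the form would be mapped to a
light-like vector. -/
theorem shape_det_ne_zero (hΩ : IsOpen Ω) (hY : IsSphericalGraph Y Ω) (hp : p ∈ Ω) :
    ⟪(dY Y p (frame p 0)).1, frame p 0⟫ * ⟪(dY Y p (frame p 1)).1, frame p 1⟫ -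
      ⟪(dY Y p (frame p 0)).1, frame p 1⟫ ^ 2 ≠ 0 := by
  intro h0
  have hN := hY.isNullOrthogonal
  have hsymm := hN.shape_symm hΩ hp (inner_frame p 0) (inner_frame p 1)
  set a := ⟪(dY Y p (frame p 0)).1, frame p 0⟫ with ha
  set b := ⟪(dY Y p (frame p 0)).1, frame p 1⟫ with hb
  set c := ⟪(dY Y p (frame p 1)).1, frame p 1⟫ with hc
  have key : ∀ r s : ℝ, r * a + s * b = 0 → r * b + s * c = 0 → r = 0 ∧ s = 0 := by
    intro r s h1 h2
    by_contra hrs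
    have hnorm : ⟪r • frame p 0 + s • frame p 1, r • frame p 0 + s • frame p 1⟫ =
        r ^ 2 + s ^ 2 := by
      simp only [inner_add_left, inner_add_right, inner_smul_left, inner_smul_right,
        inner_frame_frame]
      norm_num
      ring
    have hv : r • frame p 0 + s • frame p 1 ≠ 0 := by
      intro hv
      rw [hv, inner_zero_left] at hnorm
      exact hrs ⟨by nlinarith [sq_nonneg r, sq_nonneg s], by nlinarith [sq_nonneg r, sq_nonneg s]⟩
    have hpos := hY.spacelike p hp (r • frame p 0 + s • frame p 1)
      (by rw [inner_add_right, inner_smul_right, inner_smul_right, inner_frame, inner_frame]; ring)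
      hv
    rw [lor_dY_dY hN hN hp, dY_add_smul, Fin.sum_univ_two] at hpos
    simp only [Prod.fst_add, Prod.smul_fst, inner_add_left, inner_smul_left, conj_trivial, hsymm,
      ← ha, ← hb, ← hc, h1, h2] at hpos
    norm_num at hpos
  have h1 := key b (-a) (by ring) (by linear_combination -h0)
  have ha0 : a = 0 := by linarith [h1.2]
  have h2 := key 1 0 (by rw [ha0]; ring) (by rw [h1.1]; ring)
  exact one_ne_zero h2.1

/-- A spherical graph is marginally trapped only if its shape form is trace-free. -/
theorem shapeTrace_eq_zero (hΩ : IsOpen Ω) (hY : IsMarginallyTrappedGraph Y Ω) (hp : p ∈ Ω) :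
    shapeTrace Y p = 0 := by
  have hN := hY.isNullOrthogonal
  have hdet := shape_det_ne_zero hΩ hY.toIsSphericalGraph hp
  have hsymm := hN.shape_symm hΩ hp (inner_frame p 0) (inner_frame p 1)
  have hg := inducedMetric_apply hN hp
  have hH := hY.meanCurvature_orthogonal p hp
  simp only [meanCurvature, secondFundamentalForm, lor_smul_left, lor_sum_left,
    lor_normalPart hN hp, hN.lor_hessY hΩ hp (inner_frame p _)] at hH
  simp only [Matrix.inv_def, Matrix.adjugate_fin_two, Matrix.det_fin_two, Fin.sum_univ_two, hg,
    Matrix.smul_apply, smul_eq_mul, Matrix.of_apply, Matrix.cons_val_zero, Matrix.cons_val_one,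
    Matrix.cons_val', Matrix.cons_val_fin_one, Ring.inverse_eq_inv', hsymm] at hH
  rw [shapeTrace, Fin.sum_univ_two]
  set a := ⟪(dY Y p (frame p 0)).1, frame p 0⟫ with ha
  set b := ⟪(dY Y p (frame p 0)).1, frame p 1⟫ with hb
  set c := ⟪(dY Y p (frame p 1)).1, frame p 1⟫ with hc
  have hd : (a * a + b * b) * (b * b + c * c) - (a * b + b * c) * (b * a + c * b) =
      (a * c - b ^ 2) ^ 2 := by ring
  rw [hd] at hH
  field_simp at hH
  have : (a * c - b ^ 2) * (a + c) = 0 := by linarith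
  exact (mul_eq_zero.mp this).resolve_left hdet

/-- A trace-free shape form makes the induced metric conformal to the round one. -/
theorem inducedMetric_eq_smul_one (hΩ : IsOpen Ω) (hW : IsNullOrthogonal W Ω) (hp : p ∈ Ω)
    (ht : shapeTrace W p = 0) :
    inducedMetric W p = (energy W W p / 2) • (1 : Matrix (Fin 2) (Fin 2) ℝ) := by
  have hsymm := hW.shape_symm hΩ hp (inner_frame p 0) (inner_frame p 1)
  rw [shapeTrace, Fin.sum_univ_two] at ht
  have hc := eq_neg_of_add_eq_zero_right ht
  have hg := inducedMetric_apply hW hp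
  ext i j
  fin_cases i <;> fin_cases j <;>
  · simp [hg, energy, lor_dY_dY hW hW hp, Fin.sum_univ_two, hsymm, hc]
    ring

theorem energy_self_eq (hW : IsNullOrthogonal W Ω) (hp : p ∈ Ω) :
    energy W W p = ∑ i, ∑ k, ⟪(dY W p (frame p i)).1, frame p k⟫ ^ 2 := by
  simp only [energy, lor_dY_dY hW hW hp, sq]

theorem energy_self_nonneg (hW : IsNullOrthogonal W Ω) (hp : p ∈ Ω) : 0 ≤ energy W W p := by
  rw [energy_self_eq hW hp]
  positivity

/-- The area density of a marginally trapped graph is its Dirichlet integrand. -/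
theorem sqrt_det_inducedMetric (hΩ : IsOpen Ω) (hW : IsNullOrthogonal W Ω) (hp : p ∈ Ω)
    (ht : shapeTrace W p = 0) : Real.sqrt (inducedMetric W p).det = energy W W p / 2 := by
  rw [inducedMetric_eq_smul_one hΩ hW hp ht, Matrix.det_smul, Matrix.det_one, mul_one,
    Fintype.card_fin, Real.sqrt_sq (by linarith [energy_self_nonneg hW hp])]

/-- Twice the Dirichlet integrand is the squared norm of the trace-free Hessian of the support
function. -/
theorem energy_eq_hess (hΩ : IsOpen Ω) (hW : IsNullOrthogonal W Ω) (hp : p ∈ Ω)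
    (ht : shapeTrace W p = 0) :
    energy W W p = ‖hess (support W) p‖ ^ 2 - tr (hess (support W) p) ^ 2 / 2 := by
  rw [energy_self_eq hW hp, norm_hess_sq, tr_hess]
  rw [shapeTrace] at ht
  simp only [hW.fderiv_fderiv_support_tangent hΩ hp (inner_frame p _) (inner_frame p _),
    inner_frame_frame, Fin.sum_univ_two] at ht ⊢
  have hc := eq_neg_of_add_eq_zero_right ht
  simp [hc]
  ring

theorem energy_sub (hΩ : IsOpen Ω) (hY : IsNullOrthogonal Y Ω) (hX : IsNullOrthogonal X Ω)
    (hp : p ∈ Ω) :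
    energy Y Y p = energy X X p + 2 * energy X (Y - X) p + energy (Y - X) (Y - X) p := by
  simp only [energy, hY.dY_sub hΩ hX hp, ← lorCLM_apply, map_sub, sub_apply, Fin.sum_univ_two]
  have h0 := lor_comm (dY X p (frame p 0)) (dY Y p (frame p 0))
  have h1 := lor_comm (dY X p (frame p 1)) (dY Y p (frame p 1))
  simp only [← lorCLM_apply] at h0 h1
  linear_combination -h0 - h1

theorem shapeTrace_sub (hΩ : IsOpen Ω) (hY : IsNullOrthogonal Y Ω) (hX : IsNullOrthogonal X Ω)
    (hp : p ∈ Ω) : shapeTrace (Y - X) p = shapeTrace Y p - shapeTrace X p := by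
  simp only [shapeTrace, hY.dY_sub hΩ hX hp, Prod.fst_sub, inner_sub_left,
    Finset.sum_sub_distrib]

theorem IsZeroMeanCurvatureGraph.isMarginallyTrappedGraph (h : IsZeroMeanCurvatureGraph X Ω) :
    IsMarginallyTrappedGraph X Ω where
  toIsSphericalGraph := h.toIsSphericalGraph
  meanCurvature_orthogonal q hq := by rw [h.meanCurvature_eq_zero q hq, lor_zero_left]

/-- Conformality of the induced metric, on the cone and in polarized form. -/
theorem lor_fderiv_conformal (hΩ : IsOpen Ω) (hW : IsNullOrthogonal W Ω)
    (ht : ∀ q ∈ Ω, shapeTrace W q = 0) {x : E3} (hx : x ∈ cone Ω) (v w : E3) :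
    2 * ‖x‖ ^ 2 * lor (fderiv ℝ (radialExt W) x v) (fderiv ℝ (radialExt W) x w) =
      (∑ i, lor (fderiv ℝ (radialExt W) x (stdVec i)) (fderiv ℝ (radialExt W) x (stdVec i))) *
        (‖x‖ ^ 2 * ⟪v, w⟫ - ⟪x, v⟫ * ⟪x, w⟫) := by
  have hq := hx.2
  set q := proj x with hqdef
  have hn : 0 < ‖x‖ := norm_pos_iff.mpr hx.1
  have hxq : x = ‖x‖ • (q : E3) := (norm_smul_proj hx.1).symm
  have hg := fun i j => congrFun (congrFun (inducedMetric_eq_smul_one hΩ hW hq (ht q hq)) i) j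
  simp only [inducedMetric, Matrix.of_apply, Matrix.smul_apply, Matrix.one_apply, smul_eq_mul,
    mul_ite, mul_one, mul_zero] at hg
  -- the bilinear form at the point of the sphere
  have hB : ∀ v w : E3, lor (dY W q v) (dY W q w) =
      energy W W q / 2 * (⟪v, w⟫ - ⟪(q : E3), v⟫ * ⟪(q : E3), w⟫) := by
    intro v w
    have hv : dY W q v = ∑ k, ⟪frame q k, v⟫ • dY W q (frame q k) := by
      rw [dY, ← fderiv_radialExt_tang, tang_eq_sum_frame, map_sum]
      simp only [map_smul, dY]
    have hw : dY W q w = ∑ k, ⟪frame q k, w⟫ • dY W q (frame q k) := by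
      rw [dY, ← fderiv_radialExt_tang, tang_eq_sum_frame, map_sum]
      simp only [map_smul, dY]
    rw [hv, hw, inner_eq_sum_frame q v w]
    simp only [Fin.sum_univ_two, lor_add_left, lor_smul_left]
    simp only [lor_comm _ (_ + _), lor_add_left, lor_smul_left, hg]
    simp [real_inner_comm]
    ring
  have hS : ∑ i, lor (dY W q (stdVec i)) (dY W q (stdVec i)) = energy W W q := by
    simp only [hB]
    rw [← Finset.mul_sum, Finset.sum_sub_distrib]
    simp only [inner_stdVec, sum_coord_mul, inner_self_S2]
    simp [stdVec]
    ring
  have hd : ∀ v, fderiv ℝ (radialExt W) x v = ‖x‖⁻¹ • dY W q v := fun v => by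
    rw [fderiv_radialExt_eq W hx.1]; rfl
  have hiv : ∀ v, ⟪x, v⟫ = ‖x‖ * ⟪(q : E3), v⟫ := fun v => by
    conv_lhs => rw [hxq]
    rw [inner_smul_left]; rfl
  simp only [hd, lor_smul_left, lor_smul_right]
  rw [← Finset.mul_sum, ← Finset.mul_sum, hS, hB, hiv, hiv]
  field_simp

/-- For a conformal map the Laplacian is orthogonal to the surface. -/
theorem lor_laplacian_dY (hΩ : IsOpen Ω) (hW : IsNullOrthogonal W Ω)
    (ht : ∀ q ∈ Ω, shapeTrace W q = 0) (hp : p ∈ Ω) (k : Fin 2) :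
    lor (∑ i, hessY W p (frame p i) (frame p i)) (dY W p (frame p k)) = 0 := by
  have hx : (p : E3) ∈ cone Ω := coe_mem_cone.mpr hp
  have hD := hW.hasFDerivAt_fderiv hΩ hx
  -- derivatives of the conformality relation in a tangent direction `z`
  obtain ⟨e, he⟩ : ∃ e : E3 → ℝ, ∀ z v w, ⟪(p : E3), z⟫ = 0 → ⟪(p : E3), v⟫ = 0 →
      ⟪(p : E3), w⟫ = 0 → 2 * (lor (hessY W p z v) (dY W p w) + lor (dY W p v) (hessY W p z w)) =
        e z * ⟪v, w⟫ := by
    have hl : ∀ v w, HasFDerivAt (fun x => lor (fderiv ℝ (radialExt W) x v)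
        (fderiv ℝ (radialExt W) x w)) _ (p : E3) := fun v w =>
      hasFDerivAt_lor (hD.clm_apply (hasFDerivAt_const v (p : E3)))
        (hD.clm_apply (hasFDerivAt_const w (p : E3)))
    have hsum := HasFDerivAt.fun_sum (u := Finset.univ) fun i (_ : i ∈ Finset.univ) =>
      hl (stdVec i) (stdVec i)
    obtain ⟨e, he⟩ : ∃ e : E3 →L[ℝ] ℝ, HasFDerivAt (fun x => ∑ i,
        lor (fderiv ℝ (radialExt W) x (stdVec i)) (fderiv ℝ (radialExt W) x (stdVec i))) e p :=
      ⟨_, hsum⟩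
    refine ⟨e, fun z v w hz hv hw => ?_⟩
    have hi : ∀ v, HasFDerivAt (fun x : E3 => ⟪x, v⟫) _ (p : E3) := fun v =>
      (hasFDerivAt_id (p : E3)).inner ℝ (hasFDerivAt_const v (p : E3))
    have hn := (hasStrictFDerivAt_norm_sq (p : E3)).hasFDerivAt
    have hL := (hn.const_mul 2).mul (hl v w)
    have hR := he.mul ((hn.mul_const ⟪v, w⟫).sub ((hi v).mul (hi w)))
    have hev : (fun x => 2 * ‖x‖ ^ 2 * lor (fderiv ℝ (radialExt W) x v)
        (fderiv ℝ (radialExt W) x w)) =ᶠ[𝓝 (p : E3)] fun x => (∑ i,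
          lor (fderiv ℝ (radialExt W) x (stdVec i)) (fderiv ℝ (radialExt W) x (stdVec i))) *
        (‖x‖ ^ 2 * ⟪v, w⟫ - ⟪x, v⟫ * ⟪x, w⟫) := by
      filter_upwards [(isOpen_cone hΩ).mem_nhds hx] with x hx using
        lor_fderiv_conformal hΩ hW ht hx v w
    have h := congrArg (fun L => L z) (hL.unique (hR.congr_of_eventuallyEq hev))
    simp [hz, hv, hw, lorCLM_apply] at h
    simp only [hessY, dY]
    linarith
  have hsymm : ∀ v w, hessY W p v w = hessY W p w v := fun v w =>
    fderiv_fderiv_radialExt_symm (hW.contDiffAt hΩ 2 hx) v w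
  have f := inner_frame p
  have e000 := he _ _ _ (f 0) (f 0) (f 0)
  have e011 := he _ _ _ (f 0) (f 1) (f 1)
  have e110 := he _ _ _ (f 1) (f 1) (f 0)
  have e111 := he _ _ _ (f 1) (f 1) (f 1)
  have e100 := he _ _ _ (f 1) (f 0) (f 0)
  have e001 := he _ _ _ (f 0) (f 0) (f 1)
  simp only [inner_frame_frame, lor_comm (dY W p _), if_true, Fin.reduceEq, if_false, mul_one,
    mul_zero] at e000 e011 e110 e111 e100 e001
  rw [hsymm (frame p 1) (frame p 0)] at e110 e100
  rw [lor_sum_left, Fin.sum_univ_two]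
  fin_cases k
  · change lor (hessY W p (frame p 0) (frame p 0)) (dY W p (frame p 0)) +
      lor (hessY W p (frame p 1) (frame p 1)) (dY W p (frame p 0)) = 0
    linarith
  · change lor (hessY W p (frame p 0) (frame p 0)) (dY W p (frame p 1)) +
      lor (hessY W p (frame p 1) (frame p 1)) (dY W p (frame p 1)) = 0
    linarith

/-- A graph of vanishing mean curvature is harmonic for the round metric, because its induced metric
is conformal to the round one. -/
theorem laplacian_eq_zero (hΩ : IsOpen Ω) (hX : IsZeroMeanCurvatureGraph X Ω) (hp : p ∈ Ω) :
    ∑ i, hessY X p (frame p i) (frame p i) = 0 := by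
  have hN := hX.isNullOrthogonal
  have ht : ∀ q ∈ Ω, shapeTrace X q = 0 := fun q hq =>
    shapeTrace_eq_zero hΩ hX.isMarginallyTrappedGraph hq
  have hg := inducedMetric_eq_smul_one hΩ hN hp (ht p hp)
  have horth := lor_laplacian_dY hΩ hN ht hp
  have hpos : 0 < energy X X p / 2 := by
    have h := hX.spacelike p hp (frame p 0) (inner_frame p 0) (fun h0 => by
      have := inner_frame_frame p 0 0
      simp [h0] at this)
    have h2 := congrFun (congrFun hg 0) 0
    simp [inducedMetric] at h2
    linarith
  set l := energy X X p / 2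
  have hinv : (inducedMetric X p)⁻¹ = l⁻¹ • (1 : Matrix (Fin 2) (Fin 2) ℝ) := by
    rw [hg]
    refine Matrix.inv_eq_right_inv ?_
    rw [Matrix.smul_mul, Matrix.mul_smul, smul_smul, mul_inv_cancel₀ hpos.ne', one_smul, one_mul]
  have hnp : ∀ w, normalPart X p w =
      w - ∑ i, (l⁻¹ * lor w (dY X p (frame p i))) • dY X p (frame p i) := fun w => by
    simp [normalPart, hinv, Matrix.one_apply, Fin.sum_univ_two]
  have hH := hX.meanCurvature_eq_zero p hp
  simp only [meanCurvature, secondFundamentalForm, hinv, Matrix.smul_apply, Matrix.one_apply,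
    Fin.sum_univ_two, hnp] at hH
  simp only [Fin.sum_univ_two, lor_add_left] at horth ⊢
  simp only [if_true, Fin.reduceEq, if_false, smul_eq_mul, mul_one, mul_zero, zero_smul, add_zero,
    zero_add, ← smul_add, smul_smul] at hH
  rw [smul_eq_zero, or_iff_right (by positivity)] at hH
  have h0 := horth 0
  have h1 := horth 1
  rw [← eq_neg_iff_add_eq_zero] at h0 h1
  rw [h0, h1] at hH
  rw [← hH]
  simp only [mul_neg, neg_smul]
  abel

end Pointwise

/-! ### Maps that vanish on the boundary -/

/-- Smoothness up to the boundary bounds the first derivative in the interior. -/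
theorem exists_norm_fderiv_radialExt_le {V : Type*} [NormedAddCommGroup V] [NormedSpace ℝ V]
    {F : S2 → V} {Ω : Set S2} (hΩ : IsOpen Ω)
    (hF : ContMDiffOn (𝓡 2) 𝓘(ℝ, V) ∞ F (closure Ω)) :
    ∃ C, ∀ p ∈ Ω, ‖fderiv ℝ (radialExt F) p‖ ≤ C := by
  have hC := contDiffOn_radialExt hF
  have hcomp : IsCompact (closure Ω) := isClosed_closure.isCompact
  suffices h : ∃ C, ∀ p ∈ closure Ω ∩ Ω, ‖fderiv ℝ (radialExt F) p‖ ≤ C by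
    obtain ⟨C, hC⟩ := h
    exact ⟨C, fun p hp => hC p ⟨subset_closure hp, hp⟩⟩
  refine hcomp.induction_on (p := fun s => ∃ C, ∀ p ∈ s ∩ Ω, ‖fderiv ℝ (radialExt F) p‖ ≤ C)
    ⟨0, by simp⟩ ?_ ?_ ?_
  · rintro s t hst ⟨C, hC⟩
    exact ⟨C, fun p hp => hC p ⟨hst hp.1, hp.2⟩⟩
  · rintro s t ⟨C, hC⟩ ⟨D, hD⟩
    refine ⟨max C D, fun p hp => ?_⟩
    rcases hp.1 with h | h
    · exact (hC p ⟨h, hp.2⟩).trans (le_max_left _ _)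
    · exact (hD p ⟨h, hp.2⟩).trans (le_max_right _ _)
  · intro p₀ hp₀
    have hx₀ : (p₀ : E3) ∈ cone (closure Ω) := coe_mem_cone.mpr hp₀
    have h1 : ContDiffWithinAt ℝ (0 + 1) (radialExt F) (cone (closure Ω)) p₀ :=
      (hC p₀ hx₀).of_le (by simp)
    obtain ⟨u, hu, -, f', hf', hf'c⟩ :=
      (contDiffWithinAt_succ_iff_hasFDerivWithinAt (by simp)).mp h1
    rw [insert_eq_of_mem hx₀] at hu
    have hcont : Tendsto (fun x => ‖f' x‖) (𝓝[cone (closure Ω)] (p₀ : E3)) (𝓝 ‖f' p₀‖) :=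
      (hf'c.continuousWithinAt.norm).mono_left (nhdsWithin_le_of_mem hu)
    have hev : ∀ᶠ x in 𝓝[cone (closure Ω)] (p₀ : E3), x ∈ u ∧ ‖f' x‖ < ‖f' p₀‖ + 1 :=
      (eventually_mem_set.mpr hu).and (hcont.eventually_lt_const (by linarith))
    obtain ⟨O, hO, hpO, hOsub⟩ := mem_nhdsWithin.mp hev
    refine ⟨(fun q : S2 => (q : E3)) ⁻¹' O, mem_nhdsWithin_of_mem_nhds
      ((hO.preimage continuous_subtype_val).mem_nhds hpO), ‖f' p₀‖ + 1, fun q hq => ?_⟩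
    have hsub : O ∩ cone Ω ⊆ O ∩ cone (closure Ω) := fun x hx =>
      ⟨hx.1, hx.2.1, subset_closure hx.2.2⟩
    have hqc : (q : E3) ∈ O ∩ cone Ω := ⟨hq.1, coe_mem_cone.mpr hq.2⟩
    have hun : u ∈ 𝓝 (q : E3) := mem_of_superset ((hO.inter (isOpen_cone hΩ)).mem_nhds hqc)
      fun x hx => (hOsub (hsub hx)).1
    rw [((hf' q (mem_of_mem_nhds hun)).hasFDerivAt hun).fderiv]
    exact (hOsub (hsub hqc)).2.le

/-- A map that vanishes on the boundary is bounded by the distance to the complement, with a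
constant that only depends on its derivative close by: integrate from `p` in the direction of `z`
until the boundary is met. -/
theorem norm_le_of_frontier_eq_zero {V : Type*} [NormedAddCommGroup V] [NormedSpace ℝ V]
    {F : S2 → V} {Ω : Set S2} (hΩ : IsOpen Ω) (hF : ContinuousOn F (closure Ω))
    (hd : ∀ x ∈ cone Ω, DifferentiableAt ℝ (radialExt F) x) (h0 : ∀ p ∈ frontier Ω, F p = 0)
    {p z : S2} (hp : p ∈ Ω) (hz : z ∉ Ω) (hpz : ‖(p : E3) - z‖ ≤ 1) {B : ℝ}
    (hB : ∀ q ∈ Ω, ‖(q : E3) - z‖ ≤ 2 * ‖(p : E3) - z‖ → ‖fderiv ℝ (radialExt F) q‖ ≤ B) :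
    ‖F p‖ ≤ 2 * B * ‖(p : E3) - z‖ := by
  set d := ‖(p : E3) - z‖ with hddef
  let γ : ℝ → E3 := fun s => (p : E3) + s • ((z : E3) - p)
  have hγd : ∀ s, HasDerivAt γ ((z : E3) - p) s := fun s => by
    have := ((hasDerivAt_id s).smul_const ((z : E3) - p)).const_add (p : E3)
    rwa [one_smul] at this
  have hγc : Continuous γ := continuous_iff_continuousAt.mpr fun s => (hγd s).continuousAt
  have hγp : ∀ s, 0 ≤ s → ‖γ s - p‖ = s * d := fun s hs => by
    simp [γ, norm_smul, abs_of_nonneg hs, hddef, norm_sub_rev]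
  have hγz : ∀ s, s ≤ 1 → ‖γ s - z‖ = (1 - s) * d := fun s hs => by
    have : γ s - z = (1 - s) • ((p : E3) - z) := by simp only [γ]; module
    rw [this, norm_smul, Real.norm_of_nonneg (by linarith)]
  have hd0 : 0 ≤ d := norm_nonneg _
  have hlow : ∀ s, 1 - ‖γ s - z‖ ≤ ‖γ s‖ := fun s => by
    have := norm_sub_norm_le (z : E3) (z - γ s)
    rw [norm_coe_S2, sub_sub_cancel, norm_sub_rev] at this
    exact this
  have hhalf : ∀ s ∈ Icc (0 : ℝ) 1, 1 / 2 ≤ ‖γ s‖ := fun s hs => by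
    have h1 := hlow s
    have h2 : 1 - ‖γ s - p‖ ≤ ‖γ s‖ := by
      have := norm_sub_norm_le (p : E3) (p - γ s)
      rw [norm_coe_S2, sub_sub_cancel, norm_sub_rev] at this
      exact this
    rw [hγz s hs.2] at h1
    rw [hγp s hs.1] at h2
    rcases le_total s (1 / 2) with h | h <;> nlinarith [hs.1, hs.2]
  have hne : ∀ s ∈ Icc (0 : ℝ) 1, γ s ≠ 0 := fun s hs h => by
    have := hhalf s hs; rw [h, norm_zero] at this; linarith
  have hup : ∀ s ∈ Icc (0 : ℝ) 1, ‖γ s‖ ≤ 1 := fun s hs => by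
    have : γ s = (1 - s) • (p : E3) + s • (z : E3) := by simp only [γ]; module
    rw [this]
    refine (norm_add_le _ _).trans ?_
    rw [norm_smul, norm_smul, norm_coe_S2, norm_coe_S2, Real.norm_of_nonneg hs.1,
      Real.norm_of_nonneg (by linarith [hs.2])]
    linarith
  have hdist : ∀ s ∈ Icc (0 : ℝ) 1, ‖(proj (γ s) : E3) - z‖ ≤ 2 * d := fun s hs => by
    have h1 : ‖(proj (γ s) : E3) - γ s‖ = 1 - ‖γ s‖ := by
      have h2 : (proj (γ s) : E3) - γ s = (1 - ‖γ s‖) • (proj (γ s) : E3) := by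
        rw [sub_smul, norm_smul_proj (hne s hs), one_smul]
      rw [h2, norm_smul, norm_coe_S2, mul_one, Real.norm_of_nonneg (by linarith [hup s hs])]
    have h3 := norm_sub_le_norm_sub_add_norm_sub (proj (γ s) : E3) (γ s) z
    have h4 := hlow s
    have h5 := hγz s hs.2
    nlinarith [hs.1, hs.2]
  have hπ : ContinuousOn (fun s => proj (γ s)) (Icc 0 1) := fun s hs =>
    (ContinuousAt.comp (f := γ) (continuousAt_proj (hne s hs))
      hγc.continuousAt).continuousWithinAt
  -- the first parameter at which the path leaves the domain
  have hTcl : IsClosed (Icc (0 : ℝ) 1 ∩ (fun s => proj (γ s)) ⁻¹' Ωᶜ) :=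
    hπ.preimage_isClosed_of_isClosed isClosed_Icc hΩ.isClosed_compl
  have hγ1 : γ 1 = z := by simp [γ]
  have hγ0 : γ 0 = p := by simp [γ]
  obtain ⟨b, ⟨hb, hbΩ⟩, hbmin⟩ := (isCompact_Icc.of_isClosed_subset hTcl
    inter_subset_left).exists_isLeast ⟨1, ⟨by norm_num, le_rfl⟩, by
      change proj (γ 1) ∉ Ω; rw [hγ1, proj_coe]; exact hz⟩
  have hin : ∀ s ∈ Ico (0 : ℝ) b, proj (γ s) ∈ Ω := fun s hs => by
    by_contra h
    exact absurd (hbmin ⟨⟨hs.1, hs.2.le.trans hb.2⟩, h⟩) (not_le.mpr hs.2)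
  have hb0 : 0 < b := by
    rcases hb.1.eq_or_lt with h | h
    · rw [← h] at hbΩ
      exact absurd hp (by simpa [hγ0] using hbΩ)
    · exact h
  have hIcc : Icc 0 b ⊆ Icc (0 : ℝ) 1 := Icc_subset_Icc_right hb.2
  have hcl : ∀ s ∈ Icc (0 : ℝ) b, proj (γ s) ∈ closure Ω := by
    have h1 : Icc (0 : ℝ) b = closure (Ico 0 b) := (closure_Ico hb0.ne).symm
    have h2 := (hπ.mono hIcc)
    intro s hs
    rw [h1] at hs h2
    exact closure_mono (image_subset_iff.mpr hin) (h2.image_closure ⟨s, hs, rfl⟩)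
  have hfr : proj (γ b) ∈ frontier Ω := by
    rw [frontier, hΩ.interior_eq]
    exact ⟨hcl b ⟨hb0.le, le_rfl⟩, hbΩ⟩
  have hmv := norm_image_sub_le_of_norm_deriv_right_le_segment (a := 0) (b := b)
    (f := fun s => F (proj (γ s))) (f' := fun s => fderiv ℝ (radialExt F) (γ s) ((z : E3) - p))
    (C := 2 * B * d) (hF.comp (hπ.mono hIcc) hcl) (fun s hs => by
      have hs1 := hIcc (Ico_subset_Icc_self hs)
      have h1 := ((hd (γ s) ⟨hne s hs1, hin s hs⟩).hasFDerivAt.comp_hasDerivAt s (hγd s))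
      refine (h1.congr_of_eventuallyEq ?_).hasDerivWithinAt
      filter_upwards [hγc.continuousAt.eventually (isOpen_ne.mem_nhds (hne s hs1))] with t ht
      exact (radialExt_of_ne ht F).symm) (fun s hs => by
      have hs1 := hIcc (Ico_subset_Icc_self hs)
      refine (ContinuousLinearMap.le_opNorm _ _).trans ?_
      rw [norm_sub_rev, ← hddef]
      refine mul_le_mul_of_nonneg_right ?_ hd0
      rw [fderiv_radialExt_eq F (hne s hs1), norm_smul, norm_inv, norm_norm]
      have h1 := hB _ (hin s hs) (hdist s hs1)
      have h2 : ‖γ s‖⁻¹ ≤ 2 := by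
        rw [inv_le_comm₀ (by linarith [hhalf s hs1]) (by norm_num)]
        linarith [hhalf s hs1]
      exact mul_le_mul h2 h1 (norm_nonneg _) (by norm_num)) b ⟨hb0.le, le_rfl⟩
  simp only [h0 _ hfr, hγ0, proj_coe, zero_sub, norm_neg, sub_zero] at hmv
  have hB0 : 0 ≤ B := (norm_nonneg _).trans (hB p hp (by linarith))
  refine hmv.trans ?_
  have : 0 ≤ 2 * B * d := by positivity
  nlinarith [hb.2]

theorem norm_tang_le (p : S2) (v : E3) : ‖tang p v‖ ≤ 2 * ‖v‖ := by
  rw [tang]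
  refine (norm_sub_le _ _).trans ?_
  rw [norm_smul, norm_coe_S2, mul_one]
  have := norm_inner_le_norm (𝕜 := ℝ) (p : E3) v
  rw [norm_coe_S2] at this
  linarith

section Vanishing

variable {W : S2 → R41} {Ω : Set S2} (hΩ : IsOpen Ω) (hW : IsNullOrthogonal W Ω)
include hΩ hW

theorem IsNullOrthogonal.norm_fderiv_support_le {p : S2} (hp : p ∈ Ω) :
    ‖fderiv ℝ (radialExt (support W)) p‖ ≤ 2 * ‖W p‖ := by
  refine ContinuousLinearMap.opNorm_le_bound _ (by positivity) fun v => ?_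
  rw [hW.fderiv_support hΩ hp]
  have h1 := norm_inner_le_norm (𝕜 := ℝ) (W p).1 (tang p v)
  have h2 := norm_tang_le p v
  have h3 := norm_fst_le (W p)
  calc _ ≤ ‖(W p).1‖ * ‖tang p v‖ := h1
    _ ≤ ‖W p‖ * (2 * ‖v‖) := mul_le_mul h3 h2 (norm_nonneg _) (norm_nonneg _)
    _ = _ := by ring

theorem IsNullOrthogonal.norm_fderiv_fderiv_support_le {p : S2} (hp : p ∈ Ω) :
    ‖fderiv ℝ (fderiv ℝ (radialExt (support W))) p‖ ≤
      2 * ‖fderiv ℝ (radialExt W) p‖ + 6 * ‖W p‖ := by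
  refine ContinuousLinearMap.opNorm_le_bound _ (by positivity) fun w =>
    ContinuousLinearMap.opNorm_le_bound _ (by positivity) fun v => ?_
  rw [hW.fderiv_fderiv_support hΩ hp]
  have hi : ∀ a b : E3, |⟪a, b⟫| ≤ ‖a‖ * ‖b‖ := fun a b => abs_real_inner_le_norm a b
  have hp1 := norm_coe_S2 p
  have hw1 : ‖(W p).1‖ ≤ ‖W p‖ := norm_fst_le _
  have hd : ‖(dY W p w).1‖ ≤ ‖fderiv ℝ (radialExt W) p‖ * ‖w‖ :=
    (norm_fst_le _).trans (ContinuousLinearMap.le_opNorm _ _)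
  have hv := norm_tang_le p v
  have hw := norm_tang_le p w
  have t1 : |⟪(dY W p w).1, tang p v⟫| ≤ ‖fderiv ℝ (radialExt W) p‖ * ‖w‖ * (2 * ‖v‖) :=
    (hi _ _).trans (mul_le_mul hd hv (norm_nonneg _) (by positivity))
  have t2 : |⟪(W p).1, tang p w⟫ * ⟪(p : E3), v⟫| ≤ ‖W p‖ * (2 * ‖w‖) * (1 * ‖v‖) := by
    rw [abs_mul]
    exact mul_le_mul ((hi _ _).trans (mul_le_mul hw1 hw (norm_nonneg _) (norm_nonneg _)))
      ((hi _ _).trans (by rw [hp1])) (abs_nonneg _) (by positivity)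
  have t3 : |⟪(W p).1, (p : E3)⟫ * ⟪tang p w, v⟫| ≤ ‖W p‖ * 1 * (2 * ‖w‖ * ‖v‖) := by
    rw [abs_mul]
    exact mul_le_mul ((hi _ _).trans (mul_le_mul hw1 hp1.le (norm_nonneg _) (norm_nonneg _)))
      ((hi _ _).trans (mul_le_mul_of_nonneg_right hw (norm_nonneg _))) (abs_nonneg _)
      (by positivity)
  have t4 : |⟪(p : E3), w⟫ * ⟪(W p).1, tang p v⟫| ≤ 1 * ‖w‖ * (‖W p‖ * (2 * ‖v‖)) := by
    rw [abs_mul]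
    exact mul_le_mul ((hi _ _).trans (by rw [hp1]))
      ((hi _ _).trans (mul_le_mul hw1 hv (norm_nonneg _) (norm_nonneg _))) (abs_nonneg _)
      (by positivity)
  rw [Real.norm_eq_abs]
  refine (abs_sub _ _).trans ?_
  have a1 := abs_sub (⟪(dY W p w).1, tang p v⟫ - ⟪(W p).1, tang p w⟫ * ⟪(p : E3), v⟫)
    (⟪(W p).1, (p : E3)⟫ * ⟪tang p w, v⟫)
  have a2 := abs_sub ⟪(dY W p w).1, tang p v⟫ (⟪(W p).1, tang p w⟫ * ⟪(p : E3), v⟫)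
  nlinarith

/-- The map vanishes to first order at the boundary, and its support function, whose gradient is the
tangential part of the map, to second order. -/
theorem IsNullOrthogonal.exists_boundary_estimates (hc : ContinuousOn W (closure Ω))
    (h0 : ∀ p ∈ frontier Ω, W p = 0) {C : ℝ}
    (hC : ∀ p ∈ Ω, ‖fderiv ℝ (radialExt W) p‖ ≤ C) {p z : S2} (hp : p ∈ Ω) (hz : z ∉ Ω)
    (hpz : ‖(p : E3) - z‖ ≤ 1 / 2) :
    ‖W p‖ ≤ 2 * C * ‖(p : E3) - z‖ ∧ |support W p| ≤ 16 * C * ‖(p : E3) - z‖ ^ 2 := by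
  have hlin : ∀ q ∈ Ω, ‖(q : E3) - z‖ ≤ 1 → ‖W q‖ ≤ 2 * C * ‖(q : E3) - z‖ := fun q hq hqz =>
    norm_le_of_frontier_eq_zero hΩ hc (fun x hx => (hW.hasFDerivAt hΩ hx).differentiableAt) h0 hq
      hz hqz fun r hr _ => hC r hr
  have hC0 : 0 ≤ C := (norm_nonneg _).trans (hC p hp)
  refine ⟨hlin p hp (by linarith), ?_⟩
  have hsc : ContinuousOn (support W) (closure Ω) := by
    have : ContinuousOn (fun q => lorCLM (W q) (nullDir q)) (closure Ω) :=
      (continuousOn_const.clm_apply hc).clm_apply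
        (continuous_subtype_val.prodMk continuous_const).continuousOn
    simp only [lorCLM_apply] at this
    exact this
  have h := norm_le_of_frontier_eq_zero (F := support W) (B := 8 * C * ‖(p : E3) - z‖) hΩ hsc
    (fun x hx => (hW.contDiffAt_support hΩ 1 hx).differentiableAt (by simp))
    (fun q hq => by rw [support, h0 q hq, lor_zero_left]) hp hz (by linarith) fun q hq hqz => by
      refine (hW.norm_fderiv_support_le hΩ hq).trans ?_
      have := hlin q hq (by linarith)
      nlinarith
  rw [Real.norm_eq_abs] at h
  nlinarith

end Vanishing

/-! ### Cutoff functions -/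

-- norms on nested spaces of continuous linear maps need a deeper instance search
set_option maxSynthPendingDepth 3

/-- Convolution with a function bounded by one is bounded by the `L¹` norm of the kernel. -/
theorem norm_convolution_le {V V' : Type*} [NormedAddCommGroup V] [NormedSpace ℝ V]
    [NormedAddCommGroup V'] [NormedSpace ℝ V'] (L : ℝ →L[ℝ] V →L[ℝ] V') {f : E3 → ℝ} {h : E3 → V}
    (hf : ∀ x, ‖f x‖ ≤ 1) (hh : Continuous h) (hs : HasCompactSupport h) (x : E3) :
    ‖convolution f h L volume x‖ ≤ ‖L‖ * ∫ t, ‖h t‖ := by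
  have hi : Integrable (fun t => ‖h t‖) := (hh.integrable_of_hasCompactSupport hs).norm
  rw [convolution_def, ← integral_const_mul, ← integral_sub_left_eq_self (fun t => ‖L‖ * ‖h t‖) _ x]
  refine norm_integral_le_of_norm_le ((hi.const_mul ‖L‖).comp_sub_left x)
    (Eventually.of_forall fun t => ?_)
  refine (L.le_opNorm₂ _ _).trans ?_
  rw [mul_assoc]
  refine mul_le_mul_of_nonneg_left ?_ (norm_nonneg _)
  exact mul_le_of_le_one_left (norm_nonneg _) (hf t)

/-- A set has a cutoff function that vanishes near it and equals one away from it, with derivatives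
bounded independently of the set: mollify an indicator function at a fixed scale. -/
theorem exists_cutoff : ∃ C : ℝ, 0 ≤ C ∧ ∀ K : Set E3, ∃ g : E3 → ℝ, ContDiff ℝ ∞ g ∧
    (∀ x, 0 ≤ g x ∧ g x ≤ 1) ∧ (∀ x, ∀ z ∈ K, ‖x - z‖ < 1 → g x = 0) ∧
    (∀ x, (∀ z ∈ K, 3 ≤ ‖x - z‖) → g x = 1) ∧
    ∀ x, ‖fderiv ℝ g x‖ ≤ C ∧ ‖fderiv ℝ (fderiv ℝ g) x‖ ≤ C := by
  let ρ : ContDiffBump (0 : E3) := ⟨1 / 2, 1, by norm_num, by norm_num⟩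
  set h : E3 → ℝ := ρ.normed volume with hh
  have hc : ContDiff ℝ ∞ h := ρ.contDiff_normed
  have hs : HasCompactSupport h := ρ.hasCompactSupport_normed
  have hc1 : ContDiff ℝ ∞ (fderiv ℝ h) := hc.fderiv_right (by simp)
  have hc2 : ContDiff ℝ ∞ (fderiv ℝ (fderiv ℝ h)) := hc1.fderiv_right (by simp)
  have hs1 : HasCompactSupport (fderiv ℝ h) := hs.fderiv ℝ
  have hs2 : HasCompactSupport (fderiv ℝ (fderiv ℝ h)) := hs1.fderiv ℝ
  let L := ContinuousLinearMap.mul ℝ ℝ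
  refine ⟨‖L.precompR E3‖ * (∫ t, ‖fderiv ℝ h t‖) +
    ‖(L.precompR E3).precompR E3‖ * ∫ t, ‖fderiv ℝ (fderiv ℝ h) t‖, by positivity, fun K => ?_⟩
  let A : Set E3 := {x | ∀ z ∈ K, 2 ≤ ‖x - z‖}
  have hA : IsClosed A := by
    have : A = ⋂ z ∈ K, {x | 2 ≤ ‖x - z‖} := by ext x; simp [A]
    rw [this]
    exact isClosed_biInter fun z _ => isClosed_le continuous_const (by fun_prop)
  let f : E3 → ℝ := A.indicator fun _ => 1
  have hf1 : ∀ x, ‖f x‖ ≤ 1 := fun x => by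
    by_cases hx : x ∈ A <;> simp [f, hx]
  have hf0 : ∀ x, 0 ≤ f x ∧ f x ≤ 1 := fun x => by
    by_cases hx : x ∈ A <;> simp [f, hx]
  have hfl : LocallyIntegrable f volume :=
    (locallyIntegrable_const (1 : ℝ)).indicator hA.measurableSet
  have h0 : ∀ x : E3, 1 ≤ ‖x‖ → h x = 0 := fun x hx => by
    have : x ∉ Function.support h := by
      rw [hh, ρ.support_normed_eq]
      simpa using hx
    exact Function.notMem_support.mp this
  have hval : ∀ x, convolution f h L volume x = ∫ t, f t * h (x - t) := fun x => rfl
  have hint : ∀ x, Integrable fun t => h (x - t) := fun x =>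
    (hc.continuous.integrable_of_hasCompactSupport hs).comp_sub_left x
  have hone : ∀ x, ∫ t, h (x - t) = 1 := fun x => by
    rw [integral_sub_left_eq_self h]; exact ρ.integral_normed
  have hd1 : ∀ x, HasFDerivAt (convolution f h L volume)
      (convolution f (fderiv ℝ h) (L.precompR E3) volume x) x := fun x =>
    hs.hasFDerivAt_convolution_right L hfl (hc.of_le (by simp)) x
  have hd2 : ∀ x, HasFDerivAt (convolution f (fderiv ℝ h) (L.precompR E3) volume)
      (convolution f (fderiv ℝ (fderiv ℝ h)) ((L.precompR E3).precompR E3) volume x) x := fun x =>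
    hs1.hasFDerivAt_convolution_right _ hfl (hc1.of_le (by simp)) x
  have hfd1 : fderiv ℝ (convolution f h L volume) =
      convolution f (fderiv ℝ h) (L.precompR E3) volume := funext fun x => (hd1 x).fderiv
  refine ⟨convolution f h L volume, hs.contDiff_convolution_right L hfl hc, fun x => ⟨?_, ?_⟩,
    fun x z hz hxz => ?_, fun x hx => ?_, fun x => ⟨?_, ?_⟩⟩
  · rw [hval]
    exact integral_nonneg fun t => mul_nonneg (hf0 t).1 (ρ.nonneg_normed _)
  · rw [hval, ← hone x]
    refine integral_mono_of_nonneg (Eventually.of_forall fun t =>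
      mul_nonneg (hf0 t).1 (ρ.nonneg_normed _)) (hint x) (Eventually.of_forall fun t =>
        mul_le_of_le_one_left (ρ.nonneg_normed _) (hf0 t).2)
  · rw [hval]
    refine integral_eq_zero_of_ae (Eventually.of_forall fun t => ?_)
    by_cases ht : t ∈ A
    · have h1 := ht z hz
      have h2 := norm_sub_le_norm_sub_add_norm_sub t x z
      have h3 : 1 ≤ ‖x - t‖ := by rw [norm_sub_rev]; linarith
      simp [h0 _ h3]
    · simp [f, ht]
  · rw [hval, ← hone x]
    refine integral_congr_ae (Eventually.of_forall fun t => ?_)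
    by_cases ht : t ∈ A
    · simp [f, ht]
    · obtain ⟨z, hz, hzt⟩ : ∃ z ∈ K, ‖t - z‖ < 2 := by simpa [A] using ht
      have h1 := hx z hz
      have h2 := norm_sub_le_norm_sub_add_norm_sub x t z
      have h3 : 1 ≤ ‖x - t‖ := by linarith
      simp [h0 _ h3]
  · rw [(hd1 x).fderiv]
    refine (norm_convolution_le _ hf1 hc1.continuous hs1 x).trans ?_
    have : 0 ≤ ‖(L.precompR E3).precompR E3‖ * ∫ t, ‖fderiv ℝ (fderiv ℝ h) t‖ := by positivity
    linarith
  · rw [hfd1, (hd2 x).fderiv]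
    refine (norm_convolution_le _ hf1 hc2.continuous hs2 x).trans ?_
    have : 0 ≤ ‖L.precompR E3‖ * ∫ t, ‖fderiv ℝ h t‖ := by positivity
    linarith

/-- The cutoff functions of `exists_cutoff` at scale `ε`. -/
theorem exists_cutoff_scaled : ∃ C : ℝ, 0 ≤ C ∧ ∀ (K : Set E3) (ε : ℝ), 0 < ε → ∃ g : E3 → ℝ,
    ContDiff ℝ ∞ g ∧ (∀ x, 0 ≤ g x ∧ g x ≤ 1) ∧ (∀ x, ∀ z ∈ K, ‖x - z‖ < ε → g x = 0) ∧
    (∀ x, (∀ z ∈ K, 3 * ε ≤ ‖x - z‖) → g x = 1) ∧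
    ∀ x, ‖fderiv ℝ g x‖ ≤ C / ε ∧ ‖fderiv ℝ (fderiv ℝ g) x‖ ≤ C / ε ^ 2 := by
  obtain ⟨C, hC0, hC⟩ := exists_cutoff
  refine ⟨C, hC0, fun K ε hε => ?_⟩
  obtain ⟨g, hg, hg01, hg0, hg1, hgd⟩ := hC ((fun x => ε⁻¹ • x) '' K)
  have hn : ∀ x z : E3, ‖ε⁻¹ • x - ε⁻¹ • z‖ = ‖x - z‖ / ε := fun x z => by
    rw [← smul_sub, norm_smul, norm_inv, Real.norm_of_nonneg hε.le, div_eq_inv_mul]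
  have e1 : fderiv ℝ (fun x => g (ε⁻¹ • x)) = fun x => ε⁻¹ • fderiv ℝ g (ε⁻¹ • x) :=
    funext fun x => fderiv_comp_smul _
  have e2 : ∀ x, fderiv ℝ (fun x => ε⁻¹ • fderiv ℝ g (ε⁻¹ • x)) x =
      ε⁻¹ • ε⁻¹ • fderiv ℝ (fderiv ℝ g) (ε⁻¹ • x) := fun x => by
    have hd : DifferentiableAt ℝ (fun x => fderiv ℝ g (ε⁻¹ • x)) x := by
      have : ContDiff ℝ ∞ (fderiv ℝ g) := hg.fderiv_right (by simp)
      exact (this.differentiable (by simp) (ε⁻¹ • x)).comp x (by fun_prop)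
    rw [fderiv_fun_const_smul hd, fderiv_comp_smul]
  refine ⟨fun x => g (ε⁻¹ • x), hg.comp (contDiff_const_smul _), fun x => hg01 _,
    fun x z hz hxz => hg0 _ _ (mem_image_of_mem _ hz) ?_, fun x hx => hg1 _ ?_, fun x => ⟨?_, ?_⟩⟩
  · rw [hn, div_lt_one hε]; exact hxz
  · rintro _ ⟨z, hz, rfl⟩
    rw [hn, le_div_iff₀ hε]
    exact hx z hz
  · rw [e1, norm_smul, norm_inv, Real.norm_of_nonneg hε.le, div_eq_inv_mul]
    exact mul_le_mul_of_nonneg_left (hgd _).1 (by positivity)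
  · rw [e1, e2, norm_smul, norm_smul, norm_inv, Real.norm_of_nonneg hε.le, div_eq_inv_mul,
      ← mul_assoc, sq, mul_inv]
    exact mul_le_mul_of_nonneg_left (hgd _).2 (by positivity)

/-- The derivatives of the radial projection are bounded along the sphere. -/
theorem exists_norm_fderiv_normalize_le : ∃ D : ℝ, 0 ≤ D ∧ ∀ p : S2,
    ‖fderiv ℝ (fun x : E3 => ‖x‖⁻¹ • x) p‖ ≤ D ∧
      ‖fderiv ℝ (fderiv ℝ (fun x : E3 => ‖x‖⁻¹ • x)) p‖ ≤ D := by
  have hN : ∀ x : E3, x ≠ 0 → ContDiffAt ℝ 2 (fun x : E3 => ‖x‖⁻¹ • x) x := fun x hx =>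
    ((contDiffAt_norm ℝ hx).inv (norm_ne_zero_iff.mpr hx)).smul contDiffAt_id
  have hN1 : ∀ x : E3, x ≠ 0 → ContDiffAt ℝ 1 (fderiv ℝ (fun x : E3 => ‖x‖⁻¹ • x)) x :=
    fun x hx => (hN x hx).fderiv_right (by norm_num)
  have hN2 : ∀ x : E3, x ≠ 0 → ContDiffAt ℝ 0 (fderiv ℝ (fderiv ℝ (fun x : E3 => ‖x‖⁻¹ • x))) x :=
    fun x hx => (hN1 x hx).fderiv_right (by norm_num)
  have c : Continuous fun p : S2 => ‖fderiv ℝ (fun x : E3 => ‖x‖⁻¹ • x) p‖ +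
      ‖fderiv ℝ (fderiv ℝ (fun x : E3 => ‖x‖⁻¹ • x)) p‖ := by
    refine continuous_iff_continuousAt.mpr fun p => ?_
    exact (ContinuousAt.comp (f := fun p : S2 => (p : E3)) (hN1 p (coe_S2_ne_zero p)).continuousAt
      continuous_subtype_val.continuousAt).norm.add
      (ContinuousAt.comp (f := fun p : S2 => (p : E3)) (hN2 p (coe_S2_ne_zero p)).continuousAt
      continuous_subtype_val.continuousAt).norm
  obtain ⟨D, hD⟩ := (isCompact_range c).bddAbove
  have hD' : ∀ p : S2, _ ≤ D := fun p => hD (mem_range_self p)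
  refine ⟨max D 0, le_max_right _ _, fun p => ⟨?_, ?_⟩⟩
  · refine le_trans ?_ (le_max_left _ _)
    exact le_trans (le_add_of_nonneg_right (norm_nonneg _)) (hD' p)
  · refine le_trans ?_ (le_max_left _ _)
    exact le_trans (le_add_of_nonneg_left (norm_nonneg _)) (hD' p)

/-- Cutoff functions on the sphere at scale `ε`, with bounds for the first two derivatives of their
radially constant extensions. -/
theorem exists_sphere_cutoff : ∃ C : ℝ, 0 ≤ C ∧ ∀ (K : Set S2) (ε : ℝ), 0 < ε → ε ≤ 1 →
    ∃ θ : S2 → ℝ, ContMDiff (𝓡 2) 𝓘(ℝ, ℝ) ∞ θ ∧ (∀ p, |θ p| ≤ 1) ∧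
    (∀ p : S2, ∀ z ∈ K, ‖(p : E3) - z‖ < ε → θ p = 0) ∧
    (∀ p : S2, (∀ z ∈ K, 3 * ε ≤ ‖(p : E3) - z‖) → θ p = 1) ∧
    ∀ p : S2, ‖fderiv ℝ (radialExt θ) p‖ ≤ C / ε ∧
      ‖fderiv ℝ (fderiv ℝ (radialExt θ)) p‖ ≤ C / ε ^ 2 := by
  obtain ⟨C, hC0, hC⟩ := exists_cutoff_scaled
  obtain ⟨D, hD0, hD⟩ := exists_norm_fderiv_normalize_le
  refine ⟨C * D + C * D * D + C * D, by positivity, fun K ε hε hε1 => ?_⟩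
  obtain ⟨g, hg, hg01, hg0, hg1, hgd⟩ := hC ((fun p : S2 => (p : E3)) '' K) ε hε
  set N : E3 → E3 := fun x => ‖x‖⁻¹ • x with hNdef
  have hN : ∀ x : E3, x ≠ 0 → ContDiffAt ℝ 2 N x := fun x hx =>
    ((contDiffAt_norm ℝ hx).inv (norm_ne_zero_iff.mpr hx)).smul contDiffAt_id
  have hN1 : ∀ x : E3, x ≠ 0 → DifferentiableAt ℝ (fderiv ℝ N) x :=
    fun x hx => ((hN x hx).fderiv_right (m := 1) (by norm_num)).differentiableAt (by simp)
  have hNd : ∀ x : E3, x ≠ 0 → HasFDerivAt N (fderiv ℝ N x) x := fun x hx =>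
    ((hN x hx).differentiableAt (by simp)).hasFDerivAt
  have hgdiff : Differentiable ℝ g := hg.differentiable (by simp)
  have hg1diff : Differentiable ℝ (fderiv ℝ g) :=
    (hg.fderiv_right (m := ∞) (by simp)).differentiable (by simp)
  have hext : ∀ x : E3, x ≠ 0 → radialExt (fun p : S2 => g p) =ᶠ[𝓝 x] fun y => g (N y) :=
    fun x hx => by
      filter_upwards [isOpen_ne.mem_nhds hx] with y hy
      rw [radialExt_of_ne hy, coe_proj hy]
  have hd1 : ∀ x : E3, x ≠ 0 →
      fderiv ℝ (radialExt fun p : S2 => g p) x = (fderiv ℝ g (N x)).comp (fderiv ℝ N x) :=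
    fun x hx => by
      rw [(hext x hx).fderiv_eq]
      exact ((hgdiff (N x)).hasFDerivAt.comp x (hNd x hx)).fderiv
  have hNp : ∀ p : S2, N p = p := fun p => by simp [hNdef]
  refine ⟨fun p => g p, fun p => contMDiffAt_of_eventuallyEq hg.contDiffAt
    (Eventually.of_forall fun _ => rfl), fun p => abs_le.mpr ⟨by linarith [(hg01 p).1], (hg01 p).2⟩,
    fun p z hz hpz => hg0 _ _ (mem_image_of_mem _ hz) hpz, fun p hp => hg1 _ ?_, fun p => ⟨?_, ?_⟩⟩
  · rintro _ ⟨z, hz, rfl⟩; exact hp z hz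
  · rw [hd1 p (coe_S2_ne_zero p), hNp]
    refine (ContinuousLinearMap.opNorm_comp_le _ _).trans ?_
    have h1 : ‖fderiv ℝ g p‖ * ‖fderiv ℝ N p‖ ≤ C / ε * D :=
      mul_le_mul (hgd p).1 (hD p).1 (norm_nonneg _) (by positivity)
    refine h1.trans ?_
    rw [div_mul_eq_mul_div]
    refine div_le_div_of_nonneg_right ?_ hε.le
    have : 0 ≤ C * D * D := by positivity
    have : 0 ≤ C * D := by positivity
    linarith
  · have hp := coe_S2_ne_zero p
    have hev : fderiv ℝ (radialExt fun p : S2 => g p) =ᶠ[𝓝 (p : E3)]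
        fun x => (fderiv ℝ g (N x)).comp (fderiv ℝ N x) := by
      filter_upwards [isOpen_ne.mem_nhds hp] with x hx using hd1 x hx
    have hd2 := ((hg1diff (N p)).hasFDerivAt.comp (p : E3) (hNd p hp)).clm_comp
      (hN1 p hp).hasFDerivAt
    have hd2' : fderiv ℝ (fun x => (fderiv ℝ g (N x)).comp (fderiv ℝ N x)) p = _ := hd2.fderiv
    rw [hev.fderiv_eq]
    refine ContinuousLinearMap.opNorm_le_bound _ (by positivity) fun w => ?_
    refine ContinuousLinearMap.opNorm_le_bound _ (by positivity) fun v => ?_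
    have hval : fderiv ℝ (fun x => (fderiv ℝ g (N x)).comp (fderiv ℝ N x)) p w v =
        fderiv ℝ g p (fderiv ℝ (fderiv ℝ N) p w v) +
          fderiv ℝ (fderiv ℝ g) p (fderiv ℝ N p w) (fderiv ℝ N p v) := by
      rw [hd2', hNp]
      simp [hNp]
    rw [hval]
    have b1 : ‖fderiv ℝ g p (fderiv ℝ (fderiv ℝ N) p w v)‖ ≤ C / ε * (D * ‖w‖ * ‖v‖) := by
      refine (ContinuousLinearMap.le_opNorm _ _).trans ?_
      refine mul_le_mul (hgd p).1 ?_ (norm_nonneg _) (by positivity)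
      refine (ContinuousLinearMap.le_opNorm₂ _ _ _).trans ?_
      have := (hD p).2
      gcongr
    have b2 : ‖fderiv ℝ (fderiv ℝ g) p (fderiv ℝ N p w) (fderiv ℝ N p v)‖ ≤
        C / ε ^ 2 * (D * ‖w‖) * (D * ‖v‖) := by
      refine (ContinuousLinearMap.le_opNorm₂ _ _ _).trans ?_
      have h2 := (hgd p).2
      have h3 := ((fderiv ℝ N p).le_opNorm w).trans
        (mul_le_mul_of_nonneg_right (hD p).1 (norm_nonneg w))
      have h4 := ((fderiv ℝ N p).le_opNorm v).trans
        (mul_le_mul_of_nonneg_right (hD p).1 (norm_nonneg v))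
      gcongr
    refine (norm_add_le _ _).trans ((add_le_add b1 b2).trans ?_)
    have h5 : C / ε ≤ C / ε ^ 2 := by
      refine div_le_div_of_nonneg_left hC0 (by positivity) ?_
      nlinarith
    calc C / ε * (D * ‖w‖ * ‖v‖) + C / ε ^ 2 * (D * ‖w‖) * (D * ‖v‖)
        ≤ C / ε ^ 2 * (D * ‖w‖ * ‖v‖) + C / ε ^ 2 * (D * ‖w‖) * (D * ‖v‖)
          + C / ε ^ 2 * (D * ‖w‖ * ‖v‖) := by
          have : 0 ≤ C / ε ^ 2 * (D * ‖w‖ * ‖v‖) := by positivity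
          have := mul_le_mul_of_nonneg_right h5 (by positivity : 0 ≤ D * ‖w‖ * ‖v‖)
          linarith
      _ = _ := by ring

/-! ### Approximation by maps with compact support -/

section Product

variable {V : Type*} [NormedAddCommGroup V] [NormedSpace ℝ V] {f : E3 → ℝ} {g : E3 → V} {x : E3}

theorem norm_fderiv_smul_le (hf : DifferentiableAt ℝ f x) (hg : DifferentiableAt ℝ g x) :
    ‖fderiv ℝ (fun y => f y • g y) x‖ ≤
      |f x| * ‖fderiv ℝ g x‖ + ‖fderiv ℝ f x‖ * ‖g x‖ := by
  have h : fderiv ℝ (fun y => f y • g y) x = _ := (hf.hasFDerivAt.smul hg.hasFDerivAt).fderiv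
  rw [h]
  refine (norm_add_le _ _).trans ?_
  rw [norm_smul, Real.norm_eq_abs, ContinuousLinearMap.norm_smulRight_apply]

theorem norm_fderiv_fderiv_mul_le {g : E3 → ℝ} (hf : ContDiffAt ℝ 2 f x)
    (hg : ContDiffAt ℝ 2 g x) :
    ‖fderiv ℝ (fderiv ℝ fun y => f y * g y) x‖ ≤ |f x| * ‖fderiv ℝ (fderiv ℝ g) x‖ +
      2 * ‖fderiv ℝ f x‖ * ‖fderiv ℝ g x‖ + |g x| * ‖fderiv ℝ (fderiv ℝ f) x‖ := by
  have hev : fderiv ℝ (fun y => f y * g y) =ᶠ[𝓝 x]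
      fun y => f y • fderiv ℝ g y + g y • fderiv ℝ f y := by
    filter_upwards [hf.eventually (by simp), hg.eventually (by simp)] with y hfy hgy
    exact fderiv_fun_mul (hfy.differentiableAt (by simp)) (hgy.differentiableAt (by simp))
  have hf1 := (hf.differentiableAt (by simp)).hasFDerivAt
  have hg1 := (hg.differentiableAt (by simp)).hasFDerivAt
  have hf2 := ((hf.fderiv_right (m := 1) (by norm_num)).differentiableAt (by simp)).hasFDerivAt
  have hg2 := ((hg.fderiv_right (m := 1) (by norm_num)).differentiableAt (by simp)).hasFDerivAt
  have h : fderiv ℝ (fun y => f y • fderiv ℝ g y + g y • fderiv ℝ f y) x = _ :=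
    ((hf1.smul hg2).add (hg1.smul hf2)).fderiv
  rw [hev.fderiv_eq, h]
  refine (norm_add_le _ _).trans ?_
  have h1 := norm_add_le (f x • fderiv ℝ (fderiv ℝ g) x)
    ((fderiv ℝ f x).smulRight (fderiv ℝ g x))
  have h2 := norm_add_le (g x • fderiv ℝ (fderiv ℝ f) x)
    ((fderiv ℝ g x).smulRight (fderiv ℝ f x))
  rw [norm_smul, Real.norm_eq_abs, ContinuousLinearMap.norm_smulRight_apply] at h1 h2
  linarith

end Product

theorem isOpen_chordBall (p : S2) (ε : ℝ) : IsOpen {q : S2 | ‖(q : E3) - p‖ < ε} :=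
  isOpen_lt (by fun_prop) continuous_const

/-- Cutting `W` off at distance `ε` from the complement of `Ω` keeps the first derivative of `W` and
the first two derivatives of its support function bounded, uniformly in `ε`: a factor `1 / ε` from
each derivative of the cutoff function is compensated by the order of vanishing. -/
theorem exists_cutoff_bounded {W : S2 → R41} {Ω : Set S2} (hΩ : IsOpen Ω)
    (hW : IsNullOrthogonal W Ω) (hc : ContinuousOn W (closure Ω))
    (h0 : ∀ p ∈ frontier Ω, W p = 0) {C M : ℝ} (hC0 : 0 ≤ C) (hM0 : 0 ≤ M)
    (hC : ∀ p ∈ Ω, ‖fderiv ℝ (radialExt W) p‖ ≤ C) (hM : ∀ p ∈ Ω, ‖W p‖ ≤ M) :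
    ∃ B, ∀ ε : ℝ, 0 < ε → ε ≤ 1 / 8 → ∃ θ : S2 → ℝ, ContMDiff (𝓡 2) 𝓘(ℝ, ℝ) ∞ θ ∧
      (∀ p : S2, ∀ z ∉ Ω, ‖(p : E3) - z‖ < ε → θ p = 0) ∧
      (∀ p : S2, (∀ z ∉ Ω, 3 * ε ≤ ‖(p : E3) - z‖) → θ p = 1) ∧
      ∀ p ∈ Ω, ‖fderiv ℝ (radialExt fun q => θ q • W q) p‖ ≤ B ∧
        ‖fderiv ℝ (radialExt fun q => θ q * support W q) p‖ ≤ B ∧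
        ‖fderiv ℝ (fderiv ℝ (radialExt fun q => θ q * support W q)) p‖ ≤ B := by
  obtain ⟨D, hD0, hD⟩ := exists_sphere_cutoff
  refine ⟨(19 * C + 8 * M) + 552 * (C * D), fun ε hε hε8 => ?_⟩
  obtain ⟨θ, hθ, hθ1, hθz, hθo, hθd⟩ := hD Ωᶜ ε hε (by linarith)
  refine ⟨θ, hθ, hθz, hθo, fun p hp => ?_⟩
  have hx : (p : E3) ∈ cone Ω := coe_mem_cone.mpr hp
  have hpne := coe_S2_ne_zero p
  have hu1 := hW.norm_fderiv_support_le hΩ hp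
  have hu2 := hW.norm_fderiv_fderiv_support_le hΩ hp
  have hCp := hC p hp
  have hMp := hM p hp
  have hCD : 0 ≤ C * D := mul_nonneg hC0 hD0
  by_cases hnear : ∃ z ∉ Ω, ‖(p : E3) - z‖ < 4 * ε
  · obtain ⟨z, hz, hpz⟩ := hnear
    obtain ⟨e1, e2⟩ := hW.exists_boundary_estimates hΩ hc h0 hC hp hz (by linarith)
    set d := ‖(p : E3) - z‖
    have hd0 : 0 ≤ d := norm_nonneg _
    have hWε : ‖W p‖ ≤ 8 * C * ε := e1.trans (by nlinarith)
    have huε : |support W p| ≤ 256 * C * ε ^ 2 := by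
      refine e2.trans ?_
      have : d ^ 2 ≤ (4 * ε) ^ 2 := pow_le_pow_left₀ hd0 hpz.le 2
      nlinarith
    have hθc : ContDiffAt ℝ 2 (radialExt θ) p := contDiffAt_radialExt_of_contMDiff hθ 2 hpne
    have hWd := (hW.hasFDerivAt hΩ hx).differentiableAt
    have huc := hW.contDiffAt_support hΩ 2 hx
    have ev1 : radialExt (fun q => θ q • W q) =ᶠ[𝓝 (p : E3)]
        fun x => radialExt θ x • radialExt W x := by
      filter_upwards [isOpen_ne.mem_nhds hpne] with x hx
      simp only [radialExt_of_ne hx]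
    have ev2 : radialExt (fun q => θ q * support W q) =ᶠ[𝓝 (p : E3)]
        fun x => radialExt θ x * radialExt (support W) x := by
      filter_upwards [isOpen_ne.mem_nhds hpne] with x hx
      simp only [radialExt_of_ne hx]
    have b1 := norm_fderiv_smul_le (hθc.differentiableAt (by simp)) hWd
    have b2 := norm_fderiv_smul_le (hθc.differentiableAt (by simp))
      (huc.differentiableAt (by simp))
    have b3 := norm_fderiv_fderiv_mul_le hθc huc
    simp only [smul_eq_mul, Real.norm_eq_abs] at b2
    rw [ev1.fderiv_eq, ev2.fderiv_eq, ev2.fderiv.fderiv_eq]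
    simp only [radialExt_coe] at b1 b2 b3
    obtain ⟨d1, d2⟩ := hθd p
    have t := hθ1 p
    have k1 : ‖fderiv ℝ (radialExt θ) p‖ * ‖W p‖ ≤ 8 * (C * D) :=
      (mul_le_mul d1 hWε (norm_nonneg _) (by positivity)).trans_eq (by field_simp)
    have k2 : ‖fderiv ℝ (radialExt θ) p‖ * |support W p| ≤ 256 * (C * D) * ε :=
      (mul_le_mul d1 huε (abs_nonneg _) (by positivity)).trans_eq (by field_simp)
    have k2' : 256 * (C * D) * ε ≤ 256 * (C * D) := by nlinarith
    have k3 : |support W p| * ‖fderiv ℝ (fderiv ℝ (radialExt θ)) p‖ ≤ 256 * (C * D) :=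
      (mul_le_mul huε d2 (norm_nonneg _) (by positivity)).trans_eq (by field_simp)
    have k4 : ‖fderiv ℝ (radialExt θ) p‖ * ‖fderiv ℝ (radialExt (support W)) p‖ ≤
        16 * (C * D) :=
      (mul_le_mul d1 (hu1.trans (mul_le_mul_of_nonneg_left hWε (by norm_num))) (norm_nonneg _)
        (by positivity)).trans_eq (by field_simp; ring)
    have m1 : |θ p| * ‖fderiv ℝ (radialExt W) p‖ ≤ C :=
      (mul_le_of_le_one_left (norm_nonneg _) t).trans hCp
    have m2 : |θ p| * ‖fderiv ℝ (radialExt (support W)) p‖ ≤ 2 * M :=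
      (mul_le_of_le_one_left (norm_nonneg _) t).trans (by linarith)
    have m3 : |θ p| * ‖fderiv ℝ (fderiv ℝ (radialExt (support W))) p‖ ≤ 2 * C + 6 * M :=
      (mul_le_of_le_one_left (norm_nonneg _) t).trans (by linarith)
    exact ⟨by linarith, by linarith, by linarith⟩
  · push Not at hnear
    -- far from the complement the cutoff function is constant
    have hev : ∀ᶠ q in 𝓝 p, θ q = 1 := by
      filter_upwards [(isOpen_chordBall p ε).mem_nhds (by simpa using hε)] with q hq
      refine hθo q fun z hz => ?_
      have h1 := hnear z hz
      have h2 := norm_sub_le_norm_sub_add_norm_sub (p : E3) q z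
      rw [norm_sub_rev (p : E3) q] at h2
      have h3 : ‖(q : E3) - p‖ < ε := hq
      linarith
    have ev1 : radialExt (fun q => θ q • W q) =ᶠ[𝓝 (p : E3)] radialExt W :=
      radialExt_eventuallyEq hpne (by
        rw [proj_coe]
        filter_upwards [hev] with q hq
        rw [hq, one_smul])
    have ev2 : radialExt (fun q => θ q * support W q) =ᶠ[𝓝 (p : E3)] radialExt (support W) :=
      radialExt_eventuallyEq hpne (by
        rw [proj_coe]
        filter_upwards [hev] with q hq
        rw [hq, one_mul])
    rw [ev1.fderiv_eq, ev2.fderiv_eq, ev2.fderiv.fderiv_eq]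
    exact ⟨by linarith, by linarith, by linarith⟩

/-- A map that vanishes on the boundary, and its support function, are limits of maps with compact
support in `Ω`. The convergence is pointwise eventual equality, with bounded derivatives. -/
theorem exists_approximation {W : S2 → R41} {Ω : Set S2} (hΩ : IsOpen Ω)
    (hW : IsNullOrthogonal W Ω) (hc : ContinuousOn W (closure Ω))
    (h0 : ∀ p ∈ frontier Ω, W p = 0) {C M : ℝ} (hC0 : 0 ≤ C) (hM0 : 0 ≤ M)
    (hC : ∀ p ∈ Ω, ‖fderiv ℝ (radialExt W) p‖ ≤ C) (hM : ∀ p ∈ Ω, ‖W p‖ ≤ M) :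
    ∃ (B : ℝ) (φ : ℕ → S2 → ℝ) (V : ℕ → S2 → R41),
      (∀ n, IsTestFunction Ω (φ n)) ∧
      (∀ n, ∀ p ∈ Ω, ‖fderiv ℝ (radialExt (φ n)) p‖ ≤ B ∧
        ‖fderiv ℝ (fderiv ℝ (radialExt (φ n))) p‖ ≤ B) ∧
      (∀ p ∈ Ω, ∀ᶠ n in atTop, φ n =ᶠ[𝓝 p] support W) ∧
      (∀ n, ContMDiffOn (𝓡 2) 𝓘(ℝ, R41) ∞ (V n) Ω) ∧
      (∀ n, ∀ p ∉ Ω, V n =ᶠ[𝓝 p] 0) ∧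
      (∀ n, ∀ p ∈ Ω, ‖fderiv ℝ (radialExt (V n)) p‖ ≤ B) ∧
      (∀ p ∈ Ω, ∀ᶠ n in atTop, V n =ᶠ[𝓝 p] W) := by
  obtain ⟨B, hB⟩ := exists_cutoff_bounded hΩ hW hc h0 hC0 hM0 hC hM
  let ε : ℕ → ℝ := fun n => 1 / 8 * (1 / ((n : ℝ) + 1))
  have hε0 : ∀ n, 0 < ε n := fun n => by positivity
  have hε8 : ∀ n, ε n ≤ 1 / 8 := fun n => by
    have : 1 / ((n : ℝ) + 1) ≤ 1 := by
      rw [div_le_one (by positivity)]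
      linarith [Nat.cast_nonneg (α := ℝ) n]
    simp only [ε]
    linarith
  have hεlim : Tendsto ε atTop (𝓝 0) := by
    have := (tendsto_one_div_add_atTop_nhds_zero_nat (𝕜 := ℝ)).const_mul (1 / 8 : ℝ)
    rwa [mul_zero] at this
  choose θ hθ hθz hθo hθB using fun n => hB (ε n) (hε0 n) (hε8 n)
  have hev : ∀ n, ∀ p ∉ Ω, ∀ᶠ q in 𝓝 p, θ n q = 0 := fun n p hp => by
    filter_upwards [(isOpen_chordBall p (ε n)).mem_nhds (by simpa using hε0 n)] with q hq
    exact hθz n q p hp hq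
  have hone : ∀ p ∈ Ω, ∀ᶠ n in atTop, ∀ᶠ q in 𝓝 p, θ n q = 1 := fun p hp => by
    obtain ⟨r, hr, hrΩ⟩ := Metric.isOpen_iff.mp hΩ p hp
    filter_upwards [hεlim.eventually (gt_mem_nhds (show 0 < r / 4 by linarith))] with n hn
    filter_upwards [(isOpen_chordBall p (ε n)).mem_nhds (by simpa using hε0 n)] with q hq
    refine hθo n q fun z hz => ?_
    have h1 : r ≤ ‖(p : E3) - z‖ := by
      by_contra h
      refine hz (hrΩ ?_)
      rw [Metric.mem_ball, Subtype.dist_eq, dist_eq_norm, norm_sub_rev]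
      exact not_le.mp h
    have h2 := norm_sub_le_norm_sub_add_norm_sub (p : E3) q z
    rw [norm_sub_rev (p : E3) q] at h2
    have h3 : ‖(q : E3) - p‖ < ε n := hq
    linarith
  have hVs : ∀ n, ContMDiffOn (𝓡 2) 𝓘(ℝ, R41) ∞ (fun q => θ n q • W q) Ω := fun n =>
    (hθ n).contMDiffOn.smul hW.smooth
  let φ : ℕ → S2 → ℝ := fun n => Ω.indicator fun q => θ n q * support W q
  have hφin : ∀ n, ∀ p ∈ Ω, φ n =ᶠ[𝓝 p] fun q => θ n q * support W q := fun n p hp => by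
    filter_upwards [hΩ.mem_nhds hp] with q hq
    exact indicator_of_mem hq _
  have hφout : ∀ n, ∀ p ∉ Ω, φ n =ᶠ[𝓝 p] 0 := fun n p hp => by
    filter_upwards [hev n p hp] with q hq
    by_cases hqΩ : q ∈ Ω
    · simp [φ, hqΩ, hq]
    · simp [φ, hqΩ]
  have hext : ∀ n, ∀ p ∈ Ω, radialExt (φ n) =ᶠ[𝓝 (p : E3)]
      radialExt fun q => θ n q * support W q := fun n p hp =>
    radialExt_eventuallyEq (coe_S2_ne_zero p) (by rw [proj_coe]; exact hφin n p hp)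
  refine ⟨B, φ, fun n q => θ n q • W q, fun n => ⟨fun p => ?_, fun p hp => ?_⟩,
    fun n p hp => ⟨?_, ?_⟩, fun p hp => ?_, hVs, fun n p hp => ?_, fun n p hp => (hθB n p hp).1,
    fun p hp => ?_⟩
  · by_cases hp : p ∈ Ω
    · have h1 : ContDiffAt ℝ ∞ (radialExt (support W)) p := contDiffAt_infty.mpr fun k =>
        hW.contDiffAt_support hΩ k (coe_mem_cone.mpr hp)
      have h2 : ContMDiffAt (𝓡 2) 𝓘(ℝ, ℝ) ∞ (support W) p :=
        contMDiffAt_of_eventuallyEq h1 (Eventually.of_forall fun q => (radialExt_coe _ q).symm)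
      exact ((hθ n p).mul h2).congr_of_eventuallyEq (hφin n p hp)
    · exact contMDiffAt_const.congr_of_eventuallyEq (hφout n p hp)
  · by_contra hpΩ
    exact (notMem_tsupport_iff_eventuallyEq.mpr (hφout n p hpΩ)) hp
  · rw [(hext n p hp).fderiv_eq]; exact (hθB n p hp).2.1
  · rw [(hext n p hp).fderiv.fderiv_eq]; exact (hθB n p hp).2.2
  · filter_upwards [hone p hp] with n hn
    filter_upwards [hn, hφin n p hp] with q hq1 hq2
    rw [hq2, hq1, one_mul]
  · filter_upwards [hev n p hp] with q hq
    simp [hq]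
  · filter_upwards [hone p hp] with n hn
    filter_upwards [hn] with q hq
    rw [hq, one_smul]

/-! ### The cross term vanishes for maps with compact support -/

/-- The divergence theorem on the sphere for a homogeneous vector field `g` on space. -/
theorem integral_divergence_of_homogeneous {g : Fin 3 → E3 → ℝ} {k : ℕ}
    (hg : ∀ i, ∀ x ≠ 0, ContDiffAt ℝ 1 (g i) x)
    (hom : ∀ i, ∀ r : ℝ, 0 < r → ∀ x, g i (r • x) = (r ^ k)⁻¹ * g i x) :
    ∫ p : S2, ∑ i, fderiv ℝ (g i) p (stdVec i) ∂sphereArea =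
      (2 - k) * ∫ p : S2, ∑ i, (p : E3) i * g i p ∂sphereArea := by
  have hc : ∀ i, Continuous fun p : S2 => g i p := fun i =>
    continuous_iff_continuousAt.mpr fun p => ContinuousAt.comp (f := fun p : S2 => (p : E3))
      (hg i p (coe_S2_ne_zero p)).continuousAt continuous_subtype_val.continuousAt
  have hd : ∀ i, Continuous fun p : S2 => fderiv ℝ (g i) p (stdVec i) := fun i =>
    continuous_iff_continuousAt.mpr fun p => (ContinuousAt.comp (f := fun p : S2 => (p : E3))
      ((hg i p (coe_S2_ne_zero p)).fderiv_right (m := 0) (by norm_num)).continuousAt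
      continuous_subtype_val.continuousAt).clm_apply continuousAt_const
  have hp : ∀ i, Continuous fun p : S2 => (p : E3) i * g i p := fun i =>
    ((continuous_apply i).comp ((PiLp.continuous_ofLp 2 _).comp continuous_subtype_val)).mul (hc i)
  rw [integral_finsetSum _ fun i _ => integrable_of_continuous (hd i),
    integral_finsetSum _ fun i _ => integrable_of_continuous (hp i), Finset.mul_sum]
  refine Finset.sum_congr rfl fun i _ => ?_
  rw [integral_fderiv_of_homogeneous (hg i) (hom i) (stdVec i)]
  simp only [inner_stdVec]

theorem energy_eq_sum_stdVec (W X : S2 → R41) (p : S2) :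
    energy W X p = ∑ i, lor (dY W p (stdVec i)) (dY X p (stdVec i)) := by
  have h := sum_stdVec (lorCLM.bilinearComp (fderiv ℝ (radialExt W) p)
    (fderiv ℝ (radialExt X) p)) p
  simp only [ContinuousLinearMap.bilinearComp_apply, lorCLM_apply, fderiv_radialExt_self,
    lor_zero_left, add_zero] at h
  exact h.symm

theorem continuousOn_fderiv_radialExt {V : Type*} [NormedAddCommGroup V] [NormedSpace ℝ V]
    {F : S2 → V} {Ω : Set S2} (hΩ : IsOpen Ω) (hF : ContMDiffOn (𝓡 2) 𝓘(ℝ, V) ∞ F Ω) :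
    ContinuousOn (fun p : S2 => fderiv ℝ (radialExt F) p) Ω := fun p hp =>
  (ContinuousAt.comp (f := fun p : S2 => (p : E3))
    ((contDiffAt_radialExt hΩ hF (coe_mem_cone.mpr hp)).fderiv_right (m := 0)
      (by norm_num)).continuousAt continuous_subtype_val.continuousAt).continuousWithinAt

theorem continuousOn_energy {W X : S2 → R41} {Ω : Set S2} (hΩ : IsOpen Ω)
    (hW : ContMDiffOn (𝓡 2) 𝓘(ℝ, R41) ∞ W Ω) (hX : ContMDiffOn (𝓡 2) 𝓘(ℝ, R41) ∞ X Ω) :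
    ContinuousOn (energy W X) Ω := by
  have h : energy W X = fun p => ∑ i, lorCLM (dY W p (stdVec i)) (dY X p (stdVec i)) := by
    funext p
    simp only [energy_eq_sum_stdVec, lorCLM_apply]
  rw [h]
  refine continuousOn_finsetSum _ fun i _ => ?_
  exact (continuousOn_const.clm_apply ((continuousOn_fderiv_radialExt hΩ hW).clm_apply
    continuousOn_const)).clm_apply ((continuousOn_fderiv_radialExt hΩ hX).clm_apply
    continuousOn_const)

theorem norm_frame (p : S2) (i : Fin 2) : ‖frame p i‖ = 1 := by
  have h := inner_frame_frame p i i
  rw [if_pos rfl, real_inner_self_eq_norm_sq] at h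
  exact (pow_eq_one_iff_of_nonneg (norm_nonneg _) two_ne_zero).mp h

theorem abs_energy_le (W X : S2 → R41) (p : S2) :
    |energy W X p| ≤ 2 * (‖lorCLM‖ * ‖fderiv ℝ (radialExt W) p‖ * ‖fderiv ℝ (radialExt X) p‖) := by
  have h : ∀ i, |lor (dY W p (frame p i)) (dY X p (frame p i))| ≤
      ‖lorCLM‖ * ‖fderiv ℝ (radialExt W) p‖ * ‖fderiv ℝ (radialExt X) p‖ := fun i => by
    have h1 := (fderiv ℝ (radialExt W) p).le_opNorm (frame p i)
    have h2 := (fderiv ℝ (radialExt X) p).le_opNorm (frame p i)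
    rw [norm_frame, mul_one] at h1 h2
    rw [← lorCLM_apply, ← Real.norm_eq_abs]
    refine (lorCLM.le_opNorm₂ _ _).trans ?_
    gcongr
    · exact h1
    · exact h2
  rw [energy, Fin.sum_univ_two]
  refine (abs_add_le _ _).trans ?_
  linarith [h 0, h 1]

/-- A harmonic map is orthogonal, for the Dirichlet form, to every map with compact support. -/
theorem setIntegral_energy_eq_zero_of_eventuallyEq {X V : S2 → R41} {Ω : Set S2} (hΩ : IsOpen Ω)
    (hX : IsZeroMeanCurvatureGraph X Ω) (hV : ContMDiffOn (𝓡 2) 𝓘(ℝ, R41) ∞ V Ω)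
    (hV0 : ∀ p ∉ Ω, V =ᶠ[𝓝 p] 0) : ∫ p in Ω, energy X V p ∂sphereArea = 0 := by
  have hN := hX.isNullOrthogonal
  let g : Fin 3 → E3 → ℝ := fun i x =>
    lorCLM (fderiv ℝ (radialExt X) x (stdVec i)) (radialExt V x)
  have hzero : ∀ i, ∀ x ≠ 0, x ∉ cone Ω → g i =ᶠ[𝓝 x] fun _ => 0 := fun i x hx hxΩ => by
    have hp : proj x ∉ Ω := fun h => hxΩ ⟨hx, h⟩
    have h := radialExt_eventuallyEq hx (hV0 _ hp)
    filter_upwards [h, isOpen_ne.mem_nhds hx] with y hy hy0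
    simp only [g]
    rw [hy, radialExt_of_ne hy0, Pi.zero_apply, map_zero]
  have hg : ∀ i, ∀ x ≠ 0, ContDiffAt ℝ 1 (g i) x := fun i x hx => by
    by_cases hxΩ : x ∈ cone Ω
    · have h1 : ContDiffAt ℝ 1 (fderiv ℝ (radialExt X)) x :=
        (hN.contDiffAt hΩ 2 hxΩ).fderiv_right (by norm_num)
      have h2 : ContDiffAt ℝ 1 (radialExt V) x :=
        (contDiffAt_radialExt hΩ hV hxΩ).of_le (by exact_mod_cast le_top)
      exact (contDiffAt_const.clm_apply (h1.clm_apply contDiffAt_const)).clm_apply h2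
    · exact contDiffAt_const.congr_of_eventuallyEq (hzero i x hx hxΩ)
  have hom : ∀ i, ∀ r : ℝ, 0 < r → ∀ x, g i (r • x) = (r ^ 1)⁻¹ * g i x := fun i r hr x => by
    simp only [g]
    rw [fderiv_radialExt_smul hr, radialExt_smul hr, pow_one]
    simp
  have hI := integral_divergence_of_homogeneous hg hom
  -- the field is tangent to the sphere
  have hnormal : ∀ p : S2, ∑ i, (p : E3) i * g i p = 0 := fun p => by
    have h : ∑ i, (p : E3) i * g i p =
        lorCLM (fderiv ℝ (radialExt X) p (∑ i, (p : E3) i • stdVec i)) (radialExt V p) := by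
      simp only [map_sum, map_smul, FunLike.coe_sum, Finset.sum_apply, smul_apply, smul_eq_mul, g]
    rw [h, sum_coord_smul_stdVec, fderiv_radialExt_self, map_zero, zero_apply]
  simp only [hnormal, integral_zero, mul_zero] at hI
  have hdiv : ∀ p ∈ Ω, ∑ i, fderiv ℝ (g i) p (stdVec i) = energy X V p := fun p hp => by
    have hx : (p : E3) ∈ cone Ω := coe_mem_cone.mpr hp
    have hV1 : HasFDerivAt (radialExt V) (fderiv ℝ (radialExt V) p) p :=
      ((contDiffAt_radialExt hΩ hV hx).differentiableAt (by simp)).hasFDerivAt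
    have hD := hN.hasFDerivAt_fderiv hΩ hx
    have hd : ∀ i, fderiv ℝ (g i) p (stdVec i) =
        lorCLM (dY X p (stdVec i)) (dY V p (stdVec i)) +
          lorCLM (hessY X p (stdVec i) (stdVec i)) (V p) := fun i => by
      have h : fderiv ℝ (g i) p = _ := (lorCLM.hasFDerivAt_of_bilinear
        (hD.clm_apply (hasFDerivAt_const (stdVec i) (p : E3))) hV1).fderiv
      rw [h]
      simp [dY, hessY]
    have hB := sum_stdVec ((ContinuousLinearMap.compL ℝ E3 R41 ℝ (lorCLM.flip (V p))).comp
      (fderiv ℝ (fderiv ℝ (radialExt X)) p)) p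
    have hpp := fderiv_fderiv_radialExt_self (hN.contDiffAt hΩ 2 hx) (p : E3)
    have hL := congrArg (fun w => lorCLM w (V p)) (laplacian_eq_zero hΩ hX hp)
    simp only [map_sum, FunLike.coe_sum, Finset.sum_apply, map_zero, zero_apply, hessY] at hL
    simp only [ContinuousLinearMap.comp_apply, ContinuousLinearMap.compL_apply,
      ContinuousLinearMap.flip_apply, hL, zero_add] at hB
    simp only [hd, Finset.sum_add_distrib, energy_eq_sum_stdVec, lorCLM_apply]
    simp only [lorCLM_apply] at hB
    rw [show ∑ i, lor (hessY X p (stdVec i) (stdVec i)) (V p) = _ from hB, hpp]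
    simp [fderiv_radialExt_self, lor_zero_left]
  rw [← hI, ← setIntegral_congr_fun hΩ.measurableSet hdiv]
  · refine setIntegral_eq_integral_of_forall_compl_eq_zero fun p hp => ?_
    refine Finset.sum_eq_zero fun i _ => ?_
    rw [(hzero i p (coe_S2_ne_zero p) fun h => hp (coe_mem_cone.mp h)).fderiv_eq]
    simp

/-! ### Passing to maps that vanish on the boundary -/

theorem norm_grad (φ : S2 → ℝ) (p : S2) : ‖grad φ p‖ = ‖fderiv ℝ (radialExt φ) p‖ := by
  rw [grad, gradient, LinearIsometryEquiv.norm_map]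

theorem norm_hess_sq_le (φ : S2 → ℝ) (p : S2) :
    ‖hess φ p‖ ^ 2 ≤ 4 * ‖fderiv ℝ (fderiv ℝ (radialExt φ)) p‖ ^ 2 := by
  have h : ∀ i j, fderiv ℝ (fderiv ℝ (radialExt φ)) p (frame p i) (frame p j) ^ 2 ≤
      ‖fderiv ℝ (fderiv ℝ (radialExt φ)) p‖ ^ 2 := fun i j => by
    have h1 := (fderiv ℝ (fderiv ℝ (radialExt φ)) p).le_opNorm₂ (frame p i) (frame p j)
    rw [norm_frame, norm_frame, mul_one, mul_one] at h1
    rw [← sq_abs, ← Real.norm_eq_abs]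
    exact pow_le_pow_left₀ (norm_nonneg _) h1 2
  rw [norm_hess_sq]
  simp only [Fin.sum_univ_two]
  linarith [h 0 0, h 0 1, h 1 0, h 1 1]

theorem grad_congr {φ ψ : S2 → ℝ} {p : S2} (h : φ =ᶠ[𝓝 p] ψ) : grad φ p = grad ψ p := by
  have h1 := radialExt_eventuallyEq (coe_S2_ne_zero p) (by rwa [proj_coe] : φ =ᶠ[𝓝 (proj p)] ψ)
  rw [grad, grad, gradient, gradient, h1.fderiv_eq]

theorem hess_congr {φ ψ : S2 → ℝ} {p : S2} (h : φ =ᶠ[𝓝 p] ψ) : hess φ p = hess ψ p := by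
  have h1 := radialExt_eventuallyEq (coe_S2_ne_zero p) (by rwa [proj_coe] : φ =ᶠ[𝓝 (proj p)] ψ)
  rw [hess, hess, h1.fderiv.fderiv_eq]

/-- The integrand of the second variation, which for support functions of maps with trace-free shape
form is the Dirichlet integrand minus a multiple of the squared tangential part. -/
def stabilityDensity (Ω : Set S2) (u : S2 → ℝ) (p : S2) : ℝ :=
  1 / 2 * ‖hess u p‖ ^ 2 - 1 / 4 * tr (hess u p) ^ 2 - (buckling Ω - 2) / 4 * ‖grad u p‖ ^ 2

/-- By Bochner's formula the integral is `1 / 4` times the deficit in the buckling inequality. -/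
theorem setIntegral_stabilityDensity_nonneg {Ω : Set S2} {φ : S2 → ℝ} (h : IsTestFunction Ω φ) :
    0 ≤ ∫ p in Ω, stabilityDensity Ω φ p ∂sphereArea := by
  have i1 : Integrable (fun p => 1 / 2 * ‖hess φ p‖ ^ 2) (sphereArea.restrict Ω) :=
    (integrable_of_continuous (((continuous_hess h.1).norm.pow 2).const_mul _)).restrict
  have i2 : Integrable (fun p => 1 / 4 * tr (hess φ p) ^ 2) (sphereArea.restrict Ω) :=
    (integrable_of_continuous (((continuous_tr_hess h).pow 2).const_mul _)).restrict
  have i3 : Integrable (fun p => (buckling Ω - 2) / 4 * ‖grad φ p‖ ^ 2)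
      (sphereArea.restrict Ω) :=
    (integrable_of_continuous (((continuous_grad h.1).norm.pow 2).const_mul _)).restrict
  have e : ∫ p in Ω, stabilityDensity Ω φ p ∂sphereArea = _ := integral_sub (i1.sub i2) i3
  have e2 : ∫ p in Ω, (1 / 2 * ‖hess φ p‖ ^ 2 - 1 / 4 * tr (hess φ p) ^ 2) ∂sphereArea = _ :=
    integral_sub i1 i2
  rw [e]
  rw [e2, integral_const_mul, integral_const_mul, integral_const_mul, setIntegral_norm_hess_sq h]
  linarith [buckling_mul_le h]

section Vanishing

variable {W X : S2 → R41} {Ω : Set S2} (hΩ : IsOpen Ω) (hW : IsNullOrthogonal W Ω)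
  (hc : ContinuousOn W (closure Ω)) (h0 : ∀ p ∈ frontier Ω, W p = 0) {C M : ℝ} (hC0 : 0 ≤ C)
  (hM0 : 0 ≤ M) (hC : ∀ p ∈ Ω, ‖fderiv ℝ (radialExt W) p‖ ≤ C) (hM : ∀ p ∈ Ω, ‖W p‖ ≤ M)
include hΩ hW hc h0 hC0 hM0 hC hM

theorem setIntegral_stabilityDensity_support_nonneg :
    0 ≤ ∫ p in Ω, stabilityDensity Ω (support W) p ∂sphereArea := by
  obtain ⟨B, φ, -, hφ, hB, hlim, -⟩ := exists_approximation hΩ hW hc h0 hC0 hM0 hC hM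
  refine ge_of_tendsto' (tendsto_integral_of_dominated_convergence
    (bound := fun _ => 4 * B ^ 2 + |(buckling Ω - 2) / 4| * B ^ 2) (fun n => ?_)
    (integrable_const _) (fun n => ?_) ?_) fun n => setIntegral_stabilityDensity_nonneg (hφ n)
  · refine Continuous.aestronglyMeasurable ?_
    unfold stabilityDensity
    exact ((((continuous_hess (hφ n).1).norm.pow 2).const_mul _).sub
      (((continuous_tr_hess (hφ n)).pow 2).const_mul _)).sub
      (((continuous_grad (hφ n).1).norm.pow 2).const_mul _)
  · filter_upwards [ae_restrict_mem hΩ.measurableSet] with p hp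
    obtain ⟨b1, b2⟩ := hB n p hp
    have t1 := norm_hess_sq_le (φ n) p
    have t2 := tr_hess_sq_le (φ n) p
    have t3 : ‖fderiv ℝ (fderiv ℝ (radialExt (φ n))) p‖ ^ 2 ≤ B ^ 2 :=
      pow_le_pow_left₀ (norm_nonneg _) b2 2
    have t4 : ‖grad (φ n) p‖ ^ 2 ≤ B ^ 2 := by
      rw [norm_grad]
      exact pow_le_pow_left₀ (norm_nonneg _) b1 2
    have t5 : |(buckling Ω - 2) / 4 * ‖grad (φ n) p‖ ^ 2| ≤
        |(buckling Ω - 2) / 4| * B ^ 2 := by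
      rw [abs_mul, abs_of_nonneg (sq_nonneg ‖grad (φ n) p‖)]
      exact mul_le_mul_of_nonneg_left t4 (abs_nonneg _)
    obtain ⟨t6, t7⟩ := abs_le.mp t5
    rw [Real.norm_eq_abs, stabilityDensity, abs_le]
    constructor <;> nlinarith [sq_nonneg (tr (hess (φ n) p)), sq_nonneg ‖hess (φ n) p‖]
  · filter_upwards [ae_restrict_mem hΩ.measurableSet] with p hp
    refine tendsto_const_nhds.congr' ?_
    filter_upwards [hlim p hp] with n hn
    rw [stabilityDensity, stabilityDensity, grad_congr hn, hess_congr hn]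

theorem setIntegral_energy_eq_zero (hX : IsZeroMeanCurvatureGraph X Ω) :
    ∫ p in Ω, energy X W p ∂sphereArea = 0 := by
  obtain ⟨D, hD⟩ := exists_norm_fderiv_radialExt_le hΩ hX.smooth
  obtain ⟨B, -, V, -, -, -, hV, hV0, hB, hlim⟩ :=
    exists_approximation hΩ hW hc h0 hC0 hM0 hC hM
  have hXs : ContMDiffOn (𝓡 2) 𝓘(ℝ, R41) ∞ X Ω := hX.isNullOrthogonal.smooth
  have h := tendsto_integral_of_dominated_convergence (μ := sphereArea.restrict Ω)
    (F := fun n => energy X (V n)) (f := energy X W)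
    (fun _ => 2 * (‖lorCLM‖ * D * B)) (fun n => ?_) (integrable_const _) (fun n => ?_) ?_
  · simp only [fun n => setIntegral_energy_eq_zero_of_eventuallyEq hΩ hX (hV n) (hV0 n)] at h
    exact tendsto_nhds_unique h tendsto_const_nhds
  · exact (continuousOn_energy hΩ hXs (hV n)).aestronglyMeasurable hΩ.measurableSet
  · filter_upwards [ae_restrict_mem hΩ.measurableSet] with p hp
    have hd := hD p hp
    have hd0 := (norm_nonneg _).trans hd
    rw [Real.norm_eq_abs]
    refine (abs_energy_le _ _ _).trans ?_
    gcongr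
    exact hB n p hp
  · filter_upwards [ae_restrict_mem hΩ.measurableSet] with p hp
    refine tendsto_const_nhds.congr' ?_
    filter_upwards [hlim p hp] with n hn
    have h1 := radialExt_eventuallyEq (coe_S2_ne_zero p)
      (by rwa [proj_coe] : V n =ᶠ[𝓝 (proj p)] W)
    simp only [energy, dY, h1.fderiv_eq]

end Vanishing

/-! ### The area inequality -/

theorem integrableOn_of_bounded {F : S2 → ℝ} {Ω : Set S2} (hΩ : IsOpen Ω)
    (hF : ContinuousOn F Ω) {C : ℝ} (hC : ∀ p ∈ Ω, |F p| ≤ C) : IntegrableOn F Ω sphereArea := by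
  refine Integrable.mono' (integrable_const C) (hF.aestronglyMeasurable hΩ.measurableSet) ?_
  filter_upwards [ae_restrict_mem hΩ.measurableSet] with p hp using hC p hp

theorem integrableOn_energy {W X : S2 → R41} {Ω : Set S2} (hΩ : IsOpen Ω)
    (hW : ContMDiffOn (𝓡 2) 𝓘(ℝ, R41) ∞ W (closure Ω))
    (hX : ContMDiffOn (𝓡 2) 𝓘(ℝ, R41) ∞ X (closure Ω)) :
    IntegrableOn (energy W X) Ω sphereArea := by
  obtain ⟨C, hC⟩ := exists_norm_fderiv_radialExt_le hΩ hW
  obtain ⟨D, hD⟩ := exists_norm_fderiv_radialExt_le hΩ hX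
  refine integrableOn_of_bounded hΩ (continuousOn_energy hΩ (hW.mono subset_closure)
    (hX.mono subset_closure)) (C := 2 * (‖lorCLM‖ * C * D)) fun p hp => ?_
  have hC0 := (norm_nonneg _).trans (hC p hp)
  refine (abs_energy_le _ _ _).trans ?_
  gcongr
  · exact hC p hp
  · exact hD p hp

/-- The area of a marginally trapped graph is its Dirichlet integral. -/
theorem area_eq_energy {Y : S2 → R41} {Ω : Set S2} (hΩ : IsOpen Ω)
    (hY : IsMarginallyTrappedGraph Y Ω) :
    area Y Ω = ENNReal.ofReal (1 / 2 * ∫ p in Ω, energy Y Y p ∂sphereArea) := by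
  have hN := hY.isNullOrthogonal
  rw [← integral_const_mul, ofReal_integral_eq_lintegral_ofReal
    ((integrableOn_energy hΩ hY.smooth hY.smooth).const_mul _)]
  · refine setLIntegral_congr_fun hΩ.measurableSet fun p hp => ?_
    rw [sqrt_det_inducedMetric hΩ hN hp (shapeTrace_eq_zero hΩ hY hp)]
    congr 1
    ring
  · filter_upwards [ae_restrict_mem hΩ.measurableSet] with p hp
    have := energy_self_nonneg hN hp
    simp only [Pi.zero_apply]
    positivity

theorem continuous_tang : Continuous fun z : S2 × E3 => tang z.1 z.2 := by
  unfold tang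
  fun_prop

end SphericalGraph

end

open SphericalGraph in
theorem theorem1 (Ω : Set S2) (hΩ : IsOpen Ω) (hne : Ω.Nonempty) :
    2 ≤ buckling Ω ∧
    ∀ X Y : S2 → R41, IsZeroMeanCurvatureGraph X Ω → IsMarginallyTrappedGraph Y Ω →
      (∀ p ∈ frontier Ω, Y p = X p) →
      area X Ω ≤ area Y Ω ∧
      ENNReal.ofReal ((buckling Ω - 2) / 4) *
          (∫⁻ p in Ω, ‖tang p (X p).1 - tang p (Y p).1‖ₑ ^ 2 ∂sphereArea) + area X Ω ≤ area Y Ω := by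
  have hβ := two_le_buckling hΩ hne
  refine ⟨hβ, fun X Y hX hY hXY => ?_⟩
  suffices h : ENNReal.ofReal ((buckling Ω - 2) / 4) *
      (∫⁻ p in Ω, ‖tang p (X p).1 - tang p (Y p).1‖ₑ ^ 2 ∂sphereArea) + area X Ω ≤ area Y Ω from
    ⟨le_add_self.trans h, h⟩
  have hNX := hX.isNullOrthogonal
  have hNY := hY.isNullOrthogonal
  have hNW := hNY.sub hΩ hNX
  have hWs : ContMDiffOn (𝓡 2) 𝓘(ℝ, R41) ∞ (Y - X) (closure Ω) := hY.smooth.sub hX.smooth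
  have hWc := hWs.continuousOn
  have hW0 : ∀ p ∈ frontier Ω, (Y - X) p = 0 := fun p hp => by simp [hXY p hp]
  obtain ⟨C, hC⟩ := exists_norm_fderiv_radialExt_le hΩ hWs
  obtain ⟨M, hM⟩ := isClosed_closure.isCompact.exists_bound_of_continuousOn hWc
  obtain ⟨p₀, hp₀⟩ := hne
  have hC0 : 0 ≤ C := (norm_nonneg _).trans (hC p₀ hp₀)
  have hM0 : 0 ≤ M := (norm_nonneg _).trans (hM p₀ (subset_closure hp₀))
  have hM' : ∀ p ∈ Ω, ‖(Y - X) p‖ ≤ M := fun p hp => hM p (subset_closure hp)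
  have hS := setIntegral_stabilityDensity_support_nonneg hΩ hNW hWc hW0 hC0 hM0 hC hM'
  have hE := setIntegral_energy_eq_zero hΩ hNW hWc hW0 hC0 hM0 hC hM' hX
  -- the integrals of all terms are finite
  have iYY := integrableOn_energy hΩ hY.smooth hY.smooth
  have iXX := integrableOn_energy hΩ hX.smooth hX.smooth
  have iXW := integrableOn_energy hΩ hX.smooth hWs
  have iT : IntegrableOn (fun p => ‖tang p (X p).1 - tang p (Y p).1‖ ^ 2) Ω sphereArea := by
    have hcont : ∀ {Z : S2 → R41}, ContinuousOn Z (closure Ω) →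
        ContinuousOn (fun p => tang p (Z p).1) (closure Ω) := fun hZ =>
      continuous_tang.comp_continuousOn (continuousOn_id.prodMk hZ.fst)
    have hc := ((hcont hX.smooth.continuousOn).sub (hcont hY.smooth.continuousOn)).norm.pow 2
    obtain ⟨K, hK⟩ := isClosed_closure.isCompact.exists_bound_of_continuousOn hc
    exact integrableOn_of_bounded hΩ (hc.mono subset_closure) fun p hp =>
      hK p (subset_closure hp)
  have hpt : ∀ p ∈ Ω, stabilityDensity Ω (support (Y - X)) p =
      (1 / 2 * energy Y Y p - 1 / 2 * energy X X p - energy X (Y - X) p) -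
        (buckling Ω - 2) / 4 * ‖tang p (X p).1 - tang p (Y p).1‖ ^ 2 := fun p hp => by
    have ht : shapeTrace (Y - X) p = 0 := by
      rw [shapeTrace_sub hΩ hNY hNX hp, shapeTrace_eq_zero hΩ hY hp,
        shapeTrace_eq_zero hΩ hX.isMarginallyTrappedGraph hp, sub_zero]
    have hT : tang p (X p).1 - tang p (Y p).1 = -tang p ((Y - X) p).1 := by
      simp only [tang, Pi.sub_apply, Prod.fst_sub, inner_sub_right, sub_smul]
      abel
    rw [stabilityDensity, hNW.grad_support hΩ hp, hT, norm_neg, energy_sub hΩ hNY hNX hp,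
      energy_eq_hess hΩ hNW hp ht]
    ring
  have hint : ∫ p in Ω, stabilityDensity Ω (support (Y - X)) p ∂sphereArea =
      (1 / 2 * ∫ p in Ω, energy Y Y p ∂sphereArea) - (1 / 2 * ∫ p in Ω, energy X X p ∂sphereArea) -
        (buckling Ω - 2) / 4 *
          ∫ p in Ω, ‖tang p (X p).1 - tang p (Y p).1‖ ^ 2 ∂sphereArea := by
    rw [setIntegral_congr_fun hΩ.measurableSet hpt]
    have j1 : IntegrableOn (fun p => 1 / 2 * energy Y Y p - 1 / 2 * energy X X p) Ω sphereArea :=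
      (iYY.const_mul _).sub (iXX.const_mul _)
    have j2 : IntegrableOn (fun p => 1 / 2 * energy Y Y p - 1 / 2 * energy X X p -
        energy X (Y - X) p) Ω sphereArea := j1.sub iXW
    rw [integral_sub j2 (iT.const_mul _), integral_sub j1 iXW,
      integral_sub (iYY.const_mul _) (iXX.const_mul _), hE, sub_zero, integral_const_mul,
      integral_const_mul, integral_const_mul]
  have hT0 : 0 ≤ ∫ p in Ω, ‖tang p (X p).1 - tang p (Y p).1‖ ^ 2 ∂sphereArea :=
    integral_nonneg fun p => by positivity
  have hX0 : 0 ≤ ∫ p in Ω, energy X X p ∂sphereArea :=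
    setIntegral_nonneg hΩ.measurableSet fun p hp => energy_self_nonneg hNX hp
  have hlint : ∫⁻ p in Ω, ‖tang p (X p).1 - tang p (Y p).1‖ₑ ^ 2 ∂sphereArea =
      ENNReal.ofReal (∫ p in Ω, ‖tang p (X p).1 - tang p (Y p).1‖ ^ 2 ∂sphereArea) := by
    rw [ofReal_integral_eq_lintegral_ofReal iT (Eventually.of_forall fun p => by positivity)]
    refine lintegral_congr fun p => ?_
    rw [ENNReal.ofReal_pow (norm_nonneg _), ofReal_norm]
  rw [hlint, area_eq_energy hΩ hX.isMarginallyTrappedGraph, area_eq_energy hΩ hY,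
    ← ENNReal.ofReal_mul (by linarith), ← ENNReal.ofReal_add (by positivity) (by positivity)]
  refine ENNReal.ofReal_le_ofReal ?_
  linarith
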